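/- **Setting.** Let $V^\pm\in C^\infty(\mathbb R)$ with $V^+(0)=V^-(0)$, let $T>0$, and let $H_1^\pm\in C^\infty(\mathbb R^2\times\mathbb R)$ satisfy $H_1^+(0,y,t)=H_1^-(0,y,t)$ for all $y,t$. Put $H_0^\pm(x,y)=\frac{y^2}{2}+V^\pm(x)$, and let $H_0$, $H_1$ be equal to $H_0^+,H_1^+$ for $x\ge 0$ and to $H_0^-,H_1^-$ for $x<0$; assume that $H_1$ is $T$-periodic in $t$. With $J\nabla H=(\partial_yH,-\partial_xH)$ consider the piecewise-smooth system $$(\dot x,\dot y)=J\nabla(H_0^\pm+\varepsilon H_1^\pm)(x,y,t)\quad\text{for }\pm x>0,$$ with switching manifold $\Sigma=\{x=0\}$; solutions are concatenated at transversal crossings of $\Sigma$, with no loss of energy (coefficient of restitution $r=1$). For $\varepsilon=0$ assume: - **C.1** There are hyperbolic saddles $z^+\in\{x>0\}$ and $z^-\in\{x<0\}$ of $J\nabla H_0^+$ and $J\nabla H_0^-$ with $H_0(z^\pm)=c_1>0$. - **C.2** The origin is an invisible fold-fold of centre type, and $H_0(0,0)=0$. That is, with $X^\pm=J\nabla H_0^\pm$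 and $h(x,y)=x$, the Lie derivatives satisfy $X^\pm h(0,0)=0$, $(X^+)^2h(0,0)<0<(X^-)^2h(0,0)$, and all points near the origin other than the origin lie on periodic orbits surrounding it. - **C.3** There are a heteroclinic orbit from $z^-$ to $z^+$ and one from $z^+$ to $z^-$, contained in $\{H_0=c_1\}$; the closed curve $\Gamma$ that they form with $z^\pm$ surrounds the origin. - **C.4** Let $R$ be the connected component of $\mathbb R^2\setminus\Gamma$ containing the origin, and let $\Lambda_c=\{z\in R: H_0(z)=c\}$. Then $R\setminus\{0\}=\bigcup_{0<c<c_1}\Lambda_c$, and for $0<c<c_1$ the set $\Lambda_c$ is a periodic orbit surrounding the origin and intersecting $\Sigma$ transversally exactly twice. - **C.5** The period of $\Lambda_c$ is a differentiable function of $c\in(0,c_1)$ with strictly positive derivative. For $0<y<\sqrt{2c_1}$ and $h=y^2/2$ let $$\alpha(y)=2\int_0^{(V^+)^{-1}(h)}\frac{dx}{\sqrt{2(h-V^+(x))}}-2\int_0^{(V^-)^{-1}(h)}\frac{dx}{\sqrt{2(h-V^-(x))}},$$ where $(V^+)^{-1}(h)$ is the smallest $x>0$ with $V^+(x)=h$ and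 $(V^-)^{-1}(h)$ is the largest $x<0$ with $V^-(x)=h$; $\alpha(y)$ is the period of the unperturbed orbit through $(0,y)$. Let $P_\varepsilon(y_0,t_0)=(y_2,t_2)$ be the Poincaré impact map: the solution starting at $(0,y_0)$ at time $t_0$, $0<y_0<\sqrt{2c_1}$, runs through $x>0$ until it first hits $\Sigma$ at a point $(0,y_1)$ with $-\sqrt{2c_1}<y_1<0$, and then through $x<0$ until it hits $\Sigma$ again at $(0,y_2)$ with $0<y_2<\sqrt{2c_1}$ at time $t_2$. For positive integers $n,m$, the solution with $(x,y)=(0,y_0)$ at $t=t_0$ is called an *$(n,m)$-periodic orbit* if $m$ is the smallest integer with $P_\varepsilon^m(y_0,t_0)=(y_0,t_0+nT)$, and it is then periodic with period $nT$ and hits $\Sigma$ exactly $2m$ times per period. **Theorem.** Let $n,m\ge 1$ be coprime integers, let $0<\bar y_0<\sqrt{2c_1}$ satisfy $\alpha(\bar y_0)=\frac nm T$, and let $q$ be the unperturbed solution with $q(0)=(0,\bar y_0)$. Suppose that $\bar t_0\in[0,T]$ is a simple zero of the subharmonic Melnikov function $$M^{n,m}(t_0)=\int_0^{nT}\{H_0,H_1\}(q(t),t+t_0)\,dt,\qquad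 \{Q,R\}=\partial_xQ\,\partial_yR-\partial_yQ\,\partial_xR,$$ where the bracket is $\{H_0^+,H_1^+\}$ while $q(t)$ is in $x>0$ and $\{H_0^-,H_1^-\}$ while it is in $x<0$. Then there are $\varepsilon_0>0$ and $K$ such that for every $0<\varepsilon<\varepsilon_0$ there exist $y_0^*,t_0^*$ with $|y_0^*-\bar y_0|\le K\varepsilon$ and $|t_0^*-\bar t_0|\le K\varepsilon$ such that the solution of the perturbed system with $(x,y)=(0,y_0^*)$ at time $t_0^*$ is an $(n,m)$-periodic orbit: it has period $nT$ and hits $\Sigma$ exactly $2m$ times per period. -/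

import Mathlib

open Set Filter Topology
open scoped ContDiff

noncomputable section

/-! ### Planar vector fields -/

/-- The Hamiltonian vector field `J ∇ H` of `H : ℝ² → ℝ`, that is `(∂H/∂y, -∂H/∂x)`. -/
def hamField (H : ℝ × ℝ → ℝ) (z : ℝ × ℝ) : ℝ × ℝ :=
  (deriv (fun y => H (z.1, y)) z.2, -deriv (fun x => H (x, z.2)) z.1)

/-- The Poisson bracket `{Q, R} = ∂Q/∂x ∂R/∂y - ∂Q/∂y ∂R/∂x`. -/
def poissonBracket (Q R : ℝ × ℝ → ℝ) (z : ℝ × ℝ) : ℝ :=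
  deriv (fun x => Q (x, z.2)) z.1 * deriv (fun y => R (z.1, y)) z.2
    - deriv (fun y => Q (z.1, y)) z.2 * deriv (fun x => R (x, z.2)) z.1

/-- The Lie derivative `X f` of a function `f` along a vector field `X`. -/
def lieDeriv (X : ℝ × ℝ → ℝ × ℝ) (f : ℝ × ℝ → ℝ) (z : ℝ × ℝ) : ℝ :=
  fderiv ℝ f z (X z)

/-- `z` is a hyperbolic critical point of saddle type of the vector field `X`. -/
def IsSaddle (X : ℝ × ℝ → ℝ × ℝ) (z : ℝ × ℝ) : Prop :=
  X z = 0 ∧ ∃ a b : ℝ, a < 0 ∧ 0 < b ∧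
    Module.End.HasEigenvalue ((fderiv ℝ X z : ℝ × ℝ →L[ℝ] ℝ × ℝ) : ℝ × ℝ →ₗ[ℝ] ℝ × ℝ) a ∧
    Module.End.HasEigenvalue ((fderiv ℝ X z : ℝ × ℝ →L[ℝ] ℝ × ℝ) : ℝ × ℝ →ₗ[ℝ] ℝ × ℝ) b

/-- The set `C` surrounds the point `p`: the component of `p` in the complement of `C`
is bounded. -/
def Surrounds (C : Set (ℝ × ℝ)) (p : ℝ × ℝ) : Prop :=
  p ∉ C ∧ Bornology.IsBounded (connectedComponentIn Cᶜ p)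

/-- The switching manifold `Σ = {x = 0}`. -/
def switching : Set (ℝ × ℝ) := {z | z.1 = 0}

/-! ### The piecewise smooth Hamiltonian system -/

/-- The data of the piecewise smooth system: the potentials `V^±`, the perturbing
Hamiltonians `H₁^±` and the period `T` of the perturbation. The superscript `+` belongs to
`x > 0` and `-` to `x < 0`. -/
structure PWHamiltonian where
  Vp : ℝ → ℝ
  Vm : ℝ → ℝ
  H1p : ℝ × ℝ → ℝ → ℝ
  H1m : ℝ × ℝ → ℝ → ℝ
  T : ℝ
  Vp_smooth : ContDiff ℝ ∞ Vp
  Vm_smooth : ContDiff ℝ ∞ Vm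
  H1p_smooth : ContDiff ℝ ∞ (fun p : (ℝ × ℝ) × ℝ => H1p p.1 p.2)
  H1m_smooth : ContDiff ℝ ∞ (fun p : (ℝ × ℝ) × ℝ => H1m p.1 p.2)
  V_glue : Vp 0 = Vm 0
  H1_glue : ∀ y t, H1p (0, y) t = H1m (0, y) t
  T_pos : 0 < T
  /-- The piecewise defined perturbation is `T`-periodic in time. -/
  H1_periodic : ∀ z t,
    (if 0 ≤ z.1 then H1p z (t + T) else H1m z (t + T)) = if 0 ≤ z.1 then H1p z t else H1m z t

namespace PWHamiltonian

variable (S : PWHamiltonian)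

def H0p (z : ℝ × ℝ) : ℝ := z.2 ^ 2 / 2 + S.Vp z.1

def H0m (z : ℝ × ℝ) : ℝ := z.2 ^ 2 / 2 + S.Vm z.1

/-- The unperturbed Hamiltonian `H₀`. -/
def H0 (z : ℝ × ℝ) : ℝ := if 0 ≤ z.1 then S.H0p z else S.H0m z

/-- The vector field `X₀^+ + ε X₁^+ = J ∇ (H₀^+ + ε H₁^+)`. -/
def Xp (ε : ℝ) (z : ℝ × ℝ) (t : ℝ) : ℝ × ℝ := hamField (fun w => S.H0p w + ε * S.H1p w t) z

/-- The vector field `X₀^- + ε X₁^- = J ∇ (H₀^- + ε H₁^-)`. -/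
def Xm (ε : ℝ) (z : ℝ × ℝ) (t : ℝ) : ℝ × ℝ := hamField (fun w => S.H0m w + ε * S.H1m w t) z

/-- The unperturbed vector field `X₀^+ = J ∇ H₀^+`. -/
def X0p (z : ℝ × ℝ) : ℝ × ℝ := hamField S.H0p z

/-- The unperturbed vector field `X₀^- = J ∇ H₀^-`. -/
def X0m (z : ℝ × ℝ) : ℝ × ℝ := hamField S.H0m z

/-- `z` solves the piecewise smooth system for all times: it follows the `+` field in `x > 0`
and the `-` field in `x < 0`, and pieces of orbits are concatenated at transversal crossings of
`Σ`, where the two one-sided derivatives are given by the two fields. -/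
def IsSolution (ε : ℝ) (z : ℝ → ℝ × ℝ) : Prop :=
  ∀ t : ℝ,
    (0 < (z t).1 → HasDerivAt z (S.Xp ε (z t) t) t) ∧
    ((z t).1 < 0 → HasDerivAt z (S.Xm ε (z t) t) t) ∧
    ((z t).1 = 0 →
      ((0 < (S.Xm ε (z t) t).1 ∧ 0 < (S.Xp ε (z t) t).1 ∧
          HasDerivWithinAt z (S.Xm ε (z t) t) (Iic t) t ∧
          HasDerivWithinAt z (S.Xp ε (z t) t) (Ici t) t) ∨
        ((S.Xp ε (z t) t).1 < 0 ∧ (S.Xm ε (z t) t).1 < 0 ∧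
          HasDerivWithinAt z (S.Xp ε (z t) t) (Iic t) t ∧
          HasDerivWithinAt z (S.Xm ε (z t) t) (Ici t) t)))

/-- `C` is a periodic orbit of the unperturbed system, with (least) period `p`. -/
def IsPeriodicOrbit (C : Set (ℝ × ℝ)) (p : ℝ) : Prop :=
  ∃ q : ℝ → ℝ × ℝ, S.IsSolution 0 q ∧ range q = C ∧
    IsLeast {s : ℝ | 0 < s ∧ Function.Periodic q s} p

/-- `γ` is a heteroclinic orbit of the unperturbed system from `a` to `b`. -/
def IsHeteroclinic (γ : ℝ → ℝ × ℝ) (a b : ℝ × ℝ) : Prop :=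
  S.IsSolution 0 γ ∧ Tendsto γ atBot (𝓝 a) ∧ Tendsto γ atTop (𝓝 b)

/-! ### The hypotheses on the unperturbed phase portrait -/

/-- `z^±` are hyperbolic saddles in `x > 0` and `x < 0`, on the energy level `c₁ > 0`. -/
structure HasSaddles (zp zm : ℝ × ℝ) (c₁ : ℝ) : Prop where
  c₁_pos : 0 < c₁
  zp_mem : 0 < zp.1
  zm_mem : zm.1 < 0
  zp_saddle : IsSaddle S.X0p zp
  zm_saddle : IsSaddle S.X0m zm
  zp_level : S.H0 zp = c₁
  zm_level : S.H0 zm = c₁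

/-- The origin is an invisible fold-fold of centre type, with `H₀(0,0) = 0`. Here `Prod.fst`
is the function `(x, y) ↦ x` defining `Σ`. -/
structure HasFoldFold : Prop where
  fold_p : lieDeriv S.X0p Prod.fst 0 = 0
  invisible_p : lieDeriv S.X0p (lieDeriv S.X0p Prod.fst) 0 < 0
  fold_m : lieDeriv S.X0m Prod.fst 0 = 0
  invisible_m : 0 < lieDeriv S.X0m (lieDeriv S.X0m Prod.fst) 0
  centre : ∀ᶠ z in 𝓝[≠] (0 : ℝ × ℝ),
    ∃ (C : Set (ℝ × ℝ)) (p : ℝ), z ∈ C ∧ S.IsPeriodicOrbit C p ∧ Surrounds C 0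
  level : S.H0 0 = 0

/-- The closed curve formed by two orbits and the points `zp`, `zm`. -/
def _root_.heteroclinicLoop (zp zm : ℝ × ℝ) (γ₁ γ₂ : ℝ → ℝ × ℝ) : Set (ℝ × ℝ) :=
  {zp, zm} ∪ range γ₁ ∪ range γ₂

/-- `γ₁` and `γ₂` are heteroclinic orbits from `z^-` to `z^+` and from `z^+` to `z^-`; they are
contained in the energy level `c₁` and surround the origin. -/
structure HasHeteroclinics (zp zm : ℝ × ℝ) (c₁ : ℝ) (γ₁ γ₂ : ℝ → ℝ × ℝ) : Prop where
  het₁ : S.IsHeteroclinic γ₁ zm zp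
  het₂ : S.IsHeteroclinic γ₂ zp zm
  level₁ : ∀ t, S.H0 (γ₁ t) = c₁
  level₂ : ∀ t, S.H0 (γ₂ t) = c₁
  surrounds : Surrounds (heteroclinicLoop zp zm γ₁ γ₂) 0

/-- The region enclosed by a closed curve `Γ` around the origin. -/
def _root_.innerRegion (Γ : Set (ℝ × ℝ)) : Set (ℝ × ℝ) := connectedComponentIn Γᶜ 0

/-- The part `Λ_c` of the energy level `H₀ = c` in the region enclosed by `Γ`. -/
def levelSet (Γ : Set (ℝ × ℝ)) (c : ℝ) : Set (ℝ × ℝ) := {z | z ∈ innerRegion Γ ∧ S.H0 z = c}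

/-- The region enclosed by `Γ` is covered, up to the origin, by the `Λ_c` with `0 < c < c₁`, which
are periodic orbits around the origin and cross `Σ` transversally exactly twice. -/
structure HasPeriodicOrbits (c₁ : ℝ) (Γ : Set (ℝ × ℝ)) : Prop where
  covered : innerRegion Γ \ {0} = ⋃ c ∈ Ioo 0 c₁, S.levelSet Γ c
  periodic : ∀ c ∈ Ioo 0 c₁, ∃ p, S.IsPeriodicOrbit (S.levelSet Γ c) p
  surrounds : ∀ c ∈ Ioo 0 c₁, Surrounds (S.levelSet Γ c) 0
  twice : ∀ c ∈ Ioo 0 c₁, (S.levelSet Γ c ∩ switching).ncard = 2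
  transversal : ∀ c ∈ Ioo 0 c₁, ∀ z ∈ S.levelSet Γ c ∩ switching,
    (S.X0p z).1 ≠ 0 ∧ (S.X0m z).1 ≠ 0

/-- The period of `Λ_c` is a differentiable function of `c ∈ (0, c₁)` with positive derivative. -/
def HasIncreasingPeriod (c₁ : ℝ) (Γ : Set (ℝ × ℝ)) : Prop :=
  ∃ per : ℝ → ℝ, (∀ c ∈ Ioo 0 c₁, S.IsPeriodicOrbit (S.levelSet Γ c) (per c)) ∧
    DifferentiableOn ℝ per (Ioo 0 c₁) ∧ ∀ c ∈ Ioo 0 c₁, 0 < deriv per c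

/-! ### The unperturbed period -/

/-- `(V^+)⁻¹(h)`: the first `x > 0` with `V^+(x) = h`. -/
def turnp (h : ℝ) : ℝ := sInf {x | 0 < x ∧ S.Vp x = h}

/-- `(V^-)⁻¹(h)`: the first `x < 0` with `V^-(x) = h`. -/
def turnm (h : ℝ) : ℝ := sSup {x | x < 0 ∧ S.Vm x = h}

/-- The time `α^+(y)` an unperturbed orbit takes from `(0, y)`, `y > 0`, through `x > 0` to `Σ`. -/
def alphap (y : ℝ) : ℝ :=
  2 * ∫ x in (0 : ℝ)..S.turnp (S.H0 (0, y)), 1 / √(2 * (S.H0 (0, y) - S.Vp x))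

/-- The time `α^-(y)` an unperturbed orbit takes from `(0, y)`, `y < 0`, through `x < 0` to `Σ`. -/
def alpham (y : ℝ) : ℝ :=
  -2 * ∫ x in (0 : ℝ)..S.turnm (S.H0 (0, y)), 1 / √(2 * (S.H0 (0, y) - S.Vm x))

/-- The period `α(y) = α^+(y) + α^-(-y)` of the unperturbed orbit through `(0, y)`, `y > 0`. -/
def alpha (y : ℝ) : ℝ := S.alphap y + S.alpham (-y)

/-! ### The subharmonic Melnikov function -/

/-- The piecewise bracket `{H₀, H₁}(z, t)`. -/
def bracket (z : ℝ × ℝ) (t : ℝ) : ℝ :=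
  if 0 ≤ z.1 then poissonBracket S.H0p (fun w => S.H1p w t) z
  else poissonBracket S.H0m (fun w => S.H1m w t) z

/-- The subharmonic Melnikov function along the unperturbed orbit `q`. -/
def melnikov (q : ℝ → ℝ × ℝ) (n : ℕ) (t₀ : ℝ) : ℝ :=
  ∫ t in (0 : ℝ)..n * S.T, S.bracket (q t) (t + t₀)

/-! ### The impact map and `(n, m)`-periodic orbits -/

/-- `P^+_ε(a) = b`, with points `(0, y, t)` of the two sections written as `(y, t)`: the solution
of the `+` field from `(0, y)` at time `t` stays in `x > 0` until it first hits `Σ`, at `b`. -/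
def ImpactP (c₁ ε : ℝ) (a b : ℝ × ℝ) : Prop :=
  a.1 ∈ Ioo 0 √(2 * c₁) ∧ b.1 ∈ Ioo (-√(2 * c₁)) 0 ∧ a.2 < b.2 ∧
    ∃ z : ℝ → ℝ × ℝ,
      (∀ t ∈ Icc a.2 b.2, HasDerivWithinAt z (S.Xp ε (z t) t) (Icc a.2 b.2) t) ∧
      z a.2 = (0, a.1) ∧ z b.2 = (0, b.1) ∧ ∀ t ∈ Ioo a.2 b.2, 0 < (z t).1

/-- `P^-_ε(a) = b`: likewise, for the `-` field in `x < 0`. -/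
def ImpactM (c₁ ε : ℝ) (a b : ℝ × ℝ) : Prop :=
  a.1 ∈ Ioo (-√(2 * c₁)) 0 ∧ b.1 ∈ Ioo 0 √(2 * c₁) ∧ a.2 < b.2 ∧
    ∃ z : ℝ → ℝ × ℝ,
      (∀ t ∈ Icc a.2 b.2, HasDerivWithinAt z (S.Xm ε (z t) t) (Icc a.2 b.2) t) ∧
      z a.2 = (0, a.1) ∧ z b.2 = (0, b.1) ∧ ∀ t ∈ Ioo a.2 b.2, (z t).1 < 0

/-- `P_ε(a) = b` for the Poincaré impact map `P_ε = P^-_ε ∘ P^+_ε`. -/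
def Impact (c₁ ε : ℝ) (a b : ℝ × ℝ) : Prop :=
  ∃ d, S.ImpactP c₁ ε a d ∧ S.ImpactM c₁ ε d b

/-- `P_ε^k(a) = b`. -/
def ImpactIter (c₁ ε : ℝ) : ℕ → ℝ × ℝ → ℝ × ℝ → Prop
  | 0, a, b => a = b
  | k + 1, a, b => ∃ d, S.Impact c₁ ε a d ∧ ImpactIter c₁ ε k d b

/-- The solution of the perturbed system with `(x, y) = (0, y₀)` at time `t₀` is an
`(n, m)`-periodic orbit: `m` is the least integer with `P_ε^m(y₀, t₀) = (y₀, t₀ + nT)`, the solution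
has period `nT` and hits `Σ` exactly `2m` times in each period. -/
structure IsNMPeriodic (c₁ ε : ℝ) (n m : ℕ) (y₀ t₀ : ℝ) : Prop where
  returns : S.ImpactIter c₁ ε m (y₀, t₀) (y₀, t₀ + n * S.T)
  minimal : ∀ j < m, ¬ S.ImpactIter c₁ ε j (y₀, t₀) (y₀, t₀ + n * S.T)
  orbit : ∃ φ : ℝ → ℝ × ℝ, S.IsSolution ε φ ∧ φ t₀ = (0, y₀) ∧
    Function.Periodic φ (n * S.T) ∧
    ∀ s, {t ∈ Ico s (s + n * S.T) | φ t ∈ switching}.encard = 2 * m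

end PWHamiltonian

end

noncomputable section

/-! ### The Poincaré–Miranda theorem in the plane -/

/-! The condition that an orbit return to Σ at the same height `y` degenerates at ε = 0, where
energy conservation makes it hold for every orbit. It is desingularised by adding to position, time
and ε a coordinate `u` with u' = {H₀, H₁}. Then H₀ - εu is constant along solutions (`ext_energy`),
and on Σ both energies are y²/2 plus the same constant. A chain of passages from (y, u = 0) to (y',
u') therefore satisfies y'²/2 - y²/2 = εu'. For ε > 0 the orbit closes after m turns exactly when
the elapsed time is nT and u' = 0, and both equations keep their meaning at ε = 0.

At ε = 0 the time of m turns is m times the period at energy y²/2, which has positive derivative in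
y, and u' at y = ȳ is the Melnikov function. Near a transversal orbit the first-hit map of the
extended system is Lipschitz in all variables, ε included (`exists_lipschitz_transit`). Composing 2m
such maps (`LipReach.comp`), the elapsed time differs from its unperturbed value by O(ε), and u'
differs from M(t) by O(|y - ȳ| + ε). Since the maps are only known to be Lipschitz, the common zero
comes from the Poincaré–Miranda theorem on a box with sides proportional to ε
(`exists_common_zero`); the size of the box is the O(ε) estimate of the statement.

The values at ε = 0 follow from forward uniqueness (`PassIter.time`, `PassIter.follow`), and α is
identified with the least period in `alpha_eq_period`. A closed chain of passages is glued and
continued periodically to a solution (`PassIter.exists_arc`, `Arc.exists_periodic`). Minimality of m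
holds because the impact map is deterministic and strictly increases time (`ImpactIter.not_of_lt`).
-/

theorem mem_Ioo_of_continuous_of_ne {φ : ℝ → ℝ} {a b p r : ℝ} (hab : a ≤ b)
    (hφ : ContinuousOn φ (uIcc a b)) (hp : ∀ s ∈ Icc a b, φ s ≠ p) (hr : ∀ s ∈ Icc a b, φ s ≠ r) :
    φ a ∈ Ioo p r ↔ φ b ∈ Ioo p r := by
  have key : ∀ c, (∀ s ∈ Icc a b, φ s ≠ c) → (φ a < c ↔ φ b < c) := by
    intro c hc
    by_contra hne
    have : c ∈ uIcc (φ a) (φ b) := by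
      rw [mem_uIcc]
      by_cases h : φ a < c
      · left; exact ⟨h.le, not_lt.1 fun h' => hne ⟨fun _ => h', fun _ => h⟩⟩
      · right
        refine ⟨?_, not_lt.1 h⟩
        by_contra h'
        exact hne ⟨fun h2 => (h h2).elim, fun h2 => (h' h2.le).elim⟩
    obtain ⟨s, hs, hs'⟩ := intermediate_value_uIcc hφ this
    rw [uIcc_of_le hab] at hs
    exact hc s hs hs'
  have hpa := hp a (left_mem_Icc.2 hab)
  have hpb := hp b (right_mem_Icc.2 hab)
  have h1 := key p hp
  have h2 := key r hr
  simp only [mem_Ioo]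
  rw [h2]
  have : p < φ a ↔ p < φ b := by
    rw [← not_iff_not, not_lt, not_lt, hpa.le_iff_lt, hpb.le_iff_lt, h1]
  rw [this]

/-- A nowhere vanishing continuous pair of functions on the plane has a continuous argument. -/
theorem exists_continuous_arg {f g : ℝ × ℝ → ℝ} (hf : Continuous f) (hg : Continuous g)
    (h0 : ∀ z, f z ≠ 0 ∨ g z ≠ 0) (z₀ : ℝ × ℝ) :
    ∃ φ : ℝ × ℝ → ℝ, Continuous φ ∧ φ z₀ = Complex.arg ⟨f z₀, g z₀⟩ ∧
      ∀ z, ∃ ρ > 0, f z = ρ * Real.cos (φ z) ∧ g z = ρ * Real.sin (φ z) := by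
  let h : C(ℝ × ℝ, ℂ) := ⟨fun z => ⟨f z, g z⟩, by
    have : (fun z => (⟨f z, g z⟩ : ℂ)) = fun z => (f z : ℂ) + (g z : ℂ) * Complex.I := by
      funext z; apply Complex.ext <;> simp
    rw [this]; fun_prop⟩
  have hne : ∀ z, h z ∈ ({0}ᶜ : Set ℂ) := by
    intro z hz
    have hz' : (⟨f z, g z⟩ : ℂ) = 0 := hz
    rcases h0 z with h1 | h1
    · exact h1 (congrArg Complex.re hz')
    · exact h1 (congrArg Complex.im hz')
  -- The pair is lifted through the covering exp : ℂ → ℂ \ {0}, and the imaginary part of the lift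
  -- is the argument. Starting the lift at `Complex.log` fixes the branch at `z₀`.
  obtain ⟨F, ⟨hF0, hF⟩, -⟩ := Complex.isCoveringMapOn_exp.existsUnique_continuousMap_lifts h
    (a₀ := z₀) (e₀ := Complex.log (h z₀)) (Complex.exp_log (hne z₀)) hne
  refine ⟨fun z => (F z).im, by fun_prop, ?_, fun z => ⟨Real.exp (F z).re, Real.exp_pos _, ?_⟩⟩
  · change (F z₀).im = _
    rw [hF0, Complex.log_im]; rfl
  · have := congrFun hF z
    simp only [Function.comp_apply] at this
    have h1 : f z = (h z).re := rfl
    have h2 : g z = (h z).im := rfl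
    rw [h1, h2, ← this, Complex.exp_re, Complex.exp_im]
    exact ⟨rfl, rfl⟩

/-- Without a common zero, (f, g) has a continuous argument. The signs confine it to a half-plane
along each side, so one circuit of the boundary raises it by a full turn, although it is
single-valued. -/
theorem poincare_miranda {a b c d : ℝ} (hab : a ≤ b) (hcd : c ≤ d) {f g : ℝ × ℝ → ℝ}
    (hf : ContinuousOn f (Icc a b ×ˢ Icc c d)) (hg : ContinuousOn g (Icc a b ×ˢ Icc c d))
    (hfa : ∀ y ∈ Icc c d, f (a, y) < 0) (hfb : ∀ y ∈ Icc c d, 0 < f (b, y))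
    (hgc : ∀ x ∈ Icc a b, g (x, c) < 0) (hgd : ∀ x ∈ Icc a b, 0 < g (x, d)) :
    ∃ z ∈ Icc a b ×ˢ Icc c d, f z = 0 ∧ g z = 0 := by
  by_contra hcon
  -- Clamping to the rectangle extends the pair to the whole plane, where the argument can be
  -- lifted.
  let r : ℝ × ℝ → ℝ × ℝ := fun z => (projIcc a b hab z.1, projIcc c d hcd z.2)
  have hr : Continuous r := by
    refine Continuous.prodMk ?_ ?_
    · exact continuous_subtype_val.comp (continuous_projIcc.comp continuous_fst)
    · exact continuous_subtype_val.comp (continuous_projIcc.comp continuous_snd)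
  have hrmem : ∀ z, r z ∈ Icc a b ×ˢ Icc c d := fun z => ⟨Subtype.prop _, Subtype.prop _⟩
  have hrid : ∀ x ∈ Icc a b, ∀ y ∈ Icc c d, r (x, y) = (x, y) := by
    intro x hx y hy
    simp [r, projIcc_of_mem hab hx, projIcc_of_mem hcd hy]
  have hfr : Continuous (f ∘ r) := hf.comp_continuous hr hrmem
  have hgr : Continuous (g ∘ r) := hg.comp_continuous hr hrmem
  have hne : ∀ z, (f ∘ r) z ≠ 0 ∨ (g ∘ r) z ≠ 0 := by
    intro z
    by_contra h
    rw [not_or, not_not, not_not] at h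
    exact hcon ⟨r z, hrmem z, h⟩
  obtain ⟨φ, hφ, hφ0, hρ⟩ := exists_continuous_arg hfr hgr hne (b, c)
  have ha := left_mem_Icc.2 hab
  have hb := right_mem_Icc.2 hab
  have hc := left_mem_Icc.2 hcd
  have hd := right_mem_Icc.2 hcd
  have hcos : ∀ x ∈ Icc a b, ∀ y ∈ Icc c d,
      (f (x, y) < 0 → Real.cos (φ (x, y)) < 0) ∧ (0 < f (x, y) → 0 < Real.cos (φ (x, y))) ∧
      (g (x, y) < 0 → Real.sin (φ (x, y)) < 0) ∧ (0 < g (x, y) → 0 < Real.sin (φ (x, y))) := by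
    intro x hx y hy
    obtain ⟨ρ, hρ0, h1, h2⟩ := hρ (x, y)
    rw [Function.comp_apply, hrid x hx y hy] at h1 h2
    rw [h1, h2]
    exact ⟨fun h => by nlinarith, fun h => (pos_iff_pos_of_mul_pos h).1 hρ0,
      fun h => by nlinarith, fun h => (pos_iff_pos_of_mul_pos h).1 hρ0⟩
  have hπ := Real.pi_pos
  have cos0 : ∀ k : ℤ, Real.cos (k * Real.pi + Real.pi / 2) = 0 := by
    intro k; rw [Real.cos_add_pi_div_two, Real.sin_int_mul_pi, neg_zero]
  -- the argument along the four sides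
  have hbr : φ (b, c) ∈ Ioo (-(Real.pi / 2)) 0 := by
    rw [hφ0]
    have h1 : 0 < (f ∘ r) (b, c) := by rw [Function.comp_apply, hrid b hb c hc]; exact hfb c hc
    have h2 : (g ∘ r) (b, c) < 0 := by rw [Function.comp_apply, hrid b hb c hc]; exact hgc b hb
    refine ⟨?_, Complex.arg_neg_iff.2 h2⟩
    exact (Complex.neg_pi_div_two_lt_arg_iff.2 (Or.inl h1))
  have htr : φ (b, d) ∈ Ioo (-(Real.pi / 2)) (Real.pi / 2) := by
    refine (mem_Ioo_of_continuous_of_ne (φ := fun s => φ (b, s)) hcd (by fun_prop) ?_ ?_).1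
      ⟨hbr.1, by linarith [hbr.2]⟩
    all_goals
      intro s hs h
      have := (hcos b hb s hs).2.1 (hfb s hs)
      rw [h] at this
      simp at this
  have htr' : φ (b, d) ∈ Ioo 0 Real.pi := by
    refine ⟨?_, by linarith [htr.2]⟩
    by_contra h
    have h1 := (hcos b hb d hd).2.2.2 (hgd b hb)
    have h2 := Real.sin_nonpos_of_nonpos_of_neg_pi_le (not_lt.1 h) (by linarith [htr.1])
    linarith
  have htl : φ (a, d) ∈ Ioo 0 Real.pi := by
    refine (mem_Ioo_of_continuous_of_ne (φ := fun s => φ (s, d)) hab (by fun_prop) ?_ ?_).2 htr'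
    all_goals
      intro s hs h
      have := (hcos s hs d hd).2.2.2 (hgd s hs)
      rw [h] at this
      simp at this
  have htl' : φ (a, d) ∈ Ioo (Real.pi / 2) (3 * Real.pi / 2) := by
    refine ⟨?_, by linarith [htl.2]⟩
    by_contra h
    have h1 := (hcos a ha d hd).1 (hfa d hd)
    have h2 := Real.cos_nonneg_of_neg_pi_div_two_le_of_le (by linarith [htl.1]) (not_lt.1 h)
    linarith
  have hbl : φ (a, c) ∈ Ioo (Real.pi / 2) (3 * Real.pi / 2) := by
    refine (mem_Ioo_of_continuous_of_ne (φ := fun s => φ (a, s)) hcd (by fun_prop) ?_ ?_).2 htl'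
    · intro s hs h
      have := (hcos a ha s hs).1 (hfa s hs)
      rw [h] at this
      simp at this
    · intro s hs h
      have := (hcos a ha s hs).1 (hfa s hs)
      rw [h] at this
      have h3 := cos0 1
      rw [show ((1 : ℤ) : ℝ) * Real.pi + Real.pi / 2 = 3 * Real.pi / 2 by push_cast; ring] at h3
      linarith
  have hbl' : φ (a, c) ∈ Ioo Real.pi (2 * Real.pi) := by
    refine ⟨?_, by linarith [hbl.2]⟩
    by_contra h
    have h1 := (hcos a ha c hc).2.2.1 (hgc a ha)
    have h2 := Real.sin_nonneg_of_nonneg_of_le_pi (by linarith [hbl.1]) (not_lt.1 h)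
    linarith
  -- The bottom side closes the circuit: the value at (b, c), at first in (-π/2, 0), now has to lie
  -- in (π, 2π).
  have hbr' : φ (b, c) ∈ Ioo Real.pi (2 * Real.pi) := by
    refine (mem_Ioo_of_continuous_of_ne (φ := fun s => φ (s, c)) hab (by fun_prop) ?_ ?_).1 hbl'
    all_goals
      intro s hs h
      have := (hcos s hs c hc).2.2.1 (hgc s hs)
      rw [h] at this
      simp at this
  linarith [hbr.2, hbr'.1]

/-! ### Uniqueness for `C¹` vector fields and Lipschitz dependence -/

section ODE

open Metric
open scoped NNReal

variable {E : Type*} [NormedAddCommGroup E] [NormedSpace ℝ E]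

/-- Joint C¹ regularity gives a Lipschitz constant on the compact set `[a, b] × K`, hence one
uniform in time. `K` need not be convex. -/
theorem exists_lipschitzOnWith_image {v : ℝ → E → E}
    (hv : ContDiff ℝ 1 fun p : ℝ × E => v p.1 p.2) {a b : ℝ} {K : Set E} (hK : IsCompact K) :
    ∃ L, ∀ t ∈ Icc a b, LipschitzOnWith L (v t) K := by
  obtain ⟨L, hL⟩ := LocallyLipschitzOn.exists_lipschitzOnWith_of_compact
    ((isCompact_Icc (a := a) (b := b)).prod hK) (hv.locallyLipschitz.locallyLipschitzOn)
  refine ⟨L, fun t ht x hx y hy => ?_⟩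
  have := hL (show (t, x) ∈ Icc a b ×ˢ K from ⟨ht, hx⟩) (show (t, y) ∈ Icc a b ×ˢ K from ⟨ht, hy⟩)
  simpa [Prod.edist_eq] using this

/-- No global Lipschitz bound is needed, since both curves stay in the union of their compact
images. Right derivatives suffice, so curves that switch fields on Σ are admitted. -/
theorem ode_unique_right {v : ℝ → E → E} (hv : ContDiff ℝ 1 fun p : ℝ × E => v p.1 p.2)
    {a b : ℝ} {f g : ℝ → E} (hf : ContinuousOn f (Icc a b))
    (hf' : ∀ t ∈ Ico a b, HasDerivWithinAt f (v t (f t)) (Ici t) t)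
    (hg : ContinuousOn g (Icc a b))
    (hg' : ∀ t ∈ Ico a b, HasDerivWithinAt g (v t (g t)) (Ici t) t) (h : f a = g a) :
    EqOn f g (Icc a b) := by
  obtain ⟨L, hL⟩ := exists_lipschitzOnWith_image hv (a := a) (b := b)
    ((isCompact_Icc.image_of_continuousOn hf).union (isCompact_Icc.image_of_continuousOn hg))
  exact ODE_solution_unique_of_mem_Icc_right (fun t ht => hL t (Ico_subset_Icc_self ht)) hf hf'
    (fun t ht => Or.inl ⟨t, Ico_subset_Icc_self ht, rfl⟩) hg hg'
    (fun t ht => Or.inr ⟨t, Ico_subset_Icc_self ht, rfl⟩) h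

theorem ode_unique_left {v : ℝ → E → E} (hv : ContDiff ℝ 1 fun p : ℝ × E => v p.1 p.2)
    {a b : ℝ} {f g : ℝ → E} (hf : ContinuousOn f (Icc a b))
    (hf' : ∀ t ∈ Ioc a b, HasDerivWithinAt f (v t (f t)) (Iic t) t)
    (hg : ContinuousOn g (Icc a b))
    (hg' : ∀ t ∈ Ioc a b, HasDerivWithinAt g (v t (g t)) (Iic t) t) (h : f b = g b) :
    EqOn f g (Icc a b) := by
  obtain ⟨L, hL⟩ := exists_lipschitzOnWith_image hv (a := a) (b := b)
    ((isCompact_Icc.image_of_continuousOn hf).union (isCompact_Icc.image_of_continuousOn hg))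
  exact ODE_solution_unique_of_mem_Icc_left (fun t ht => hL t (Ioc_subset_Icc_self ht)) hf hf'
    (fun t ht => Or.inl ⟨t, Ioc_subset_Icc_self ht, rfl⟩) hg hg'
    (fun t ht => Or.inr ⟨t, Ioc_subset_Icc_self ht, rfl⟩) h

/-- The function `f` has derivative `f'` on the segment `[a, b]`, one-sided at the end points. -/
def HasDerivOnIcc (f f' : ℝ → E) (a b : ℝ) : Prop :=
  ∀ t ∈ Icc a b, HasDerivWithinAt f (f' t) (Icc a b) t

namespace HasDerivOnIcc

variable {f f' : ℝ → E} {a b : ℝ}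

theorem continuousOn (h : HasDerivOnIcc f f' a b) : ContinuousOn f (Icc a b) :=
  fun t ht => (h t ht).continuousWithinAt

theorem hasDerivAt (h : HasDerivOnIcc f f' a b) {t : ℝ} (ht : t ∈ Ioo a b) :
    HasDerivAt f (f' t) t :=
  (h t (Ioo_subset_Icc_self ht)).hasDerivAt (Icc_mem_nhds ht.1 ht.2)

theorem right (h : HasDerivOnIcc f f' a b) {t : ℝ} (ht : t ∈ Ico a b) :
    HasDerivWithinAt f (f' t) (Ici t) t :=
  (h t (Ico_subset_Icc_self ht)).mono_of_mem_nhdsWithin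
    (mem_of_superset (Icc_mem_nhdsGE ht.2) (Icc_subset_Icc_left ht.1))

theorem left (h : HasDerivOnIcc f f' a b) {t : ℝ} (ht : t ∈ Ioc a b) :
    HasDerivWithinAt f (f' t) (Iic t) t :=
  (h t (Ioc_subset_Icc_self ht)).mono_of_mem_nhdsWithin
    (mem_of_superset (Icc_mem_nhdsLE ht.1) (Icc_subset_Icc_right ht.2))

theorem mono (h : HasDerivOnIcc f f' a b) {c d : ℝ} (hac : a ≤ c) (hdb : d ≤ b) :
    HasDerivOnIcc f f' c d := fun t ht =>
  (h t ⟨hac.trans ht.1, ht.2.trans hdb⟩).mono (Icc_subset_Icc hac hdb)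

theorem comp_sub (h : HasDerivOnIcc f f' a b) (s : ℝ) :
    HasDerivOnIcc (fun t => f (t - s)) (fun t => f' (t - s)) (a + s) (b + s) := by
  intro t ht
  have h1 := h (t - s) ⟨by linarith [ht.1], by linarith [ht.2]⟩
  have h2 : HasDerivWithinAt (fun t : ℝ => t - s) 1 (Icc (a + s) (b + s)) t :=
    ((hasDerivAt_id t).sub_const s).hasDerivWithinAt
  have h3 : MapsTo (fun t : ℝ => t - s) (Icc (a + s) (b + s)) (Icc a b) :=
    fun r hr => ⟨by linarith [hr.1], by linarith [hr.2]⟩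
  simpa [Function.comp_def] using HasDerivWithinAt.scomp t h1 h2 h3

theorem clm_comp {G : Type*} [NormedAddCommGroup G] [NormedSpace ℝ G] (ℓ : E →L[ℝ] G)
    (h : HasDerivOnIcc f f' a b) : HasDerivOnIcc (fun t => ℓ (f t)) (fun t => ℓ (f' t)) a b :=
  fun t ht => ℓ.hasFDerivAt.comp_hasDerivWithinAt t (h t ht)

theorem congr (h : HasDerivOnIcc f f' a b) {g g' : ℝ → E} (hfg : EqOn g f (Icc a b))
    (hfg' : EqOn g' f' (Icc a b)) : HasDerivOnIcc g g' a b := fun t ht => by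
  rw [hfg' ht]; exact (h t ht).congr hfg (hfg ht)

theorem mul_sub_le {f f' : ℝ → ℝ} (h : HasDerivOnIcc f f' a b) {η : ℝ} (hab : a ≤ b)
    (hη : ∀ t ∈ Ioo a b, η ≤ f' t) : η * (b - a) ≤ f b - f a := by
  refine Convex.mul_sub_le_image_sub_of_le_deriv (convex_Icc a b) h.continuousOn ?_ ?_ a
    (left_mem_Icc.2 hab) b (right_mem_Icc.2 hab) hab
  · rw [interior_Icc]
    exact fun t ht => (h.hasDerivAt ht).differentiableAt.differentiableWithinAt
  · rw [interior_Icc]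
    intro t ht
    rw [(h.hasDerivAt ht).deriv]
    exact hη t ht

theorem sub_le_mul {f f' : ℝ → ℝ} (h : HasDerivOnIcc f f' a b) {η : ℝ} (hab : a ≤ b)
    (hη : ∀ t ∈ Ioo a b, f' t ≤ η) : f b - f a ≤ η * (b - a) := by
  have := mul_sub_le (f := fun t => - f t) (f' := fun t => - f' t) (η := -η)
    (fun t ht => (h t ht).neg) hab (fun t ht => neg_le_neg (hη t ht))
  linarith

end HasDerivOnIcc

/-- Solutions of a bounded globally Lipschitz autonomous equation exist on any segment and depend
in a Lipschitz way on the initial value and on time. -/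
theorem exists_flow_of_lipschitz [CompleteSpace E] {F : E → E} {K : ℝ≥0} (hK : LipschitzWith K F)
    {B : ℝ≥0} (hB : ∀ x, ‖F x‖ ≤ B) {T : ℝ} (hT : 0 ≤ T) :
    ∃ φ : E → ℝ → E, (∀ w, φ w 0 = w ∧ HasDerivOnIcc (φ w) (fun s => F (φ w s)) 0 T) ∧
      ∀ w w', ∀ s ∈ Icc 0 T, ∀ s' ∈ Icc 0 T,
        dist (φ w s) (φ w' s') ≤ Real.exp (K * T) * dist w w' + B * |s - s'| := by
  have hex : ∀ w, ∃ α : ℝ → E, α 0 = w ∧ HasDerivOnIcc α (fun s => F (α s)) 0 T := by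
    intro w
    -- A field bounded by `B` moves a point by at most `B * T` in time `T`, so a ball of that radius
    -- cannot be left and `T` may be arbitrary.
    have : IsPicardLindelof (fun _ => F) (⟨0, left_mem_Icc.2 hT⟩ : Icc 0 T) w
        (B * T.toNNReal) 0 B K := by
      refine .of_time_independent (fun x _ => hB x) hK.lipschitzOnWith ?_
      simp [hT]
    exact this.exists_eq_forall_mem_Icc_hasDerivWithinAt₀
  choose φ hφ using hex
  refine ⟨φ, hφ, fun w w' s hs s' hs' => ?_⟩
  have h1 : dist (φ w s) (φ w' s) ≤ Real.exp (K * T) * dist w w' := by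
    have := dist_le_of_trajectories_ODE (v := fun _ => F) (K := K) (fun _ => hK)
      (hφ w).2.continuousOn (fun t ht => (hφ w).2.right ht)
      (hφ w').2.continuousOn (fun t ht => (hφ w').2.right ht)
      (δ := dist w w') (by rw [(hφ w).1, (hφ w').1]) s hs
    refine this.trans ?_
    rw [mul_comm]
    gcongr
    linarith [hs.2]
  have h2 : dist (φ w' s) (φ w' s') ≤ B * |s - s'| := by
    rw [dist_eq_norm, ← Real.norm_eq_abs]
    exact Convex.norm_image_sub_le_of_norm_hasDerivWithin_le (fun t ht => (hφ w').2 t ht)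
      (fun t _ => hB _) (convex_Icc 0 T) hs' hs
  exact (dist_triangle _ _ _).trans (add_le_add h1 h2)

/-- The solution of `ζ' = F(ζ)` from `w` runs through `ℓ > 0` from `ℓ = 0` until it hits `ℓ = 0`
again at `w'`. -/
def Transit (F : E → E) (ℓ : E →L[ℝ] ℝ) (w w' : E) : Prop :=
  ∃ s > 0, ∃ ζ : ℝ → E, ζ 0 = w ∧ ζ s = w' ∧ HasDerivOnIcc ζ (fun r => F (ζ r)) 0 s ∧
    ℓ w = 0 ∧ ℓ w' = 0 ∧ ∀ r ∈ Ioo 0 s, 0 < ℓ (ζ r)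

/-! ### Lipschitz dependence of the first hit on the initial state. -/

theorem exists_cutoff [FiniteDimensional ℝ E] {F : E → E} (hF : ContDiff ℝ 1 F) {R : ℝ}
    (hR : 0 < R) : ∃ G : E → E, ContDiff ℝ 1 G ∧ (∃ K, LipschitzWith K G) ∧
      (∃ B : ℝ≥0, ∀ x, ‖G x‖ ≤ B) ∧ ∀ x ∈ closedBall (0 : E) R, G x = F x := by
  let χ : ContDiffBump (0 : E) := ⟨R, R + 1, hR, by linarith⟩
  have hG : ContDiff ℝ 1 fun x => χ x • F x := χ.contDiff.smul hF
  have hGc : HasCompactSupport fun x => χ x • F x := χ.hasCompactSupport.smul_right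
  obtain ⟨B, hB⟩ := hGc.exists_bound_of_continuous hG.continuous
  refine ⟨fun x => χ x • F x, hG, hG.lipschitzWith_of_hasCompactSupport hGc one_ne_zero,
    ⟨B.toNNReal, fun x => (hB x).trans (Real.le_coe_toNNReal B)⟩, fun x hx => ?_⟩
  simp [χ.one_of_mem_closedBall hx]

/-- Nearby orbits remain close to the reference orbit, while transversality at its two ends excludes
early zeros of `ℓ` and forces a zero near `τ`. There `ℓ` decreases at rate at least `η`, so the
hitting time inherits a Lipschitz bound from the flow. The map is Lipschitz on a full neighbourhood;
`ℓ w = 0` is needed only for the transit itself. -/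
theorem exists_lipschitz_transit [FiniteDimensional ℝ E] {F : E → E} (hF : ContDiff ℝ 1 F)
    (ℓ : E →L[ℝ] ℝ) {τ : ℝ} (hτ : 0 < τ) {ζ : ℝ → E}
    (hζ : HasDerivOnIcc ζ (fun r => F (ζ r)) 0 τ) (h0' : 0 < ℓ (F (ζ 0)))
    (hpos : ∀ r ∈ Ioo 0 τ, 0 < ℓ (ζ r)) (h1 : ℓ (ζ τ) = 0) (h1' : ℓ (F (ζ τ)) < 0) :
    ∃ P : E → E, P (ζ 0) = ζ τ ∧ ∃ U ∈ 𝓝 (ζ 0), (∃ L, LipschitzOnWith L P U) ∧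
      ∀ w ∈ U, ℓ w = 0 → Transit F ℓ w (P w) := by
  have : CompleteSpace E := FiniteDimensional.complete ℝ E
  obtain ⟨R, hR0, hR⟩ : ∃ R > 0, ζ '' Icc 0 τ ⊆ closedBall 0 R := by
    obtain ⟨R, hR⟩ := (isCompact_Icc.image_of_continuousOn hζ.continuousOn).isBounded.subset_closedBall
      (0 : E)
    exact ⟨max R 1, by positivity, hR.trans (closedBall_subset_closedBall (le_max_left _ _))⟩
  -- The margin 1 around the reference orbit, together with `ρ ≤ 1` below, ensures that the nearby
  -- orbits never see the cutoff.
  obtain ⟨G, hG, ⟨K, hK⟩, ⟨B, hB⟩, hGF⟩ := exists_cutoff hF (show 0 < R + 1 by linarith)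
  have hζR : ∀ s ∈ Icc 0 τ, ζ s ∈ closedBall 0 R := fun s hs => hR ⟨s, hs, rfl⟩
  have hGζ : ∀ s ∈ Icc 0 τ, G (ζ s) = F (ζ s) := fun s hs =>
    hGF _ (closedBall_subset_closedBall (by linarith) (hζR s hs))
  obtain ⟨φ, hφ, hLip⟩ := exists_flow_of_lipschitz hK hB (show 0 ≤ τ + 1 by linarith)
  set T := τ + 1 with hT
  set C := Real.exp (K * T) with hC
  have hC0 : 0 < C := Real.exp_pos _
  have href : EqOn (φ (ζ 0)) ζ (Icc 0 τ) := by
    refine ode_unique_right (v := fun _ => G) (hG.comp contDiff_snd)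
      ((hφ _).2.continuousOn.mono (Icc_subset_Icc_right (by linarith)))
      (fun t ht => (hφ _).2.right ⟨ht.1, by linarith [ht.2]⟩) hζ.continuousOn
      (fun t ht => ?_) (hφ _).1
    rw [hGζ t (Ico_subset_Icc_self ht)]
    exact hζ.right ht
  have h0m : (0 : ℝ) ∈ Icc 0 τ := ⟨le_rfl, hτ.le⟩
  have hτm : τ ∈ Icc 0 τ := ⟨hτ.le, le_rfl⟩
  have hg : ∀ w, HasDerivOnIcc (fun s => ℓ (φ w s)) (fun s => ℓ (G (φ w s))) 0 T :=
    fun w => (hφ w).2.clm_comp ℓ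
  have hcont : Continuous fun x => ℓ (G x) := ℓ.continuous.comp hG.continuous
  -- Transversality at both ends, made uniform with rate `η` on balls of radius `ρ`.
  obtain ⟨η, hη, ρ, hρ, hρ1, hρ0, hρτ⟩ : ∃ η > 0, ∃ ρ > 0, ρ ≤ 1 ∧
      (∀ x ∈ ball (ζ 0) ρ, η ≤ ℓ (G x)) ∧ ∀ x ∈ ball (ζ τ) ρ, ℓ (G x) ≤ -η := by
    rw [← hGζ 0 h0m] at h0'
    rw [← hGζ τ hτm] at h1'
    obtain ⟨ρ₁, hρ₁, h2⟩ := Metric.eventually_nhds_iff_ball.1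
      (hcont.continuousAt.eventually (lt_mem_nhds (half_lt_self h0')))
    obtain ⟨ρ₂, hρ₂, h3⟩ := Metric.eventually_nhds_iff_ball.1
      (hcont.continuousAt.eventually (gt_mem_nhds (show ℓ (G (ζ τ)) < ℓ (G (ζ τ)) / 2 by linarith)))
    refine ⟨min (ℓ (G (ζ 0)) / 2) (-(ℓ (G (ζ τ)) / 2)), lt_min (by linarith) (by linarith),
      min 1 (min ρ₁ ρ₂), by positivity, min_le_left _ _, fun x hx => ?_, fun x hx => ?_⟩
    · exact (min_le_left _ _).trans
        (h2 x (ball_subset_ball ((min_le_right _ _).trans (min_le_left _ _)) hx)).le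
    · have h4 := h3 x (ball_subset_ball ((min_le_right _ _).trans (min_le_right _ _)) hx)
      have h5 := min_le_right (ℓ (G (ζ 0)) / 2) (-(ℓ (G (ζ τ)) / 2))
      linarith
  -- During a time `δ` an orbit moves by less than `ρ / 2`; the other half of `ρ` is left for the
  -- change of initial state. The bound `δ ≤ 1` keeps `τ + δ` inside the time span of the flow.
  obtain ⟨δ, hδ, hδτ, hδ1, hδB⟩ : ∃ δ > 0, δ < τ / 2 ∧ δ ≤ 1 ∧ B * δ < ρ / 2 := by
    refine ⟨min (min (τ / 4) 1) (ρ / (4 * (B + 1))), by positivity, ?_, ?_, ?_⟩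
    · have := (min_le_left (min (τ / 4) 1) (ρ / (4 * (B + 1)))).trans (min_le_left _ _)
      linarith
    · exact (min_le_left _ _).trans (min_le_right _ _)
    · have h2 := min_le_right (min (τ / 4) 1) (ρ / (4 * (B + 1)))
      calc (B : ℝ) * min (min (τ / 4) 1) (ρ / (4 * (B + 1)))
          ≤ (B + 1) * (ρ / (4 * (B + 1))) := by
            gcongr
            linarith
        _ = ρ / 4 := by field_simp
        _ < ρ / 2 := by linarith
  obtain ⟨c, hc, hcmin⟩ : ∃ c > 0, ∀ s ∈ Icc δ (τ - δ), c ≤ ℓ (ζ s) := by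
    obtain ⟨s₀, hs₀, hmin⟩ := (isCompact_Icc (a := δ) (b := τ - δ)).exists_isMinOn
      ⟨δ, le_rfl, by linarith⟩ ((ℓ.continuous.comp_continuousOn hζ.continuousOn).mono
        (Icc_subset_Icc hδ.le (by linarith)))
    exact ⟨ℓ (ζ s₀), hpos s₀ ⟨by linarith [hs₀.1], by linarith [hs₀.2]⟩, fun s hs => hmin hs⟩
  -- The error in `ℓ` must be smaller than its minimum `c` on the middle segment, and smaller than
  -- the drop `η * δ` that makes the reference value at `τ + δ` negative.
  obtain ⟨r, hr, hr1, hr2, hr3⟩ : ∃ r > 0, C * r ≤ ρ / 2 ∧ ‖ℓ‖ * (C * r) < c ∧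
      ‖ℓ‖ * (C * r) < η * δ := by
    set M := min (ρ / 2) (min c (η * δ) / (2 * (‖ℓ‖ + 1))) with hM
    have hM0 : 0 < M := by positivity
    have hCr : C * (M / C) = M := by field_simp
    have h2 : ‖ℓ‖ * M < min c (η * δ) := by
      have h3 : M ≤ min c (η * δ) / (2 * (‖ℓ‖ + 1)) := min_le_right _ _
      have h4 : 0 < min c (η * δ) := by positivity
      calc ‖ℓ‖ * M ≤ (‖ℓ‖ + 1) * (min c (η * δ) / (2 * (‖ℓ‖ + 1))) := by
            gcongr
            linarith
        _ = min c (η * δ) / 2 := by field_simp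
        _ < min c (η * δ) := by linarith
    refine ⟨M / C, by positivity, ?_⟩
    rw [hCr]
    exact ⟨min_le_left _ _, h2.trans_le (min_le_left _ _), h2.trans_le (min_le_right _ _)⟩
  have hclose : ∀ w ∈ ball (ζ 0) r, ∀ s ∈ Icc 0 T, ∀ s' ∈ Icc 0 T,
      dist (φ w s) (φ (ζ 0) s') ≤ C * r + B * |s - s'| := fun w hw s hs s' hs' =>
    (hLip w _ s hs s' hs').trans (by gcongr; exact (mem_ball.1 hw).le)
  have hcloseℓ : ∀ w ∈ ball (ζ 0) r, ∀ s ∈ Icc 0 T,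
      |ℓ (φ w s) - ℓ (φ (ζ 0) s)| ≤ ‖ℓ‖ * (C * r) := by
    intro w hw s hs
    rw [← map_sub, ← Real.norm_eq_abs]
    refine (ℓ.le_opNorm _).trans ?_
    gcongr
    simpa [dist_eq_norm] using hclose w hw s hs s hs
  have hderiv0 : ∀ w ∈ ball (ζ 0) r, ∀ s ∈ Icc 0 δ, η ≤ ℓ (G (φ w s)) := by
    intro w hw s hs
    refine hρ0 _ (mem_ball.2 ?_)
    have h2 := hclose w hw s ⟨hs.1, by linarith [hs.2]⟩ 0 ⟨le_rfl, by linarith⟩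
    rw [(hφ _).1, sub_zero, abs_of_nonneg hs.1] at h2
    have : (B : ℝ) * s ≤ B * δ := by gcongr; exact hs.2
    linarith
  have hnear : ∀ w ∈ ball (ζ 0) r, ∀ s ∈ Icc (τ - δ) (τ + δ), φ w s ∈ ball (ζ τ) ρ := by
    intro w hw s hs
    rw [mem_ball]
    have h2 := hclose w hw s ⟨by linarith [hs.1], by linarith [hs.2]⟩ τ ⟨hτ.le, by linarith⟩
    rw [href hτm] at h2
    have h3 : |s - τ| ≤ δ := abs_le.2 ⟨by linarith [hs.1], by linarith [hs.2]⟩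
    have : (B : ℝ) * |s - τ| ≤ B * δ := by gcongr
    linarith
  have hdecr : ∀ w ∈ ball (ζ 0) r, ∀ s ∈ Icc (τ - δ) (τ + δ), ∀ s' ∈ Icc (τ - δ) (τ + δ), s ≤ s' →
      η * (s' - s) ≤ ℓ (φ w s) - ℓ (φ w s') := by
    intro w hw s hs s' hs' hss
    have := ((hg w).mono (c := s) (d := s') (by linarith [hs.1]) (by linarith [hs'.2])).sub_le_mul
      (η := -η) hss (fun t ht => hρτ _ (hnear w hw t ⟨by linarith [hs.1, ht.1],
        by linarith [hs'.2, ht.2]⟩))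
    linarith
  have hmid : ∀ w ∈ ball (ζ 0) r, ∀ s ∈ Icc δ (τ - δ), 0 < ℓ (φ w s) := by
    intro w hw s hs
    have h2 := (abs_le.1 (hcloseℓ w hw s ⟨by linarith [hs.1], by linarith [hs.2]⟩)).1
    rw [href ⟨by linarith [hs.1], by linarith [hs.2]⟩] at h2
    linarith [hcmin s hs]
  have hzero : ∀ w ∈ ball (ζ 0) r, ∃ s ∈ Icc (τ - δ) (τ + δ), ℓ (φ w s) = 0 := by
    intro w hw
    have h2 : ℓ (φ w (τ + δ)) < 0 := by
      have h3 := (abs_le.1 (hcloseℓ w hw (τ + δ) ⟨by linarith, by linarith⟩)).2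
      have h4 := hdecr (ζ 0) (mem_ball_self hr) τ ⟨by linarith, by linarith⟩ (τ + δ)
        ⟨by linarith, by linarith⟩ (by linarith)
      rw [href hτm, h1] at h4
      linarith
    have h3 := hmid w hw (τ - δ) ⟨by linarith, le_rfl⟩
    have h4 : ContinuousOn (fun s => ℓ (φ w s)) (Icc (τ - δ) (τ + δ)) :=
      (hg w).continuousOn.mono (Icc_subset_Icc (by linarith) (by linarith))
    obtain ⟨s, hs, hs'⟩ := intermediate_value_Icc' (by linarith) h4 ⟨h2.le, h3.le⟩
    exact ⟨s, hs, hs'⟩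
  choose! t ht ht0 using hzero
  -- This inverse estimate replaces the implicit function theorem: a small value of `ℓ` at time `s`
  -- bounds the distance from `s` to the hitting time.
  have hexp : ∀ w ∈ ball (ζ 0) r, ∀ s ∈ Icc (τ - δ) (τ + δ), η * |s - t w| ≤ |ℓ (φ w s)| := by
    intro w hw s hs
    rcases le_total s (t w) with h | h
    · have := hdecr w hw s hs (t w) (ht w hw) h
      rw [ht0 w hw] at this
      rw [abs_sub_comm, abs_of_nonneg (sub_nonneg.2 h)]
      linarith [le_abs_self (ℓ (φ w s))]
    · have := hdecr w hw (t w) (ht w hw) s hs h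
      rw [ht0 w hw] at this
      rw [abs_of_nonneg (sub_nonneg.2 h)]
      linarith [neg_abs_le (ℓ (φ w s))]
  have hsub : Icc (τ - δ) (τ + δ) ⊆ Icc 0 T := Icc_subset_Icc (by linarith) (by linarith)
  refine ⟨fun w => φ w (t w), ?_, ball (ζ 0) r, ball_mem_nhds _ hr,
    ⟨(C + B * (‖ℓ‖ * C / η)).toNNReal, ?_⟩, fun w hw hw0 => ?_⟩
  · have h2 := hexp (ζ 0) (mem_ball_self hr) τ ⟨by linarith, by linarith⟩
    rw [href hτm, h1, abs_zero] at h2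
    have h3 : |τ - t (ζ 0)| ≤ 0 := by
      by_contra h
      nlinarith [not_le.1 h]
    have h4 : τ = t (ζ 0) := by
      have := abs_nonpos_iff.1 h3
      linarith
    change φ (ζ 0) (t (ζ 0)) = ζ τ
    rw [← h4, href hτm]
  · refine LipschitzOnWith.of_dist_le_mul fun w hw w' hw' => ?_
    rw [Real.coe_toNNReal _ (by positivity)]
    have h2 : |t w - t w'| ≤ ‖ℓ‖ * C / η * dist w w' := by
      have h3 := hexp w hw (t w') (ht w' hw')
      have h4 : |ℓ (φ w (t w'))| ≤ ‖ℓ‖ * (C * dist w w') := by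
        rw [← sub_zero (ℓ (φ w (t w'))), ← ht0 w' hw', ← map_sub, ← Real.norm_eq_abs]
        refine (ℓ.le_opNorm _).trans ?_
        gcongr
        simpa [dist_eq_norm] using hLip w w' _ (hsub (ht w' hw')) _ (hsub (ht w' hw'))
      rw [abs_sub_comm, div_mul_eq_mul_div, le_div_iff₀ hη]
      linarith
    calc dist (φ w (t w)) (φ w' (t w'))
        ≤ C * dist w w' + B * |t w - t w'| := hLip w w' _ (hsub (ht w hw)) _ (hsub (ht w' hw'))
      _ ≤ C * dist w w' + B * (‖ℓ‖ * C / η * dist w w') := by gcongr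
      _ = _ := by ring
  · have htw := ht w hw
    have hball : ∀ s ∈ Icc 0 (t w), φ w s ∈ closedBall (0 : E) (R + 1) := by
      intro s hs
      rw [mem_closedBall]
      rcases le_total s τ with h | h
      · have h2 := hclose w hw s ⟨hs.1, by linarith⟩ s ⟨hs.1, by linarith⟩
        rw [href ⟨hs.1, h⟩, sub_self, abs_zero, mul_zero, add_zero] at h2
        have h3 := mem_closedBall.1 (hζR s ⟨hs.1, h⟩)
        linarith [dist_triangle (φ w s) (ζ s) 0]
      · have h2 := mem_ball.1 (hnear w hw s ⟨by linarith, by linarith [hs.2, htw.2]⟩)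
        have h3 := mem_closedBall.1 (hζR τ hτm)
        linarith [dist_triangle (φ w s) (ζ τ) 0]
    refine ⟨t w, by linarith [htw.1], φ w, (hφ w).1, rfl, ?_, hw0, ht0 w hw, ?_⟩
    · exact ((hφ w).2.mono le_rfl (by linarith [htw.2])).congr (fun _ _ => rfl)
        (fun s hs => (hGF _ (hball s hs)).symm)
    -- Positivity has a different reason in each regime: `ℓ` grows from 0 up to time `δ`, stays near
    -- the positive reference values until `τ - δ`, and afterwards still has to decrease to 0.
    · intro s hs
      rcases le_total s δ with h | h
      · have := ((hg w).mono (c := 0) (d := s) le_rfl (by linarith [hs.2, htw.2])).mul_sub_le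
          (η := η) hs.1.le (fun x hx => hderiv0 w hw x ⟨hx.1.le, hx.2.le.trans h⟩)
        simp only [(hφ w).1, hw0] at this
        nlinarith [hs.1]
      · rcases le_total s (τ - δ) with h2 | h2
        · exact hmid w hw s ⟨h, h2⟩
        · have := hdecr w hw s ⟨h2, by linarith [hs.2, htw.2]⟩ (t w) htw hs.2.le
          rw [ht0 w hw] at this
          nlinarith [hs.2]

end ODE

/-! ### The extended autonomous system -/

section Extended

/-- The perturbed Hamiltonian vector field `J ∇ (H + ε W(·, t))`. -/
def pertField (H : ℝ × ℝ → ℝ) (W : ℝ × ℝ → ℝ → ℝ) (ε : ℝ) (z : ℝ × ℝ) (t : ℝ) : ℝ × ℝ :=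
  hamField (fun w => H w + ε * W w t) z

/-- States `(z, t, ε, u)`: position, time, parameter and accumulated bracket. -/
abbrev ExtState := (ℝ × ℝ) × ℝ × ℝ × ℝ

/-- The perturbed system as an autonomous system, with `t' = 1`, `ε' = 0`, `u' = {H, W}`. -/
def extField (H : ℝ × ℝ → ℝ) (W : ℝ × ℝ → ℝ → ℝ) (w : ExtState) : ExtState :=
  (pertField H W w.2.2.1 w.1 w.2.1, 1, 0, poissonBracket H (fun v => W v w.2.1) w.1)

theorem hasDerivAt_fst_slice {P : Type*} [NormedAddCommGroup P] [NormedSpace ℝ P]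
    {G : (ℝ × ℝ) × P → ℝ} (hG : ContDiff ℝ ∞ G) (q : (ℝ × ℝ) × P) :
    HasDerivAt (fun x => G ((x, q.1.2), q.2)) (fderiv ℝ G q ((1, 0), 0)) q.1.1 := by
  have h1 : HasDerivAt (fun x : ℝ => (((x, q.1.2), q.2) : (ℝ × ℝ) × P)) ((1, 0), 0) q.1.1 :=
    ((hasDerivAt_id _).prodMk (hasDerivAt_const _ _)).prodMk (hasDerivAt_const _ _)
  exact ((hG.differentiable (by simp)) q).hasFDerivAt.comp_hasDerivAt q.1.1 h1

theorem hasDerivAt_snd_slice {P : Type*} [NormedAddCommGroup P] [NormedSpace ℝ P]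
    {G : (ℝ × ℝ) × P → ℝ} (hG : ContDiff ℝ ∞ G) (q : (ℝ × ℝ) × P) :
    HasDerivAt (fun y => G ((q.1.1, y), q.2)) (fderiv ℝ G q ((0, 1), 0)) q.1.2 := by
  have h1 : HasDerivAt (fun y : ℝ => (((q.1.1, y), q.2) : (ℝ × ℝ) × P)) ((0, 1), 0) q.1.2 :=
    ((hasDerivAt_const _ _).prodMk (hasDerivAt_id _)).prodMk (hasDerivAt_const _ _)
  exact ((hG.differentiable (by simp)) q).hasFDerivAt.comp_hasDerivAt q.1.2 h1

theorem contDiff_deriv_fst {P : Type*} [NormedAddCommGroup P] [NormedSpace ℝ P]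
    {G : (ℝ × ℝ) × P → ℝ} (hG : ContDiff ℝ ∞ G) :
    ContDiff ℝ 1 fun q : (ℝ × ℝ) × P => deriv (fun x => G ((x, q.1.2), q.2)) q.1.1 := by
  simp_rw [fun q => (hasDerivAt_fst_slice hG q).deriv]
  exact (hG.fderiv_right (m := 1) (by decide)).clm_apply contDiff_const

theorem contDiff_deriv_snd {P : Type*} [NormedAddCommGroup P] [NormedSpace ℝ P]
    {G : (ℝ × ℝ) × P → ℝ} (hG : ContDiff ℝ ∞ G) :
    ContDiff ℝ 1 fun q : (ℝ × ℝ) × P => deriv (fun y => G ((q.1.1, y), q.2)) q.1.2 := by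
  simp_rw [fun q => (hasDerivAt_snd_slice hG q).deriv]
  exact (hG.fderiv_right (m := 1) (by decide)).clm_apply contDiff_const

variable {H : ℝ × ℝ → ℝ} {W : ℝ × ℝ → ℝ → ℝ}

/-- With `t` and ε among the coordinates, a single C¹ autonomous field covers all times and
parameters, so regularity in ε is part of regularity in the state. -/
theorem contDiff_extField (hH : ContDiff ℝ ∞ H)
    (hW : ContDiff ℝ ∞ fun p : (ℝ × ℝ) × ℝ => W p.1 p.2) : ContDiff ℝ 1 (extField H W) := by
  have hG : ContDiff ℝ ∞ fun p : (ℝ × ℝ) × ℝ × ℝ × ℝ => H p.1 + p.2.2.1 * W p.1 p.2.1 := by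
    have : ContDiff ℝ ∞ fun p : (ℝ × ℝ) × ℝ × ℝ × ℝ => W p.1 p.2.1 :=
      hW.comp (contDiff_fst.prodMk contDiff_snd.fst)
    fun_prop
  have hH' : ContDiff ℝ ∞ fun p : (ℝ × ℝ) × ℝ × ℝ × ℝ => H p.1 := hH.comp contDiff_fst
  have hW' : ContDiff ℝ ∞ fun p : (ℝ × ℝ) × ℝ × ℝ × ℝ => W p.1 p.2.1 :=
    hW.comp (contDiff_fst.prodMk contDiff_snd.fst)
  refine ContDiff.prodMk (ContDiff.prodMk (contDiff_deriv_snd hG) (contDiff_deriv_fst hG).neg)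
    (contDiff_const.prodMk (contDiff_const.prodMk ?_))
  exact ((contDiff_deriv_fst hH').mul (contDiff_deriv_snd hW')).sub
    ((contDiff_deriv_snd hH').mul (contDiff_deriv_fst hW'))

theorem contDiff_pertField (hH : ContDiff ℝ ∞ H)
    (hW : ContDiff ℝ ∞ fun p : (ℝ × ℝ) × ℝ => W p.1 p.2) (ε : ℝ) :
    ContDiff ℝ 1 fun p : ℝ × ℝ × ℝ => pertField H W ε p.2 p.1 :=
  (contDiff_extField hH hW).fst.comp
    (contDiff_snd.prodMk (contDiff_fst.prodMk (contDiff_const.prodMk contDiff_const)) :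
      ContDiff ℝ 1 fun p : ℝ × ℝ × ℝ => ((p.2, p.1, ε, 0) : ExtState))

theorem continuous_poissonBracket (hH : ContDiff ℝ ∞ H)
    (hW : ContDiff ℝ ∞ fun p : (ℝ × ℝ) × ℝ => W p.1 p.2) :
    Continuous fun p : ℝ × ℝ × ℝ => poissonBracket H (fun v => W v p.1) p.2 :=
  (contDiff_extField hH hW).continuous.snd.snd.snd.comp
    (by fun_prop : Continuous fun p : ℝ × ℝ × ℝ => ((p.2, p.1, 0, 0) : ExtState))

theorem fderiv_pair_apply (hH : ContDiff ℝ ∞ H) (z : ℝ × ℝ) (v : ℝ × ℝ) :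
    fderiv ℝ H z v
      = v.1 * deriv (fun x => H (x, z.2)) z.1 + v.2 * deriv (fun y => H (z.1, y)) z.2 := by
  have hd : DifferentiableAt ℝ H z := (hH.differentiable (by simp)) z
  have h1 : HasDerivAt (fun x => H (x, z.2)) (fderiv ℝ H z (1, 0)) z.1 :=
    hd.hasFDerivAt.comp_hasDerivAt z.1 ((hasDerivAt_id z.1).prodMk (hasDerivAt_const z.1 z.2))
  have h2 : HasDerivAt (fun y => H (z.1, y)) (fderiv ℝ H z (0, 1)) z.2 :=
    hd.hasFDerivAt.comp_hasDerivAt z.2 ((hasDerivAt_const z.2 z.1).prodMk (hasDerivAt_id z.2))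
  rw [h1.deriv, h2.deriv]
  have h3 : v = v.1 • ((1, 0) : ℝ × ℝ) + v.2 • ((0, 1) : ℝ × ℝ) := by ext <;> simp
  conv_lhs => rw [h3, map_add, map_smul, map_smul]
  rfl

theorem pertField_eq (hH : ContDiff ℝ ∞ H)
    (hW : ContDiff ℝ ∞ fun p : (ℝ × ℝ) × ℝ => W p.1 p.2) (ε : ℝ) (z : ℝ × ℝ) (t : ℝ) :
    pertField H W ε z t =
      (deriv (fun y => H (z.1, y)) z.2 + ε * deriv (fun y => W (z.1, y) t) z.2,
        -(deriv (fun x => H (x, z.2)) z.1 + ε * deriv (fun x => W (x, z.2) t) z.1)) := by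
  have hH' : ContDiff ℝ ∞ fun p : (ℝ × ℝ) × ℝ => H p.1 := hH.comp contDiff_fst
  have h1 := (hasDerivAt_fst_slice hH' (z, t)).differentiableAt
  have h2 := (hasDerivAt_snd_slice hH' (z, t)).differentiableAt
  have h3 := (hasDerivAt_fst_slice hW (z, t)).differentiableAt
  have h4 := (hasDerivAt_snd_slice hW (z, t)).differentiableAt
  have h5 := (h1.hasDerivAt.add (h3.hasDerivAt.const_mul ε)).deriv
  have h6 := (h2.hasDerivAt.add (h4.hasDerivAt.const_mul ε)).deriv
  exact Prod.ext h6 (congrArg Neg.neg h5)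

theorem HasDerivOnIcc.sub_eq_of_const {f : ℝ → ℝ} {a b k : ℝ}
    (h : HasDerivOnIcc f (fun _ => k) a b) (hab : a ≤ b) : f b - f a = k * (b - a) :=
  le_antisymm (h.sub_le_mul hab fun _ _ => le_rfl) (h.mul_sub_le hab fun _ _ => le_rfl)

variable {ζ : ℝ → ExtState} {s : ℝ}

theorem ext_time (h : HasDerivOnIcc ζ (fun r => extField H W (ζ r)) 0 s) {r : ℝ}
    (hr : r ∈ Icc 0 s) : (ζ r).2.1 = (ζ 0).2.1 + r := by
  have := ((h.mono le_rfl hr.2).clm_comp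
    ((ContinuousLinearMap.fst ℝ ℝ (ℝ × ℝ)).comp (ContinuousLinearMap.snd ℝ (ℝ × ℝ) (ℝ × ℝ × ℝ))))
  have := HasDerivOnIcc.sub_eq_of_const (k := 1) this hr.1
  simp only [ContinuousLinearMap.comp_apply, ContinuousLinearMap.coe_fst',
    ContinuousLinearMap.coe_snd'] at this
  linarith

theorem ext_param (h : HasDerivOnIcc ζ (fun r => extField H W (ζ r)) 0 s) {r : ℝ}
    (hr : r ∈ Icc 0 s) : (ζ r).2.2.1 = (ζ 0).2.2.1 := by
  have := ((h.mono le_rfl hr.2).clm_comp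
    ((ContinuousLinearMap.fst ℝ ℝ ℝ).comp ((ContinuousLinearMap.snd ℝ ℝ (ℝ × ℝ)).comp
      (ContinuousLinearMap.snd ℝ (ℝ × ℝ) (ℝ × ℝ × ℝ)))))
  have := HasDerivOnIcc.sub_eq_of_const (k := 0) this hr.1
  simp only [ContinuousLinearMap.comp_apply, ContinuousLinearMap.coe_fst',
    ContinuousLinearMap.coe_snd'] at this
  linarith

/-- Since {H, H} = 0, the derivative of `H` along J∇(H + εW) is ε{H, W}, which is ε times the
derivative of `u`. -/
theorem ext_energy (hH : ContDiff ℝ ∞ H) (hW : ContDiff ℝ ∞ fun p : (ℝ × ℝ) × ℝ => W p.1 p.2)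
    (h : HasDerivOnIcc ζ (fun r => extField H W (ζ r)) 0 s) {r : ℝ} (hr : r ∈ Icc 0 s) :
    H (ζ r).1 - (ζ 0).2.2.1 * (ζ r).2.2.2 = H (ζ 0).1 - (ζ 0).2.2.1 * (ζ 0).2.2.2 := by
  have hz := (h.mono le_rfl hr.2).clm_comp (ContinuousLinearMap.fst ℝ (ℝ × ℝ) (ℝ × ℝ × ℝ))
  have hu := (h.mono le_rfl hr.2).clm_comp
    ((ContinuousLinearMap.snd ℝ ℝ ℝ).comp ((ContinuousLinearMap.snd ℝ ℝ (ℝ × ℝ)).comp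
      (ContinuousLinearMap.snd ℝ (ℝ × ℝ) (ℝ × ℝ × ℝ))))
  have hE : HasDerivOnIcc (fun x => H (ζ x).1 - (ζ 0).2.2.1 * (ζ x).2.2.2) (fun _ => 0) 0 r := by
    intro x hx
    have h1 := ((hH.differentiable (by simp)) (ζ x).1).hasFDerivAt.comp_hasDerivWithinAt x (hz x hx)
    have h2 := (hu x hx).const_mul (ζ 0).2.2.1
    have h3 := h1.sub h2
    refine h3.congr_deriv ?_
    rw [fderiv_pair_apply hH]
    have h4 := ext_param h (r := x) ⟨hx.1, hx.2.trans hr.2⟩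
    simp only [ContinuousLinearMap.comp_apply, ContinuousLinearMap.coe_fst',
      ContinuousLinearMap.coe_snd', extField, pertField_eq hH hW, h4, poissonBracket]
    ring
  have := hE.sub_eq_of_const hr.1
  simp only [zero_mul] at this
  linarith

/-- The planar orbit underlying a transit of the extended system. -/
theorem Transit.exists_orbit (hH : ContDiff ℝ ∞ H)
    (hW : ContDiff ℝ ∞ fun p : (ℝ × ℝ) × ℝ => W p.1 p.2) {ℓ : ℝ × ℝ →L[ℝ] ℝ} {w w' : ExtState}
    (h : Transit (extField H W) (ℓ.comp (ContinuousLinearMap.fst ℝ _ _)) w w') :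
    ∃ z : ℝ → ℝ × ℝ, w.2.1 < w'.2.1 ∧
      HasDerivOnIcc z (fun r => pertField H W w.2.2.1 (z r) r) w.2.1 w'.2.1 ∧
      z w.2.1 = w.1 ∧ z w'.2.1 = w'.1 ∧ w'.2.2.1 = w.2.2.1 ∧
      H w'.1 - w.2.2.1 * w'.2.2.2 = H w.1 - w.2.2.1 * w.2.2.2 ∧
      w'.2.2.2 - w.2.2.2 = (∫ r in w.2.1..w'.2.1, poissonBracket H (fun v => W v r) (z r)) ∧
      ℓ w.1 = 0 ∧ ℓ w'.1 = 0 ∧ ∀ r ∈ Ioo w.2.1 w'.2.1, 0 < ℓ (z r) := by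
  obtain ⟨s, hs, ζ, rfl, rfl, hζ, h0, h1, hpos⟩ := h
  have ht := ext_time hζ (r := s) ⟨hs.le, le_rfl⟩
  have hsh := hζ.comp_sub (ζ 0).2.1
  have hz := hsh.clm_comp (ContinuousLinearMap.fst ℝ (ℝ × ℝ) (ℝ × ℝ × ℝ))
  have hu := hsh.clm_comp
    ((ContinuousLinearMap.snd ℝ ℝ ℝ).comp ((ContinuousLinearMap.snd ℝ ℝ (ℝ × ℝ)).comp
      (ContinuousLinearMap.snd ℝ (ℝ × ℝ) (ℝ × ℝ × ℝ))))
  rw [zero_add, add_comm s, ← ht] at hz hu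
  have htr : ∀ r ∈ Icc (ζ 0).2.1 (ζ s).2.1, (ζ (r - (ζ 0).2.1)).2.1 = r := by
    intro r hr
    rw [ext_time hζ ⟨by linarith [hr.1], by linarith [hr.2]⟩]
    ring
  have hzd : HasDerivOnIcc (fun r => (ζ (r - (ζ 0).2.1)).1)
      (fun r => pertField H W (ζ 0).2.2.1 (ζ (r - (ζ 0).2.1)).1 r) (ζ 0).2.1 (ζ s).2.1 := by
    refine hz.congr (fun _ _ => rfl) fun r hr => ?_
    simp only [ContinuousLinearMap.coe_fst', extField]
    rw [htr r hr, ext_param hζ (r := r - (ζ 0).2.1) ⟨by linarith [hr.1], by linarith [hr.2]⟩]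
  refine ⟨fun r => (ζ (r - (ζ 0).2.1)).1, by linarith, hzd, by simp, ?_,
    ext_param hζ ⟨hs.le, le_rfl⟩, ext_energy hH hW hζ ⟨hs.le, le_rfl⟩, ?_, h0, h1, ?_⟩
  · simp only [ht, add_sub_cancel_left]
  · have hle : (ζ 0).2.1 ≤ (ζ s).2.1 := by linarith
    have hud : HasDerivOnIcc (fun r => (ζ (r - (ζ 0).2.1)).2.2.2)
        (fun r => poissonBracket H (fun v => W v r) (ζ (r - (ζ 0).2.1)).1)
        (ζ 0).2.1 (ζ s).2.1 := by
      refine hu.congr (fun _ _ => rfl) fun r hr => ?_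
      simp only [ContinuousLinearMap.comp_apply, ContinuousLinearMap.coe_snd', extField]
      rw [htr r hr]
    rw [intervalIntegral.integral_eq_sub_of_hasDerivAt_of_le hle hud.continuousOn
      (fun r hr => hud.hasDerivAt hr)]
    · simp only [ht, add_sub_cancel_left, sub_self]
    · refine ContinuousOn.intervalIntegrable_of_Icc hle ?_
      exact (continuous_poissonBracket hH hW).comp_continuousOn
        (continuousOn_id.prodMk hzd.continuousOn)
  · intro r hr
    exact hpos (r - (ζ 0).2.1) ⟨by linarith [hr.1], by linarith [hr.2]⟩

/-- A planar orbit lifts to the extended system. -/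
theorem exists_ext_orbit (hH : ContDiff ℝ ∞ H)
    (hW : ContDiff ℝ ∞ fun p : (ℝ × ℝ) × ℝ => W p.1 p.2) {ε a b : ℝ} (hab : a ≤ b)
    {z : ℝ → ℝ × ℝ} (hz : HasDerivOnIcc z (fun r => pertField H W ε (z r) r) a b) (u : ℝ) :
    ∃ ζ : ℝ → ExtState, ζ 0 = (z a, a, ε, u) ∧ (∀ r, (ζ r).1 = z (r + a)) ∧
      (∀ r, (ζ r).2.1 = r + a) ∧ (∀ r, (ζ r).2.2.1 = ε) ∧
      HasDerivOnIcc ζ (fun r => extField H W (ζ r)) 0 (b - a) := by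
  let β : ℝ → ℝ := fun r => poissonBracket H (fun v => W v r) (z r)
  have hβ : ContinuousOn β (Icc a b) := (continuous_poissonBracket hH hW).comp_continuousOn
        (continuousOn_id.prodMk hz.continuousOn)
  -- The bracket along `z` is controlled only on `[a, b]`. Extending it by its end values makes the
  -- integral differentiable at every time.
  let g : ℝ → ℝ := IccExtend hab ((Icc a b).domRestrict β)
  have hg : Continuous g := (continuousOn_iff_continuous_domRestrict.1 hβ).Icc_extend'
  have hgβ : EqOn g β (Icc a b) := fun r hr => by
    simp [g, IccExtend_of_mem hab _ hr, domRestrict]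
  let U : ℝ → ℝ := fun r => u + ∫ x in a..r, g x
  have hU : ∀ r, HasDerivAt U (g r) r := fun r =>
    (intervalIntegral.integral_hasDerivAt_right (hg.intervalIntegrable _ _)
      (hg.stronglyMeasurableAtFilter _ _) hg.continuousAt).const_add u
  have hζ : HasDerivOnIcc (fun r => ((z r, r, ε, U r) : ExtState))
      (fun r => extField H W (z r, r, ε, U r)) a b := by
    intro r hr
    have h1 := (hz r hr).prodMk ((hasDerivWithinAt_id r (Icc a b)).prodMk
      ((hasDerivWithinAt_const r (Icc a b) ε).prodMk (hU r).hasDerivWithinAt))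
    rw [hgβ hr] at h1
    exact h1
  have := hζ.comp_sub (-a)
  simp only [sub_neg_eq_add] at this
  rw [add_neg_cancel, ← sub_eq_add_neg] at this
  refine ⟨fun r => (z (r + a), r + a, ε, U (r + a)), ?_, fun r => rfl, fun r => rfl,
    fun r => rfl, this⟩
  simp [U]

end Extended

/-! ### Periodicity of the fields, passages and the impact map -/

section General

variable {H : ℝ × ℝ → ℝ} {W : ℝ × ℝ → ℝ → ℝ}

theorem hamField_congr {F G : ℝ × ℝ → ℝ} {z : ℝ × ℝ} (h : F =ᶠ[𝓝 z] G) :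
    hamField F z = hamField G z := by
  have h1 : Tendsto (fun y => (z.1, y)) (𝓝 z.2) (𝓝 z) :=
    (by fun_prop : Continuous fun y : ℝ => (z.1, y)).tendsto' _ _ rfl
  have h2 : Tendsto (fun x => (x, z.2)) (𝓝 z.1) (𝓝 z) :=
    (by fun_prop : Continuous fun x : ℝ => (x, z.2)).tendsto' _ _ rfl
  exact Prod.ext (h.comp_tendsto h1).deriv_eq (congrArg Neg.neg (h.comp_tendsto h2).deriv_eq)

/-- Periodicity of `W` on an open half-plane passes to its space derivatives there, because these
are local; continuity carries it to Σ from the same side. The sign of `σ` selects the side. -/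
theorem pertField_periodic (hH : ContDiff ℝ ∞ H)
    (hW : ContDiff ℝ ∞ fun p : (ℝ × ℝ) × ℝ => W p.1 p.2) {T σ : ℝ} (hσ : σ ≠ 0)
    (hper : ∀ v : ℝ × ℝ, 0 < σ * v.1 → ∀ t, W v (t + T) = W v t) (ε : ℝ) {z : ℝ × ℝ}
    (hz : 0 ≤ σ * z.1) : Function.Periodic (fun t => pertField H W ε z t) T := by
  intro t
  have hc : ∀ t, Continuous fun s : ℝ => pertField H W ε (z.1 + σ * s, z.2) t := fun t =>
    (contDiff_pertField hH hW ε).continuous.comp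
      (by fun_prop : Continuous fun s : ℝ => (t, z.1 + σ * s, z.2))
  have key : EqOn (fun s : ℝ => pertField H W ε (z.1 + σ * s, z.2) (t + T))
      (fun s : ℝ => pertField H W ε (z.1 + σ * s, z.2) t) (Ioi 0) := by
    intro s hs
    refine hamField_congr ?_
    have hpos : 0 < σ * (z.1 + σ * s) := by
      have : 0 < σ * σ * s := mul_pos (mul_self_pos.2 hσ) hs
      nlinarith
    have : ∀ᶠ v : ℝ × ℝ in 𝓝 (z.1 + σ * s, z.2), 0 < σ * v.1 :=
      (by fun_prop : Continuous fun v : ℝ × ℝ => σ * v.1).continuousAt.eventually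
        (lt_mem_nhds hpos)
    filter_upwards [this] with v hv
    rw [hper v hv]
  have := key.closure (hc _) (hc _) (show (0 : ℝ) ∈ closure (Ioi 0) by simp)
  simpa using this

/-- The first hitting point of `ℓ = 0` is determined by the starting point. -/
theorem first_hit_unique {E : Type*} [NormedAddCommGroup E] [NormedSpace ℝ E] {v : ℝ → E → E}
    (hv : ContDiff ℝ 1 fun p : ℝ × E => v p.1 p.2) {ℓ : E → ℝ} {a b b' : ℝ} {z z' : ℝ → E}
    (hab : a < b) (hab' : a < b') (hz : HasDerivOnIcc z (fun r => v r (z r)) a b)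
    (hz' : HasDerivOnIcc z' (fun r => v r (z' r)) a b') (h0 : z a = z' a)
    (hb : ℓ (z b) = 0) (hb' : ℓ (z' b') = 0) (hpos : ∀ t ∈ Ioo a b, 0 < ℓ (z t))
    (hpos' : ∀ t ∈ Ioo a b', 0 < ℓ (z' t)) : b = b' ∧ EqOn z z' (Icc a b) := by
  have heq : EqOn z z' (Icc a (min b b')) :=
    ode_unique_right hv (hz.mono le_rfl (min_le_left _ _)).continuousOn
      (fun t ht => (hz.mono le_rfl (min_le_left _ _)).right ht)
      (hz'.mono le_rfl (min_le_right _ _)).continuousOn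
      (fun t ht => (hz'.mono le_rfl (min_le_right _ _)).right ht) h0
  have hbb : b = b' := by
    rcases lt_trichotomy b b' with h | h | h
    · rw [min_eq_left h.le] at heq
      have := hpos' b ⟨hab, h⟩
      rw [← heq (right_mem_Icc.2 hab.le), hb] at this
      exact (lt_irrefl _ this).elim
    · exact h
    · rw [min_eq_right h.le] at heq
      have := hpos b' ⟨hab', h⟩
      rw [heq (right_mem_Icc.2 hab'.le), hb'] at this
      exact (lt_irrefl _ this).elim
  subst hbb
  rw [min_self] at heq
  exact ⟨rfl, heq⟩

theorem hasDerivWithinAt_comp_sub {E : Type*} [NormedAddCommGroup E] [NormedSpace ℝ E]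
    {f : ℝ → E} {f' : E} {s s' : Set ℝ} {t c : ℝ} (h : HasDerivWithinAt f f' s (t - c))
    (hs : MapsTo (fun r => r - c) s' s) : HasDerivWithinAt (fun r => f (r - c)) f' s' t := by
  have h2 : HasDerivWithinAt (fun r : ℝ => r - c) 1 s' t :=
    ((hasDerivAt_id t).sub_const c).hasDerivWithinAt
  simpa [Function.comp_def] using HasDerivWithinAt.scomp t h h2 hs

end General

namespace PWHamiltonian

variable (S : PWHamiltonian)

theorem contDiff_H0p : ContDiff ℝ ∞ S.H0p :=
  ((contDiff_snd.pow 2).div_const 2).add (S.Vp_smooth.comp contDiff_fst)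

theorem contDiff_H0m : ContDiff ℝ ∞ S.H0m :=
  ((contDiff_snd.pow 2).div_const 2).add (S.Vm_smooth.comp contDiff_fst)

theorem contDiff_Xp (ε : ℝ) : ContDiff ℝ 1 fun p : ℝ × ℝ × ℝ => S.Xp ε p.2 p.1 :=
  contDiff_pertField S.contDiff_H0p S.H1p_smooth ε

theorem contDiff_Xm (ε : ℝ) : ContDiff ℝ 1 fun p : ℝ × ℝ × ℝ => S.Xm ε p.2 p.1 :=
  contDiff_pertField S.contDiff_H0m S.H1m_smooth ε

theorem Xp_periodic (ε : ℝ) {z : ℝ × ℝ} (hz : 0 ≤ z.1) :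
    Function.Periodic (fun t => S.Xp ε z t) S.T := by
  refine pertField_periodic S.contDiff_H0p S.H1p_smooth one_ne_zero (fun v hv t => ?_) ε
    (by simpa using hz)
  have := S.H1_periodic v t
  rw [one_mul] at hv
  simpa [hv.le] using this

theorem Xm_periodic (ε : ℝ) {z : ℝ × ℝ} (hz : z.1 ≤ 0) :
    Function.Periodic (fun t => S.Xm ε z t) S.T := by
  refine pertField_periodic S.contDiff_H0m S.H1m_smooth (neg_ne_zero.2 one_ne_zero)
    (fun v hv t => ?_) ε (by simpa using hz)
  have := S.H1_periodic v t
  have hv' : ¬ 0 ≤ v.1 := by linarith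
  simpa [hv'] using this

/-! #### Determinism of the impact map -/

variable {S}

theorem ImpactP.unique {c₁ ε : ℝ} {a b b' : ℝ × ℝ} (h : S.ImpactP c₁ ε a b)
    (h' : S.ImpactP c₁ ε a b') : b = b' := by
  obtain ⟨-, -, hab, z, hz, hza, hzb, hpos⟩ := h
  obtain ⟨-, -, hab', z', hz', hza', hzb', hpos'⟩ := h'
  obtain ⟨h1, h2⟩ := first_hit_unique (S.contDiff_Xp ε) (ℓ := Prod.fst) hab hab' hz hz'
    (hza.trans hza'.symm) (by rw [hzb]) (by rw [hzb']) hpos hpos'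
  have h3 := h2 (right_mem_Icc.2 hab.le)
  rw [hzb, h1, hzb'] at h3
  exact Prod.ext (congrArg Prod.snd h3) h1

theorem ImpactM.unique {c₁ ε : ℝ} {a b b' : ℝ × ℝ} (h : S.ImpactM c₁ ε a b)
    (h' : S.ImpactM c₁ ε a b') : b = b' := by
  obtain ⟨-, -, hab, z, hz, hza, hzb, hpos⟩ := h
  obtain ⟨-, -, hab', z', hz', hza', hzb', hpos'⟩ := h'
  obtain ⟨h1, h2⟩ := first_hit_unique (S.contDiff_Xm ε) (ℓ := fun w => -w.1) hab hab' hz hz'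
    (hza.trans hza'.symm) (by rw [hzb]; simp) (by rw [hzb']; simp)
    (fun t ht => neg_pos.2 (hpos t ht)) (fun t ht => neg_pos.2 (hpos' t ht))
  have h3 := h2 (right_mem_Icc.2 hab.le)
  rw [hzb, h1, hzb'] at h3
  exact Prod.ext (congrArg Prod.snd h3) h1

theorem Impact.unique {c₁ ε : ℝ} {a b b' : ℝ × ℝ} (h : S.Impact c₁ ε a b)
    (h' : S.Impact c₁ ε a b') : b = b' := by
  obtain ⟨d, h1, h2⟩ := h
  obtain ⟨d', h1', h2'⟩ := h'
  obtain rfl := h1.unique h1'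
  exact h2.unique h2'

theorem Impact.time_lt {c₁ ε : ℝ} {a b : ℝ × ℝ} (h : S.Impact c₁ ε a b) : a.2 < b.2 := by
  obtain ⟨d, h1, h2⟩ := h
  exact h1.2.2.1.trans h2.2.2.1

theorem ImpactIter.time_le {c₁ ε : ℝ} {k : ℕ} {a b : ℝ × ℝ} (h : S.ImpactIter c₁ ε k a b) :
    a.2 ≤ b.2 := by
  induction k generalizing a with
  | zero => exact le_of_eq (congrArg Prod.snd h)
  | succ k ih =>
    obtain ⟨d, h1, h2⟩ := h
    exact h1.time_lt.le.trans (ih h2)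

/-- By determinism the common initial impacts can be cancelled. What remains is a nonempty chain
that ends where it starts, which is impossible because every impact increases time. -/
theorem ImpactIter.not_of_lt {c₁ ε : ℝ} {j m : ℕ} {a b : ℝ × ℝ} (h : S.ImpactIter c₁ ε m a b)
    (hj : j < m) : ¬ S.ImpactIter c₁ ε j a b := by
  induction j generalizing m a with
  | zero =>
    intro h0
    obtain ⟨k, rfl⟩ := Nat.exists_eq_succ_of_ne_zero hj.ne'
    obtain ⟨d, h1, h2⟩ := h
    have h3 : a.2 = b.2 := congrArg Prod.snd h0
    linarith [h1.time_lt, ImpactIter.time_le h2]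
  | succ j ih =>
    intro h0
    obtain ⟨k, rfl⟩ := Nat.exists_eq_succ_of_ne_zero (Nat.ne_of_gt (Nat.zero_lt_of_lt hj))
    obtain ⟨d, h1, h2⟩ := h
    obtain ⟨d', h1', h2'⟩ := h0
    obtain rfl := h1.unique h1'
    exact ih h2 (Nat.succ_lt_succ_iff.1 hj) h2'

/-! #### Passages of the extended system -/

variable (S)

/-- States from which both fields cross `Σ` towards `x > 0`. -/
def crossUp (c₁ : ℝ) : Set ExtState :=
  {w | w.1.2 ∈ Ioo 0 √(2 * c₁) ∧ 0 < (S.Xp w.2.2.1 w.1 w.2.1).1 ∧ 0 < (S.Xm w.2.2.1 w.1 w.2.1).1}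

/-- States from which both fields cross `Σ` towards `x < 0`. -/
def crossDown (c₁ : ℝ) : Set ExtState :=
  {w | w.1.2 ∈ Ioo (-√(2 * c₁)) 0 ∧ (S.Xp w.2.2.1 w.1 w.2.1).1 < 0 ∧
    (S.Xm w.2.2.1 w.1 w.2.1).1 < 0}

/-- A passage through `x > 0`. -/
def HalfP (c₁ : ℝ) (w w' : ExtState) : Prop :=
  Transit (extField S.H0p S.H1p)
    ((ContinuousLinearMap.fst ℝ ℝ ℝ).comp (ContinuousLinearMap.fst ℝ _ _)) w w' ∧
    w ∈ S.crossUp c₁ ∧ w' ∈ S.crossDown c₁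

/-- A passage through `x < 0`. -/
def HalfM (c₁ : ℝ) (w w' : ExtState) : Prop :=
  Transit (extField S.H0m S.H1m)
    ((-ContinuousLinearMap.fst ℝ ℝ ℝ).comp (ContinuousLinearMap.fst ℝ _ _)) w w' ∧
    w ∈ S.crossDown c₁ ∧ w' ∈ S.crossUp c₁

/-- A passage through `x > 0` followed by one through `x < 0`. -/
def Pass (c₁ : ℝ) : ExtState → ExtState → Prop := Relation.Comp (S.HalfP c₁) (S.HalfM c₁)

/-- The iterates of `Pass`. -/
def PassIter (c₁ : ℝ) : ℕ → ExtState → ExtState → Prop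
  | 0, w, w' => w = w'
  | k + 1, w, w' => Relation.Comp (S.Pass c₁) (PassIter c₁ k) w w'

variable {S} {c₁ : ℝ} {w w' : ExtState}

/-! ### From passages of the extended system to impacts and energy balance. -/

theorem HalfP.exists_orbit (h : S.HalfP c₁ w w') :
    ∃ z : ℝ → ℝ × ℝ, w.2.1 < w'.2.1 ∧
      HasDerivOnIcc z (fun r => S.Xp w.2.2.1 (z r) r) w.2.1 w'.2.1 ∧
      z w.2.1 = w.1 ∧ z w'.2.1 = w'.1 ∧ w'.2.2.1 = w.2.2.1 ∧
      w'.1.2 ^ 2 / 2 - w.2.2.1 * w'.2.2.2 = w.1.2 ^ 2 / 2 - w.2.2.1 * w.2.2.2 ∧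
      w'.2.2.2 - w.2.2.2 =
        (∫ r in w.2.1..w'.2.1, poissonBracket S.H0p (fun v => S.H1p v r) (z r)) ∧
      w.1.1 = 0 ∧ w'.1.1 = 0 ∧ ∀ r ∈ Ioo w.2.1 w'.2.1, 0 < (z r).1 := by
  obtain ⟨z, h1, h2, h3, h4, h5, h6, h7, h8, h9, h10⟩ :=
    h.1.exists_orbit S.contDiff_H0p S.H1p_smooth
  refine ⟨z, h1, h2, h3, h4, h5, ?_, h7, h8, h9, h10⟩
  have h8' : w.1.1 = 0 := h8
  have h9' : w'.1.1 = 0 := h9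
  simp only [H0p, h8', h9'] at h6
  linarith

theorem HalfM.exists_orbit (h : S.HalfM c₁ w w') :
    ∃ z : ℝ → ℝ × ℝ, w.2.1 < w'.2.1 ∧
      HasDerivOnIcc z (fun r => S.Xm w.2.2.1 (z r) r) w.2.1 w'.2.1 ∧
      z w.2.1 = w.1 ∧ z w'.2.1 = w'.1 ∧ w'.2.2.1 = w.2.2.1 ∧
      w'.1.2 ^ 2 / 2 - w.2.2.1 * w'.2.2.2 = w.1.2 ^ 2 / 2 - w.2.2.1 * w.2.2.2 ∧
      w'.2.2.2 - w.2.2.2 =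
        (∫ r in w.2.1..w'.2.1, poissonBracket S.H0m (fun v => S.H1m v r) (z r)) ∧
      w.1.1 = 0 ∧ w'.1.1 = 0 ∧ ∀ r ∈ Ioo w.2.1 w'.2.1, (z r).1 < 0 := by
  obtain ⟨z, h1, h2, h3, h4, h5, h6, h7, h8, h9, h10⟩ :=
    h.1.exists_orbit S.contDiff_H0m S.H1m_smooth
  have h8' : w.1.1 = 0 := neg_eq_zero.1 h8
  have h9' : w'.1.1 = 0 := neg_eq_zero.1 h9
  refine ⟨z, h1, h2, h3, h4, h5, ?_, h7, h8', h9', fun r hr => neg_pos.1 (h10 r hr)⟩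
  simp only [H0m, h8', h9'] at h6
  linarith

theorem HalfP.impactP (h : S.HalfP c₁ w w') :
    S.ImpactP c₁ w.2.2.1 (w.1.2, w.2.1) (w'.1.2, w'.2.1) := by
  obtain ⟨z, h1, h2, h3, h4, -, -, -, h8, h9, h10⟩ := h.exists_orbit
  exact ⟨h.2.1.1, h.2.2.1, h1, z, h2, h3.trans (Prod.ext h8 rfl), h4.trans (Prod.ext h9 rfl), h10⟩

theorem HalfM.impactM (h : S.HalfM c₁ w w') :
    S.ImpactM c₁ w.2.2.1 (w.1.2, w.2.1) (w'.1.2, w'.2.1) := by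
  obtain ⟨z, h1, h2, h3, h4, -, -, -, h8, h9, h10⟩ := h.exists_orbit
  exact ⟨h.2.1.1, h.2.2.1, h1, z, h2, h3.trans (Prod.ext h8 rfl), h4.trans (Prod.ext h9 rfl), h10⟩

theorem Pass.impact (h : S.Pass c₁ w w') :
    S.Impact c₁ w.2.2.1 (w.1.2, w.2.1) (w'.1.2, w'.2.1) := by
  obtain ⟨d, h1, h2⟩ := h
  obtain ⟨-, -, -, -, -, h5, -⟩ := h1.exists_orbit
  exact ⟨_, h1.impactP, h5 ▸ h2.impactM⟩

/-- On Σ the energy of either side is y²/2 plus a constant that cancels, so the two balances add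
without a jump at the intermediate crossing. -/
theorem Pass.invariants (h : S.Pass c₁ w w') : w'.2.2.1 = w.2.2.1 ∧ w.1.1 = 0 ∧ w'.1.1 = 0 ∧
    w'.1.2 ^ 2 / 2 - w.2.2.1 * w'.2.2.2 = w.1.2 ^ 2 / 2 - w.2.2.1 * w.2.2.2 ∧
    0 < w.1.2 ∧ 0 < w'.1.2 := by
  obtain ⟨d, h1, h2⟩ := h
  obtain ⟨-, -, -, -, -, h5, h6, -, h7, h8, -⟩ := h1.exists_orbit
  obtain ⟨-, -, -, -, -, h5', h6', -, h7', h8', -⟩ := h2.exists_orbit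
  refine ⟨h5'.trans h5, h7, h8', ?_, h1.2.1.1.1, h2.2.2.1.1⟩
  rw [h5] at h6'
  exact h6'.trans h6

theorem PassIter.impactIter {k : ℕ} (h : S.PassIter c₁ k w w') :
    S.ImpactIter c₁ w.2.2.1 k (w.1.2, w.2.1) (w'.1.2, w'.2.1) := by
  induction k generalizing w with
  | zero =>
    obtain rfl : w = w' := h
    rfl
  | succ k ih =>
    obtain ⟨d, h1, h2⟩ := h
    exact ⟨_, h1.impact, h1.invariants.1 ▸ ih h2⟩

theorem PassIter.invariants {k : ℕ} (h : S.PassIter c₁ k w w') : w'.2.2.1 = w.2.2.1 ∧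
    (w.1.1 = 0 → w'.1.1 = 0) ∧
    w'.1.2 ^ 2 / 2 - w.2.2.1 * w'.2.2.2 = w.1.2 ^ 2 / 2 - w.2.2.1 * w.2.2.2 ∧
    (0 < w.1.2 → 0 < w'.1.2) := by
  induction k generalizing w with
  | zero =>
    obtain rfl : w = w' := h
    exact ⟨rfl, id, rfl, id⟩
  | succ k ih =>
    obtain ⟨d, h1, h2⟩ := h
    obtain ⟨g1, g2, g3, g4, g5, g6⟩ := h1.invariants
    obtain ⟨k1, k2, k3, k4⟩ := ih h2
    refine ⟨k1.trans g1, fun _ => k2 g3, ?_, fun _ => k4 g6⟩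
    rw [g1] at k3
    exact k3.trans g4

end PWHamiltonian

/-! ### Concatenation of passages -/

namespace PWHamiltonian

variable (S : PWHamiltonian)

/-- The conditions of `IsSolution` at the time `t`. -/
def IsSolutionAt (ε : ℝ) (z : ℝ → ℝ × ℝ) (t : ℝ) : Prop :=
  (0 < (z t).1 → HasDerivAt z (S.Xp ε (z t) t) t) ∧
  ((z t).1 < 0 → HasDerivAt z (S.Xm ε (z t) t) t) ∧
  ((z t).1 = 0 →
    ((0 < (S.Xm ε (z t) t).1 ∧ 0 < (S.Xp ε (z t) t).1 ∧
        HasDerivWithinAt z (S.Xm ε (z t) t) (Iic t) t ∧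
        HasDerivWithinAt z (S.Xp ε (z t) t) (Ici t) t) ∨
      ((S.Xp ε (z t) t).1 < 0 ∧ (S.Xm ε (z t) t).1 < 0 ∧
        HasDerivWithinAt z (S.Xp ε (z t) t) (Iic t) t ∧
        HasDerivWithinAt z (S.Xm ε (z t) t) (Ici t) t)))

/-- An upward crossing of `Σ` at the point `v` and time `t`. -/
def UpAt (ε : ℝ) (v : ℝ × ℝ) (t : ℝ) : Prop :=
  v.1 = 0 ∧ 0 < (S.Xm ε v t).1 ∧ 0 < (S.Xp ε v t).1

/-- `z` is a solution between two upward crossings at times `a < b`, with `N` crossings of `Σ` in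
`[a, b)`. -/
structure Arc (ε a b : ℝ) (N : ℕ∞) (z : ℝ → ℝ × ℝ) : Prop where
  lt : a < b
  start : S.UpAt ε (z a) a
  finish : S.UpAt ε (z b) b
  right : HasDerivWithinAt z (S.Xp ε (z a) a) (Ici a) a
  left : HasDerivWithinAt z (S.Xm ε (z b) b) (Iic b) b
  sol : ∀ t ∈ Ioo a b, S.IsSolutionAt ε z t
  count : {t ∈ Ico a b | (z t).1 = 0}.encard = N

variable {S}

theorem IsSolutionAt.congr {ε : ℝ} {z z' : ℝ → ℝ × ℝ} {t : ℝ} (h : S.IsSolutionAt ε z t)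
    (hz : z' =ᶠ[𝓝 t] z) : S.IsSolutionAt ε z' t := by
  have h0 := hz.eq_of_nhds
  unfold IsSolutionAt
  rw [h0]
  refine ⟨fun hp => (h.1 hp).congr_of_eventuallyEq hz,
    fun hp => (h.2.1 hp).congr_of_eventuallyEq hz, fun hp => ?_⟩
  rcases h.2.2 hp with ⟨h1, h2, h3, h4⟩ | ⟨h1, h2, h3, h4⟩
  · exact Or.inl ⟨h1, h2, h3.congr_of_eventuallyEq (hz.filter_mono nhdsWithin_le_nhds) h0,
      h4.congr_of_eventuallyEq (hz.filter_mono nhdsWithin_le_nhds) h0⟩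
  · exact Or.inr ⟨h1, h2, h3.congr_of_eventuallyEq (hz.filter_mono nhdsWithin_le_nhds) h0,
      h4.congr_of_eventuallyEq (hz.filter_mono nhdsWithin_le_nhds) h0⟩

theorem isSolutionAt_of_up {ε : ℝ} {z : ℝ → ℝ × ℝ} {t : ℝ} (h : S.UpAt ε (z t) t)
    (hl : HasDerivWithinAt z (S.Xm ε (z t) t) (Iic t) t)
    (hr : HasDerivWithinAt z (S.Xp ε (z t) t) (Ici t) t) : S.IsSolutionAt ε z t :=
  ⟨fun h' => absurd h.1 h'.ne', fun h' => absurd h.1 h'.ne, fun _ => Or.inl ⟨h.2.1, h.2.2, hl, hr⟩⟩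

/-- Concatenation of two curves at time `b`. -/
def glue (b : ℝ) (z z' : ℝ → ℝ × ℝ) (t : ℝ) : ℝ × ℝ := if t ≤ b then z t else z' t

theorem glue_left {b : ℝ} {z z' : ℝ → ℝ × ℝ} : EqOn (glue b z z') z (Iic b) :=
  fun _ ht => if_pos ht

theorem glue_right {b : ℝ} {z z' : ℝ → ℝ × ℝ} (h : z b = z' b) : EqOn (glue b z z') z' (Ici b) := by
  intro t ht
  rcases eq_or_lt_of_le (mem_Ici.1 ht) with rfl | ht'
  · exact (if_pos le_rfl).trans h
  · exact if_neg (not_le.2 ht')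

theorem glue_eventually_left {b t : ℝ} {z z' : ℝ → ℝ × ℝ} (h : t < b) : glue b z z' =ᶠ[𝓝 t] z :=
  glue_left.eventuallyEq_of_mem (Iic_mem_nhds h)

theorem glue_eventually_right {b t : ℝ} {z z' : ℝ → ℝ × ℝ} (hb : z b = z' b) (h : b < t) :
    glue b z z' =ᶠ[𝓝 t] z' :=
  (glue_right hb).eventuallyEq_of_mem (Ici_mem_nhds h)

theorem encard_zeros_glue {a b c : ℝ} {z z' : ℝ → ℝ × ℝ} (hab : a ≤ b) (hbc : b ≤ c)
    (h : z b = z' b) : {t ∈ Ico a c | (glue b z z' t).1 = 0}.encard =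
      {t ∈ Ico a b | (z t).1 = 0}.encard + {t ∈ Ico b c | (z' t).1 = 0}.encard := by
  rw [← encard_union_eq]
  · congr 1
    ext t
    simp only [mem_ofPred_eq, mem_union, mem_Ico]
    rcases lt_or_ge t b with ht | ht
    · rw [glue_left (mem_Iic.2 ht.le)]
      constructor
      · exact fun h => Or.inl ⟨⟨h.1.1, ht⟩, h.2⟩
      · rintro (h | h)
        · exact ⟨⟨h.1.1, h.1.2.trans_le hbc⟩, h.2⟩
        · exact absurd h.1.1 (not_le.2 ht)
    · rw [glue_right h (mem_Ici.2 ht)]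
      constructor
      · exact fun h => Or.inr ⟨⟨ht, h.1.2⟩, h.2⟩
      · rintro (h | h)
        · exact absurd h.1.2 (not_lt.2 ht)
        · exact ⟨⟨hab.trans h.1.1, h.1.2⟩, h.2⟩
  · rw [disjoint_left]
    exact fun t h1 h2 => absurd h1.1.2 (not_lt.2 h2.1.1)

/-- At the seam the first arc supplies the left derivative from the minus field and the second the
right derivative from the plus field, which is exactly an upward crossing. Half-open counting avoids
counting the seam twice. -/
theorem Arc.trans {ε a b c : ℝ} {N M : ℕ∞} {z z' : ℝ → ℝ × ℝ} (h : S.Arc ε a b N z)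
    (h' : S.Arc ε b c M z') (hb : z b = z' b) : S.Arc ε a c (N + M) (glue b z z') where
  lt := h.lt.trans h'.lt
  start := by rw [glue_left (mem_Iic.2 h.lt.le)]; exact h.start
  finish := by rw [glue_right hb (mem_Ici.2 h'.lt.le)]; exact h'.finish
  right := by
    rw [glue_left (mem_Iic.2 h.lt.le)]
    exact h.right.congr_of_eventuallyEq ((glue_eventually_left h.lt).filter_mono nhdsWithin_le_nhds)
      (glue_left (mem_Iic.2 h.lt.le))
  left := by
    rw [glue_right hb (mem_Ici.2 h'.lt.le)]
    exact h'.left.congr_of_eventuallyEq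
      ((glue_eventually_right hb h'.lt).filter_mono nhdsWithin_le_nhds)
      (glue_right hb (mem_Ici.2 h'.lt.le))
  sol := by
    intro t ht
    rcases lt_trichotomy t b with htb | rfl | htb
    · exact (h.sol t ⟨ht.1, htb⟩).congr (glue_eventually_left htb)
    · have h0 : glue t z z' t = z t := glue_left (mem_Iic.2 le_rfl)
      refine isSolutionAt_of_up (by rw [h0]; exact h.finish) ?_ ?_
      · rw [h0]
        exact h.left.congr glue_left h0
      · rw [h0, hb]
        exact h'.right.congr (glue_right hb) (h0.trans hb)
    · exact (h'.sol t ⟨htb, ht.2⟩).congr (glue_eventually_right hb htb)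
  count := by rw [encard_zeros_glue h.lt.le h'.lt.le hb, h.count, h'.count]

variable {c₁ : ℝ} {w w' : ExtState}

theorem Pass.exists_arc (h : S.Pass c₁ w w') : ∃ z, S.Arc w.2.2.1 w.2.1 w'.2.1 2 z ∧
    z w.2.1 = w.1 ∧ z w'.2.1 = w'.1 := by
  obtain ⟨d, h1, h2⟩ := h
  obtain ⟨z, a1, a2, a3, a4, a5, -, -, a8, a9, a10⟩ := h1.exists_orbit
  obtain ⟨z', b1, b2, b3, b4, b5, -, -, b8, b9, b10⟩ := h2.exists_orbit
  have hd : z d.2.1 = z' d.2.1 := a4.trans b3.symm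
  have ha : glue d.2.1 z z' w.2.1 = w.1 := (glue_left (mem_Iic.2 a1.le)).trans a3
  have hb : glue d.2.1 z z' w'.2.1 = w'.1 := (glue_right hd (mem_Ici.2 b1.le)).trans b4
  have hm : glue d.2.1 z z' d.2.1 = d.1 := (glue_left (mem_Iic.2 le_rfl)).trans a4
  rw [a5] at b2 b5
  refine ⟨glue d.2.1 z z', ⟨a1.trans b1, ?_, ?_, ?_, ?_, ?_, ?_⟩, ha, hb⟩
  · rw [ha]; exact ⟨a8, h1.2.1.2.2, h1.2.1.2.1⟩
  · rw [hb, ← b5]; exact ⟨b9, h2.2.2.2.2, h2.2.2.2.1⟩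
  · have := a2.right ⟨le_rfl, a1⟩
    rw [a3] at this
    rw [ha]
    exact this.congr_of_eventuallyEq ((glue_eventually_left a1).filter_mono nhdsWithin_le_nhds)
      (ha.trans a3.symm)
  · have := b2.left ⟨b1, le_rfl⟩
    rw [b4] at this
    rw [hb]
    exact this.congr_of_eventuallyEq
      ((glue_eventually_right hd b1).filter_mono nhdsWithin_le_nhds) (hb.trans b4.symm)
  · intro t ht
    rcases lt_trichotomy t d.2.1 with htd | rfl | htd
    · have hpos := a10 t ⟨ht.1, htd⟩
      refine IsSolutionAt.congr ⟨fun _ => a2.hasDerivAt ⟨ht.1, htd⟩, fun h => ?_, fun h => ?_⟩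
        (glue_eventually_left htd)
      · exact absurd h hpos.not_gt
      · exact absurd h hpos.ne'
    · refine ⟨fun h => ?_, fun h => ?_, fun _ => Or.inr ?_⟩
      · rw [hm, a9] at h; exact absurd h (lt_irrefl _)
      · rw [hm, a9] at h; exact absurd h (lt_irrefl _)
      · rw [hm]
        have h3 := h1.2.2.2
        rw [a5] at h3
        refine ⟨h3.1, h3.2, ?_, ?_⟩
        · have := a2.left ⟨a1, le_rfl⟩
          rw [a4] at this
          exact this.congr glue_left (hm.trans a4.symm)
        · have := b2.right ⟨le_rfl, b1⟩
          rw [b3] at this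
          exact this.congr (glue_right hd) (hm.trans b3.symm)
    · have hneg := b10 t ⟨htd, ht.2⟩
      refine IsSolutionAt.congr ⟨fun h => ?_, fun _ => b2.hasDerivAt ⟨htd, ht.2⟩, fun h => ?_⟩
        (glue_eventually_right hd htd)
      · exact absurd h hneg.not_gt
      · exact absurd h hneg.ne
  -- On a half-open interval each half passage contributes only its starting crossing.
  · rw [encard_zeros_glue a1.le b1.le hd]
    have e1 : {t ∈ Ico w.2.1 d.2.1 | (z t).1 = 0} = {w.2.1} := by
      ext t
      simp only [mem_ofPred_eq, mem_singleton_iff]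
      constructor
      · rintro ⟨h3, h4⟩
        by_contra hne
        exact (a10 t ⟨lt_of_le_of_ne h3.1 (Ne.symm hne), h3.2⟩).ne' h4
      · rintro rfl
        exact ⟨⟨le_rfl, a1⟩, by rw [a3, a8]⟩
    have e2 : {t ∈ Ico d.2.1 w'.2.1 | (z' t).1 = 0} = {d.2.1} := by
      ext t
      simp only [mem_ofPred_eq, mem_singleton_iff]
      constructor
      · rintro ⟨h3, h4⟩
        by_contra hne
        exact (b10 t ⟨lt_of_le_of_ne h3.1 (Ne.symm hne), h3.2⟩).ne h4
      · rintro rfl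
        exact ⟨⟨le_rfl, b1⟩, by rw [b3, b8]⟩
    rw [e1, e2, encard_singleton, encard_singleton, one_add_one_eq_two]

/-- The chain has length `k + 1` because an arc has positive duration; the count is two crossings
per turn. -/
theorem PassIter.exists_arc {k : ℕ} (h : S.PassIter c₁ (k + 1) w w') :
    ∃ z, S.Arc w.2.2.1 w.2.1 w'.2.1 (2 * (k + 1 : ℕ)) z ∧ z w.2.1 = w.1 ∧ z w'.2.1 = w'.1 := by
  induction k generalizing w with
  | zero =>
    obtain ⟨d, h1, h2⟩ := h
    obtain rfl : d = w' := h2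
    obtain ⟨z, hz⟩ := h1.exists_arc
    exact ⟨z, by simpa using hz⟩
  | succ k ih =>
    obtain ⟨d, h1, h2⟩ := h
    obtain ⟨z, hz, hza, hzb⟩ := h1.exists_arc
    obtain ⟨z', hz', hza', hzb'⟩ := ih h2
    rw [h1.invariants.1] at hz'
    have hd := hzb.trans hza'.symm
    refine ⟨glue d.2.1 z z', ?_, (glue_left (mem_Iic.2 hz.lt.le)).trans hza,
      (glue_right hd (mem_Ici.2 hz'.lt.le)).trans hzb'⟩
    convert hz.trans hz' hd using 1
    push_cast
    ring

theorem Xp_sub_period (ε : ℝ) {v : ℝ × ℝ} (hv : 0 ≤ v.1) {c : ℝ} {k : ℤ} (hc : c = k * S.T)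
    (t : ℝ) : S.Xp ε v (t - c) = S.Xp ε v t := by
  rw [hc]
  exact ((S.Xp_periodic ε hv).int_mul k).sub_eq t

theorem Xm_sub_period (ε : ℝ) {v : ℝ × ℝ} (hv : v.1 ≤ 0) {c : ℝ} {k : ℤ} (hc : c = k * S.T)
    (t : ℝ) : S.Xm ε v (t - c) = S.Xm ε v t := by
  rw [hc]
  exact ((S.Xm_periodic ε hv).int_mul k).sub_eq t

/-- Each field is compared only on the closed half-plane where it acts, which is all that
periodicity of the piecewise perturbation gives. At ε = 0 the fields are autonomous and every shift
is allowed. -/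
theorem IsSolutionAt.shift {ε : ℝ} {z : ℝ → ℝ × ℝ} {t c : ℝ}
    (hXp : ∀ v : ℝ × ℝ, 0 ≤ v.1 → S.Xp ε v (t - c) = S.Xp ε v t)
    (hXm : ∀ v : ℝ × ℝ, v.1 ≤ 0 → S.Xm ε v (t - c) = S.Xm ε v t)
    (h : S.IsSolutionAt ε z (t - c)) : S.IsSolutionAt ε (fun r => z (r - c)) t := by
  refine ⟨fun hp => ?_, fun hp => ?_, fun hp => ?_⟩
  · have := h.1 hp
    rw [hXp _ hp.le] at this
    exact this.comp_sub_const t c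
  · have := h.2.1 hp
    rw [hXm _ hp.le] at this
    exact this.comp_sub_const t c
  · have := h.2.2 hp
    rw [hXm _ hp.le, hXp _ hp.ge] at this
    have m1 : MapsTo (fun r => r - c) (Iic t) (Iic (t - c)) := fun r hr => sub_le_sub_right hr c
    have m2 : MapsTo (fun r => r - c) (Ici t) (Ici (t - c)) := fun r hr => sub_le_sub_right hr c
    exact this.imp
      (fun h => ⟨h.1, h.2.1, hasDerivWithinAt_comp_sub h.2.2.1 m1,
        hasDerivWithinAt_comp_sub h.2.2.2 m2⟩)
      (fun h => ⟨h.1, h.2.1, hasDerivWithinAt_comp_sub h.2.2.1 m1,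
        hasDerivWithinAt_comp_sub h.2.2.2 m2⟩)

/-- The zeros of a periodic curve in a period interval do not depend on the interval. -/
theorem encard_zeros_periodic {φ : ℝ → ℝ × ℝ} {P : ℝ} (hP : 0 < P) (hφ : Function.Periodic φ P)
    (a s : ℝ) : {t ∈ Ico s (s + P) | (φ t).1 = 0}.encard =
      {t ∈ Ico a (a + P) | (φ t).1 = 0}.encard := by
  have hval : ∀ b t, φ (toIcoMod hP b t) = φ t := fun b t => by
    rw [toIcoMod]; exact hφ.sub_zsmul_eq _
  have himg : ∀ a s, toIcoMod hP a '' {t ∈ Ico s (s + P) | (φ t).1 = 0} ⊆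
      {t ∈ Ico a (a + P) | (φ t).1 = 0} := by
    rintro a s _ ⟨t, ht, rfl⟩
    exact ⟨toIcoMod_mem_Ico hP a t, by rw [hval]; exact ht.2⟩
  have hinj : ∀ a s, InjOn (toIcoMod hP a) {t ∈ Ico s (s + P) | (φ t).1 = 0} := by
    intro a s t ht t' ht' h
    have h1 : toIcoMod hP s (toIcoMod hP a t) = toIcoMod hP s (toIcoMod hP a t') := by rw [h]
    rw [toIcoMod_toIcoMod, toIcoMod_toIcoMod, (toIcoMod_eq_self hP).2 ht.1,
      (toIcoMod_eq_self hP).2 ht'.1] at h1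
    exact h1
  refine le_antisymm ?_ ?_
  · rw [← (hinj a s).encard_image]; exact encard_le_encard (himg a s)
  · rw [← (hinj s a).encard_image]; exact encard_le_encard (himg s a)

/-- An arc that ends at its starting point after a multiple of the period of the system extends to
a periodic solution. -/
theorem Arc.exists_periodic {ε a P : ℝ} {N : ℕ∞} {z : ℝ → ℝ × ℝ} (h : S.Arc ε a (a + P) N z)
    {n : ℕ} (hP : P = n * S.T) (hz : z (a + P) = z a) :
    ∃ φ : ℝ → ℝ × ℝ, S.IsSolution ε φ ∧ φ a = z a ∧ Function.Periodic φ P ∧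
      ∀ s, {t ∈ Ico s (s + P) | φ t ∈ switching}.encard = N := by
  have hP0 : 0 < P := by linarith [h.lt]
  let φ : ℝ → ℝ × ℝ := fun t => z (toIcoMod hP0 a t)
  have hφ : Function.Periodic φ P := fun t => by simp [φ]
  have hφz : EqOn φ z (Icc a (a + P)) := by
    intro t ht
    rcases eq_or_lt_of_le ht.2 with rfl | ht'
    · rw [hφ, hz]; simp [φ]
    · simp [φ, (toIcoMod_eq_self hP0).2 ⟨ht.1, ht'⟩]
  have hsol : ∀ t ∈ Ico a (a + P), S.IsSolutionAt ε φ t := by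
    intro t ht
    rcases eq_or_lt_of_le ht.1 with rfl | ht'
    · have h0 : φ a = z a := hφz (left_mem_Icc.2 h.lt.le)
      refine isSolutionAt_of_up (by rw [h0]; exact h.start) ?_ ?_
      -- At the seam the left derivative is that of the end of the arc, carried back by one period;
      -- the field does not change because `P` is a multiple of `S.T`.
      · have hc : -P = ((-n : ℤ) : ℝ) * S.T := by rw [hP]; push_cast; ring
        have h1 := h.left
        rw [hz, ← sub_neg_eq_add, Xm_sub_period ε h.start.1.le hc] at h1
        have h2 : HasDerivWithinAt (fun r => z (r - -P)) (S.Xm ε (z a) a) (Iic a) a :=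
          hasDerivWithinAt_comp_sub h1 (fun r hr => mem_Iic.2 (sub_le_sub_right (mem_Iic.1 hr) _))
        rw [h0]
        refine h2.congr_of_eventuallyEq ?_ ?_
        · filter_upwards [Ioc_mem_nhdsLE (show a - P < a by linarith)] with r hr
          rw [sub_neg_eq_add, ← hφ r]
          exact hφz ⟨by linarith [hr.1], by linarith [hr.2]⟩
        · rw [sub_neg_eq_add, hz, h0]
      · rw [h0]
        refine h.right.congr_of_eventuallyEq ?_ h0
        filter_upwards [Ico_mem_nhdsGE h.lt] with r hr
        exact hφz (Ico_subset_Icc_self hr)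
    · refine (h.sol t ⟨ht', ht.2⟩).congr ?_
      filter_upwards [Icc_mem_nhds ht' ht.2] with r hr
      exact hφz hr
  refine ⟨φ, fun t => ?_, hφz (left_mem_Icc.2 h.lt.le), hφ, fun s => ?_⟩
  · have h1 := hsol _ (toIcoMod_mem_Ico hP0 a t)
    rw [toIcoMod, zsmul_eq_mul] at h1
    have hc : toIcoDiv hP0 a t * P = ((toIcoDiv hP0 a t * n : ℤ) : ℝ) * S.T := by
      push_cast
      linear_combination (toIcoDiv hP0 a t : ℝ) * hP
    have h2 := h1.shift (fun v hv => Xp_sub_period ε hv hc t) (fun v hv => Xm_sub_period ε hv hc t)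
    have h3 : (fun r => φ (r - toIcoDiv hP0 a t * P)) = φ := by
      funext r
      have := hφ.sub_zsmul_eq (toIcoDiv hP0 a t) (x := r)
      rwa [zsmul_eq_mul] at this
    rw [h3] at h2
    exact h2
  · change {t ∈ Ico s (s + P) | (φ t).1 = 0}.encard = N
    rw [encard_zeros_periodic hP0 hφ a s, ← h.count]
    congr 1
    ext t
    simp only [mem_ofPred_eq, and_congr_right_iff]
    intro ht
    rw [hφz (Ico_subset_Icc_self ht)]

/-- A closed chain of passages gives an `(n, m)`-periodic orbit. -/
theorem PassIter.isNMPeriodic {m n : ℕ} (hm : 0 < m) {ε y t u u' : ℝ}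
    (h : S.PassIter c₁ m ((0, y), t, ε, u) ((0, y), t + n * S.T, ε, u')) :
    S.IsNMPeriodic c₁ ε n m y t where
  returns := h.impactIter
  minimal := fun _ hj => h.impactIter.not_of_lt hj
  orbit := by
    obtain ⟨k, rfl⟩ := Nat.exists_eq_succ_of_ne_zero hm.ne'
    obtain ⟨z, hz, hza, hzb⟩ := h.exists_arc
    obtain ⟨φ, h1, h2, h3, h4⟩ := hz.exists_periodic rfl (hzb.trans hza.symm)
    exact ⟨φ, h1, h2.trans hza, h3, h4⟩

end PWHamiltonian

/-! ### Forward uniqueness for the piecewise smooth system -/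

section General

/-- Two solutions in the sense of right derivatives that agree at `t` agree shortly after `t`. -/
theorem eventually_eq_right {E : Type*} [NormedAddCommGroup E] [NormedSpace ℝ E] {v : ℝ → E → E}
    (hv : ContDiff ℝ 1 fun p : ℝ × E => v p.1 p.2) {f g : ℝ → E} {t b : ℝ} (htb : t < b)
    (hf : ContinuousOn f (Icc t b)) (hg : ContinuousOn g (Icc t b))
    (hf' : ∀ᶠ s in 𝓝[≥] t, HasDerivWithinAt f (v s (f s)) (Ici s) s)
    (hg' : ∀ᶠ s in 𝓝[≥] t, HasDerivWithinAt g (v s (g s)) (Ici s) s) (h : f t = g t) :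
    ∀ᶠ s in 𝓝[>] t, f s = g s := by
  obtain ⟨c, hc, hcs⟩ := (mem_nhdsGE_iff_exists_Ico_subset' htb).1
    (inter_mem (hf'.and hg') (Ico_mem_nhdsGE htb))
  have hcb : ∀ s ∈ Ico t c, s < b := fun s hs => (hcs hs).2.2
  have hct : t < c := hc
  have hcb' : c ≤ b := le_of_forall_lt fun s hs => by
    rcases lt_or_ge s t with h | h
    · exact h.trans htb
    · exact hcb s ⟨h, hs⟩
  have heq : EqOn f g (Icc t c) :=
    ode_unique_right hv (hf.mono (Icc_subset_Icc_right hcb')) (fun s hs => (hcs hs).1.1)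
      (hg.mono (Icc_subset_Icc_right hcb')) (fun s hs => (hcs hs).1.2) h
  filter_upwards [Ioc_mem_nhdsGT hct] with s hs
  exact heq (Ioc_subset_Icc_self hs)

/-- A real function with positive right derivative at a zero is positive just after it. -/
theorem eventually_pos_right {g : ℝ → ℝ} {t d : ℝ} (h : HasDerivWithinAt g d (Ici t) t)
    (h0 : g t = 0) (hd : 0 < d) : ∀ᶠ s in 𝓝[>] t, 0 < g s := by
  have h1 := (hasDerivWithinAt_iff_tendsto_slope' (lt_irrefl t)).1 (h.mono Ioi_subset_Ici_self)
  filter_upwards [h1.eventually (lt_mem_nhds hd), self_mem_nhdsWithin] with s hs hst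
  rw [slope_def_field, h0, sub_zero] at hs
  exact (div_pos_iff_of_pos_right (sub_pos.2 hst)).1 hs

theorem eventually_neg_left {g : ℝ → ℝ} {t d : ℝ} (h : HasDerivWithinAt g d (Iic t) t)
    (h0 : g t = 0) (hd : 0 < d) : ∀ᶠ s in 𝓝[<] t, g s < 0 := by
  have h1 := (hasDerivWithinAt_iff_tendsto_slope' (s := Iio t) (lt_irrefl t)).1
    (h.mono Iio_subset_Iic_self)
  filter_upwards [h1.eventually (lt_mem_nhds hd), self_mem_nhdsWithin] with s hs hst
  rw [slope_def_field, h0, sub_zero] at hs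
  by_contra hcon
  exact absurd hs (not_lt.2 (div_nonpos_of_nonneg_of_nonpos (not_lt.1 hcon) (sub_neg.2 hst).le))

/-- Positivity just after `a` keeps later zeros away from `a`, where `g` may itself vanish; the
remaining zeros up to `p` form a compact set, which has a least element. -/
theorem exists_first_zero {g : ℝ → ℝ} (hg : Continuous g) {a p : ℝ}
    (ha : ∀ᶠ t in 𝓝[>] a, 0 < g t) (hap : a < p) (hp : g p = 0) :
    ∃ b ∈ Ioc a p, g b = 0 ∧ ∀ t ∈ Ioo a b, 0 < g t := by
  obtain ⟨c, hc, hcs⟩ := mem_nhdsGT_iff_exists_Ioc_subset.1 ha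
  have hac : a < c := hc
  have hcp : c < p := by
    by_contra h
    have : 0 < g p := hcs ⟨hap, not_lt.1 h⟩
    exact this.ne' hp
  have hcomp : IsCompact (Icc c p ∩ g ⁻¹' {0}) :=
    isCompact_Icc.inter_right (isClosed_singleton.preimage hg)
  obtain ⟨b, ⟨hb1, hb2⟩, hb3⟩ := hcomp.exists_isLeast ⟨p, ⟨hcp.le, le_rfl⟩, hp⟩
  refine ⟨b, ⟨hac.trans_le hb1.1, hb1.2⟩, hb2, fun t ht => ?_⟩
  rcases le_total t c with h | h
  · exact hcs ⟨ht.1, h⟩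
  · by_contra hcon
    have hgc : 0 < g c := hcs ⟨hac, le_rfl⟩
    obtain ⟨s, hs, hs0⟩ := intermediate_value_Icc' h hg.continuousOn ⟨not_lt.1 hcon, hgc.le⟩
    have := hb3 ⟨⟨hs.1, (hs.2.trans ht.2.le).trans hb1.2⟩, hs0⟩
    linarith [hs.2, ht.2]

theorem hasDerivOnIcc_of_Ioo {E : Type*} [NormedAddCommGroup E] [NormedSpace ℝ E] {f f' : ℝ → E}
    {a b : ℝ} (ha : HasDerivWithinAt f (f' a) (Ici a) a)
    (hb : HasDerivWithinAt f (f' b) (Iic b) b) (h : ∀ t ∈ Ioo a b, HasDerivAt f (f' t) t) :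
    HasDerivOnIcc f f' a b := by
  intro t ht
  rcases eq_or_lt_of_le ht.1 with rfl | h1
  · exact ha.mono Icc_subset_Ici_self
  · rcases eq_or_lt_of_le ht.2 with rfl | h2
    · exact hb.mono Icc_subset_Iic_self
    · exact (h t ⟨h1, h2⟩).hasDerivWithinAt

theorem HasDerivWithinAt.fst' {f : ℝ → ℝ × ℝ} {f' : ℝ × ℝ} {s : Set ℝ} {t : ℝ}
    (h : HasDerivWithinAt f f' s t) : HasDerivWithinAt (fun r => (f r).1) f'.1 s t :=
  (ContinuousLinearMap.fst ℝ ℝ ℝ).hasFDerivAt.comp_hasDerivWithinAt t h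

end General

namespace PWHamiltonian

variable {S : PWHamiltonian} {ε : ℝ} {q : ℝ → ℝ × ℝ}

theorem IsSolution.continuous (hq : S.IsSolution ε q) : Continuous q := by
  refine continuous_iff_continuousAt.2 fun t => ?_
  rcases lt_trichotomy (q t).1 0 with h | h | h
  · exact ((hq t).2.1 h).continuousAt
  · rw [continuousAt_iff_continuous_left_right]
    rcases (hq t).2.2 h with ⟨-, -, h1, h2⟩ | ⟨-, -, h1, h2⟩
    · exact ⟨h1.continuousWithinAt, h2.continuousWithinAt⟩
    · exact ⟨h1.continuousWithinAt, h2.continuousWithinAt⟩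
  · exact ((hq t).1 h).continuousAt

theorem IsSolution.up_derivs (hq : S.IsSolution ε q) {t : ℝ} (h : (q t).1 = 0)
    (hX : 0 < (S.Xp ε (q t) t).1) : HasDerivWithinAt q (S.Xm ε (q t) t) (Iic t) t ∧
      HasDerivWithinAt q (S.Xp ε (q t) t) (Ici t) t := by
  rcases (hq t).2.2 h with h1 | h1
  · exact h1.2.2
  · exact absurd hX h1.1.not_gt

theorem IsSolution.down_derivs (hq : S.IsSolution ε q) {t : ℝ} (h : (q t).1 = 0)
    (hX : (S.Xm ε (q t) t).1 < 0) : HasDerivWithinAt q (S.Xp ε (q t) t) (Iic t) t ∧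
      HasDerivWithinAt q (S.Xm ε (q t) t) (Ici t) t := by
  rcases (hq t).2.2 h with h1 | h1
  · exact absurd hX h1.1.not_gt
  · exact h1.2.2

theorem IsSolution.pos_after (hq : S.IsSolution ε q) {t : ℝ} (h : (q t).1 = 0)
    (hX : 0 < (S.Xp ε (q t) t).1) : ∀ᶠ s in 𝓝[>] t, 0 < (q s).1 :=
  eventually_pos_right (hq.up_derivs h hX).2.fst' h hX

theorem IsSolution.neg_after (hq : S.IsSolution ε q) {t : ℝ} (h : (q t).1 = 0)
    (hX : (S.Xm ε (q t) t).1 < 0) : ∀ᶠ s in 𝓝[>] t, 0 < -(q s).1 :=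
  eventually_pos_right (hq.down_derivs h hX).2.fst'.neg (by simp [h]) (neg_pos.2 hX)

theorem eventually_nhdsGE {p : ℝ → Prop} {t : ℝ} (h : p t) (h' : ∀ᶠ s in 𝓝[>] t, p s) :
    ∀ᶠ s in 𝓝[≥] t, p s := by
  rw [eventually_nhdsWithin_iff] at h' ⊢
  filter_upwards [h'] with s hs hst
  rcases eq_or_lt_of_le (mem_Ici.1 hst) with rfl | h1
  · exact h
  · exact hs h1

theorem IsSolution.right_deriv_p (hq : S.IsSolution ε q) {t : ℝ}
    (h : 0 < (q t).1 ∨ (q t).1 = 0 ∧ 0 < (S.Xp ε (q t) t).1) :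
    ∀ᶠ s in 𝓝[≥] t, HasDerivWithinAt q (S.Xp ε (q s) s) (Ici s) s := by
  rcases h with h | ⟨h, hX⟩
  · have : ∀ᶠ s in 𝓝[≥] t, 0 < (q s).1 :=
      (hq.continuous.fst.continuousAt.eventually (lt_mem_nhds h)).filter_mono nhdsWithin_le_nhds
    filter_upwards [this] with s hs
    exact ((hq s).1 hs).hasDerivWithinAt
  · refine eventually_nhdsGE (hq.up_derivs h hX).2 ?_
    filter_upwards [hq.pos_after h hX] with s hs
    exact ((hq s).1 hs).hasDerivWithinAt

theorem IsSolution.right_deriv_m (hq : S.IsSolution ε q) {t : ℝ}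
    (h : (q t).1 < 0 ∨ (q t).1 = 0 ∧ (S.Xm ε (q t) t).1 < 0) :
    ∀ᶠ s in 𝓝[≥] t, HasDerivWithinAt q (S.Xm ε (q s) s) (Ici s) s := by
  rcases h with h | ⟨h, hX⟩
  · have : ∀ᶠ s in 𝓝[≥] t, (q s).1 < 0 :=
      (hq.continuous.fst.continuousAt.eventually (gt_mem_nhds h)).filter_mono nhdsWithin_le_nhds
    filter_upwards [this] with s hs
    exact ((hq s).2.1 hs).hasDerivWithinAt
  · refine eventually_nhdsGE (hq.down_derivs h hX).2 ?_
    filter_upwards [hq.neg_after h hX] with s hs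
    exact ((hq s).2.1 (neg_pos.1 hs)).hasDerivWithinAt

/-- Solutions of the piecewise smooth system are unique in forward time. -/
theorem IsSolution.eqOn_Ici {q' : ℝ → ℝ × ℝ} (hq : S.IsSolution ε q) (hq' : S.IsSolution ε q')
    {a : ℝ} (h : q a = q' a) : EqOn q q' (Ici a) := by
  intro b hb
  have hclosed : IsClosed ({t | q t = q' t} ∩ Icc a b) :=
    (isClosed_eq hq.continuous hq'.continuous).inter isClosed_Icc
  refine hclosed.Icc_subset_of_forall_mem_nhdsWithin h (fun t ht => ?_) (right_mem_Icc.2 hb)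
  have heq : q t = q' t := ht.1
  -- One smooth field governs the immediate future of every point: off Σ the side decides, on Σ the
  -- direction of crossing.
  have hup : (0 < (q t).1 ∨ (q t).1 = 0 ∧ 0 < (S.Xp ε (q t) t).1) ∨
      ((q t).1 < 0 ∨ (q t).1 = 0 ∧ (S.Xm ε (q t) t).1 < 0) := by
    rcases lt_trichotomy (q t).1 0 with h | h | h
    · exact Or.inr (Or.inl h)
    · rcases (hq t).2.2 h with h1 | h1
      · exact Or.inl (Or.inr ⟨h, h1.2.1⟩)
      · exact Or.inr (Or.inr ⟨h, h1.2.1⟩)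
    · exact Or.inl (Or.inl h)
  rcases hup with hup | hup
  · exact eventually_eq_right (S.contDiff_Xp ε) (lt_add_one t) hq.continuous.continuousOn
      hq'.continuous.continuousOn (hq.right_deriv_p hup) (hq'.right_deriv_p (heq ▸ hup)) heq
  · exact eventually_eq_right (S.contDiff_Xm ε) (lt_add_one t) hq.continuous.continuousOn
      hq'.continuous.continuousOn (hq.right_deriv_m hup) (hq'.right_deriv_m (heq ▸ hup)) heq

/-- The set of agreement is closed and extends to the right of each of its points before `b`, since
until the next hit the piecewise solution also follows the plus field. -/
theorem IsSolution.eqOn_of_orbit_p (hq : S.IsSolution ε q) {z : ℝ → ℝ × ℝ} {a b : ℝ}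
    (hz : HasDerivOnIcc z (fun r => S.Xp ε (z r) r) a b) (h : q a = z a) (h0 : (z a).1 = 0)
    (hX : 0 < (S.Xp ε (z a) a).1) (hpos : ∀ r ∈ Ioo a b, 0 < (z r).1) : EqOn q z (Icc a b) := by
  have hclosed : IsClosed ({t | q t = z t} ∩ Icc a b) := by
    rw [inter_comm]
    exact (hq.continuous.continuousOn.prodMk hz.continuousOn).preimage_isClosed_of_isClosed
      isClosed_Icc isClosed_diagonal
  refine hclosed.Icc_subset_of_forall_mem_nhdsWithin h (fun t ht => ?_)
  have heq : q t = z t := ht.1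
  refine eventually_eq_right (S.contDiff_Xp ε) ht.2.2 hq.continuous.continuousOn
    (hz.continuousOn.mono (Icc_subset_Icc_left ht.2.1)) (hq.right_deriv_p ?_) ?_ heq
  · rw [heq]
    rcases eq_or_lt_of_le ht.2.1 with rfl | h1
    · exact Or.inr ⟨h0, hX⟩
    · exact Or.inl (hpos t ⟨h1, ht.2.2⟩)
  · filter_upwards [Ico_mem_nhdsGE ht.2.2] with s hs
    exact hz.right ⟨ht.2.1.trans hs.1, hs.2⟩

theorem IsSolution.eqOn_of_orbit_m (hq : S.IsSolution ε q) {z : ℝ → ℝ × ℝ} {a b : ℝ}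
    (hz : HasDerivOnIcc z (fun r => S.Xm ε (z r) r) a b) (h : q a = z a) (h0 : (z a).1 = 0)
    (hX : (S.Xm ε (z a) a).1 < 0) (hneg : ∀ r ∈ Ioo a b, (z r).1 < 0) : EqOn q z (Icc a b) := by
  have hclosed : IsClosed ({t | q t = z t} ∩ Icc a b) := by
    rw [inter_comm]
    exact (hq.continuous.continuousOn.prodMk hz.continuousOn).preimage_isClosed_of_isClosed
      isClosed_Icc isClosed_diagonal
  refine hclosed.Icc_subset_of_forall_mem_nhdsWithin h (fun t ht => ?_)
  have heq : q t = z t := ht.1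
  refine eventually_eq_right (S.contDiff_Xm ε) ht.2.2 hq.continuous.continuousOn
    (hz.continuousOn.mono (Icc_subset_Icc_left ht.2.1)) (hq.right_deriv_m ?_) ?_ heq
  · rw [heq]
    rcases eq_or_lt_of_le ht.2.1 with rfl | h1
    · exact Or.inr ⟨h0, hX⟩
    · exact Or.inl (hneg t ⟨h1, ht.2.2⟩)
  · filter_upwards [Ico_mem_nhdsGE ht.2.2] with s hs
    exact hz.right ⟨ht.2.1.trans hs.1, hs.2⟩

/-! ### Passages of the unperturbed system -/

theorem hasDerivAt_kinetic (c y : ℝ) : HasDerivAt (fun y : ℝ => y ^ 2 / 2 + c) y y := by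
  have := (((hasDerivAt_id y).pow 2).div_const 2).add_const c
  simpa using this

theorem Xp_zero (v : ℝ × ℝ) (t : ℝ) : S.Xp 0 v t = (v.2, -deriv S.Vp v.1) := by
  simp only [Xp, zero_mul, add_zero, hamField, H0p]
  rw [(hasDerivAt_kinetic _ _).deriv, deriv_const_add]

theorem Xm_zero (v : ℝ × ℝ) (t : ℝ) : S.Xm 0 v t = (v.2, -deriv S.Vm v.1) := by
  simp only [Xm, zero_mul, add_zero, hamField, H0m]
  rw [(hasDerivAt_kinetic _ _).deriv, deriv_const_add]

theorem IsSolution.shift_zero (hq : S.IsSolution 0 q) (c : ℝ) :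
    S.IsSolution 0 fun t => q (t - c) := fun t =>
  IsSolutionAt.shift (t := t) (fun v _ => by rw [Xp_zero, Xp_zero])
    (fun v _ => by rw [Xm_zero, Xm_zero]) (hq (t - c))

theorem HalfP.follow {c₁ : ℝ} {w w' : ExtState} (h : S.HalfP c₁ w w')
    (hq : S.IsSolution w.2.2.1 q) (h0 : q w.2.1 = w.1) :
    w.2.1 < w'.2.1 ∧ q w'.2.1 = w'.1 ∧ (∀ r ∈ Ioo w.2.1 w'.2.1, 0 < (q r).1) ∧
      IntervalIntegrable (fun r => S.bracket (q r) r) MeasureTheory.volume w.2.1 w'.2.1 ∧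
      w'.2.2.2 - w.2.2.2 = ∫ r in w.2.1..w'.2.1, S.bracket (q r) r := by
  obtain ⟨z, h1, h2, h3, h4, -, -, h7, h8, h9, h10⟩ := h.exists_orbit
  have heq := hq.eqOn_of_orbit_p h2 (h0.trans h3.symm) (by rw [h3, h8])
    (by rw [h3]; exact h.2.1.2.1) h10
  have hb : EqOn (fun r => poissonBracket S.H0p (fun v => S.H1p v r) (z r))
      (fun r => S.bracket (q r) r) (uIoo w.2.1 w'.2.1) := by
    intro r hr
    rw [uIoo_of_lt h1] at hr
    have := h10 r hr
    simp only [bracket, heq (Ioo_subset_Icc_self hr), if_pos this.le]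
  refine ⟨h1, (heq (right_mem_Icc.2 h1.le)).trans h4, fun r hr => ?_, ?_, ?_⟩
  · rw [heq (Ioo_subset_Icc_self hr)]; exact h10 r hr
  · refine IntervalIntegrable.congr_uIoo (ContinuousOn.intervalIntegrable_of_Icc h1.le ?_) hb
    exact Continuous.comp_continuousOn' (f := fun r => (r, z r))
      (continuous_poissonBracket S.contDiff_H0p S.H1p_smooth)
      (continuousOn_id.prodMk h2.continuousOn)
  · rw [h7]
    exact intervalIntegral.integral_congr_uIoo hb

theorem HalfM.follow {c₁ : ℝ} {w w' : ExtState} (h : S.HalfM c₁ w w')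
    (hq : S.IsSolution w.2.2.1 q) (h0 : q w.2.1 = w.1) :
    w.2.1 < w'.2.1 ∧ q w'.2.1 = w'.1 ∧ (∀ r ∈ Ioo w.2.1 w'.2.1, (q r).1 < 0) ∧
      IntervalIntegrable (fun r => S.bracket (q r) r) MeasureTheory.volume w.2.1 w'.2.1 ∧
      w'.2.2.2 - w.2.2.2 = ∫ r in w.2.1..w'.2.1, S.bracket (q r) r := by
  obtain ⟨z, h1, h2, h3, h4, -, -, h7, h8, h9, h10⟩ := h.exists_orbit
  have heq := hq.eqOn_of_orbit_m h2 (h0.trans h3.symm) (by rw [h3, h8])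
    (by rw [h3]; exact h.2.1.2.2) h10
  have hb : EqOn (fun r => poissonBracket S.H0m (fun v => S.H1m v r) (z r))
      (fun r => S.bracket (q r) r) (uIoo w.2.1 w'.2.1) := by
    intro r hr
    rw [uIoo_of_lt h1] at hr
    have := h10 r hr
    simp only [bracket, heq (Ioo_subset_Icc_self hr), if_neg (not_le.2 this)]
  refine ⟨h1, (heq (right_mem_Icc.2 h1.le)).trans h4, fun r hr => ?_, ?_, ?_⟩
  · rw [heq (Ioo_subset_Icc_self hr)]; exact h10 r hr
  · refine IntervalIntegrable.congr_uIoo (ContinuousOn.intervalIntegrable_of_Icc h1.le ?_) hb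
    exact Continuous.comp_continuousOn' (f := fun r => (r, z r))
      (continuous_poissonBracket S.contDiff_H0m S.H1m_smooth)
      (continuousOn_id.prodMk h2.continuousOn)
  · rw [h7]
    exact intervalIntegral.integral_congr_uIoo hb

end PWHamiltonian

/-! ### The period integral -/

section PeriodIntegral

/-- The time of a monotone motion at energy `h` from `x = 0` to the turning point. -/
theorem turning_time {V X Y : ℝ → ℝ} {h p q : ℝ} (hpq : p < q) (hX : HasDerivOnIcc X Y p q)
    (hE : ∀ r ∈ Icc p q, Y r ^ 2 / 2 + V (X r) = h) (hY : ∀ r ∈ Ioo p q, 0 < Y r) (hp : X p = 0)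
    (hq : Y q = 0) : sInf {x | 0 < x ∧ V x = h} = X q ∧
      ∫ x in (0 : ℝ)..X q, 1 / √(2 * (h - V x)) = q - p := by
  have hmono : StrictMonoOn X (Icc p q) := by
    refine strictMonoOn_of_deriv_pos (convex_Icc p q) hX.continuousOn fun r hr => ?_
    rw [interior_Icc] at hr
    rw [(hX.hasDerivAt hr).deriv]
    exact hY r hr
  have hXq : 0 < X q := hp ▸ hmono (left_mem_Icc.2 hpq.le) (right_mem_Icc.2 hpq.le) hpq
  have himg : X '' Ioo p q = Ioo 0 (X q) := by
    refine Subset.antisymm ?_ ?_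
    · rintro _ ⟨r, hr, rfl⟩
      exact ⟨hp ▸ hmono (left_mem_Icc.2 hpq.le) (Ioo_subset_Icc_self hr) hr.1,
        hmono (Ioo_subset_Icc_self hr) (right_mem_Icc.2 hpq.le) hr.2⟩
    · have := intermediate_value_Ioo hpq.le hX.continuousOn
      rwa [hp] at this
  -- Before the stop Y ≠ 0, so V(X) = h - Y²/2 < h: no smaller positive `x` reaches the level `h`.
  refine ⟨IsLeast.csInf_eq ⟨⟨hXq, ?_⟩, fun x hx => ?_⟩, ?_⟩
  · simpa [hq] using hE q (right_mem_Icc.2 hpq.le)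
  · by_contra hlt
    obtain ⟨r, hr, rfl⟩ : x ∈ X '' Ioo p q := himg ▸ ⟨hx.1, not_le.1 hlt⟩
    have h1 := hE r (Ioo_subset_Icc_self hr)
    have h2 := hY r hr
    rw [hx.2] at h1
    nlinarith
  -- The substitution x = X(r) has dx = Y dr with Y = √(2(h - V)), so the integrand becomes 1.
  -- Working on the open interval avoids the singularity at the turning point.
  · rw [intervalIntegral.integral_of_le hXq.le, MeasureTheory.integral_Ioc_eq_integral_Ioo, ← himg,
      MeasureTheory.integral_image_eq_integral_abs_deriv_smul measurableSet_Ioo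
        (fun r hr => (hX.hasDerivAt hr).hasDerivWithinAt)
        (hmono.injOn.mono Ioo_subset_Icc_self)]
    have : EqOn (fun r => |Y r| • (1 / √(2 * (h - V (X r))))) (fun _ => (1 : ℝ)) (Ioo p q) := by
      intro r hr
      have h1 := hY r hr
      have h2 : 2 * (h - V (X r)) = Y r ^ 2 := by
        linarith [hE r (Ioo_subset_Icc_self hr)]
      simp only [h2, Real.sqrt_sq h1.le, abs_of_pos h1, smul_eq_mul]
      field_simp
    rw [MeasureTheory.setIntegral_congr_fun measurableSet_Ioo this]
    simp [hpq.le]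

/-- The time of the motion from `(0, y)` to `(0, -y)` in a potential `V` with `V(0) = 0`. -/
theorem half_period_integral {V : ℝ → ℝ} (hV : ContDiff ℝ ∞ V) {y a b : ℝ} (hy : 0 < y)
    (hab : a < b) {z : ℝ → ℝ × ℝ} (hzc : Continuous z)
    (hz : HasDerivOnIcc z (fun r => ((z r).2, -deriv V (z r).1)) a b)
    (hE : ∀ r ∈ Icc a b, (z r).2 ^ 2 / 2 + V (z r).1 = y ^ 2 / 2)
    (ha : z a = (0, y)) (hb : z b = (0, -y)) (hpos : ∀ r ∈ Ioo a b, 0 < (z r).1) :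
    2 * ∫ x in (0 : ℝ)..sInf {x | 0 < x ∧ V x = y ^ 2 / 2}, 1 / √(2 * (y ^ 2 / 2 - V x))
      = b - a := by
  have hX : HasDerivOnIcc (fun r => (z r).1) (fun r => (z r).2) a b := fun r hr => (hz r hr).fst'
  obtain ⟨p, hp, hp0⟩ : ∃ p ∈ Icc a b, (z p).2 = 0 := by
    have := intermediate_value_Icc' hab.le (f := fun r => (z r).2) hzc.snd.continuousOn
    obtain ⟨p, hp, hp'⟩ := this (show (0 : ℝ) ∈ Icc (z b).2 (z a).2 by
      rw [ha, hb]; exact ⟨by simp [hy.le], hy.le⟩)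
    exact ⟨p, hp, hp'⟩
  have hap : a < p := lt_of_le_of_ne hp.1 (by rintro rfl; rw [ha] at hp0; exact hy.ne' hp0)
  have hpb : p < b := lt_of_le_of_ne hp.2 (by
    rintro rfl; rw [hb] at hp0; exact (neg_neg_of_pos hy).ne hp0)
  obtain ⟨s₁, hs₁, hs₁0, hs₁pos⟩ := exists_first_zero (g := fun r => (z r).2) hzc.snd
    ((hzc.snd.continuousAt.eventually (lt_mem_nhds (show 0 < (z a).2 by rw [ha]; exact hy))).filter_mono
      nhdsWithin_le_nhds) hap hp0
  -- The second half is read backwards from `b`, which gives another monotone motion from x = 0 to a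
  -- stop at the same energy.
  obtain ⟨s₂, hs₂, hs₂0, hs₂pos⟩ := exists_first_zero (g := fun r => -(z (-r)).2)
    (a := -b) (p := -p) (by fun_prop)
    (((show Continuous fun r => -(z (-r)).2 by fun_prop).continuousAt.eventually
      (lt_mem_nhds (show 0 < -(z (- -b)).2 by rw [neg_neg, hb]; simpa using hy))).filter_mono nhdsWithin_le_nhds)
    (neg_lt_neg hpb) (by rw [neg_neg, hp0, neg_zero])
  obtain ⟨t₁, ht₁⟩ := turning_time (V := V) hs₁.1 (hX.mono le_rfl (hs₁.2.trans hp.2))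
    (fun r hr => hE r ⟨hr.1, hr.2.trans (hs₁.2.trans hp.2)⟩) hs₁pos (by rw [ha]) hs₁0
  have hXr : HasDerivOnIcc (fun r => (z (-r)).1) (fun r => -(z (-r)).2) (-b) s₂ := by
    intro r hr
    have h1 := hX (-r) ⟨by linarith [hr.2, hs₂.2], by linarith [hr.1]⟩
    have h2 := HasDerivWithinAt.comp r h1 (hasDerivAt_neg r).hasDerivWithinAt
      (s := Icc (-b) s₂) (fun x hx => ⟨by linarith [hx.2, hs₂.2], by linarith [hx.1]⟩)
    simpa [Function.comp_def] using h2
  obtain ⟨t₂, ht₂⟩ := turning_time (V := V) (h := y ^ 2 / 2) hs₂.1 hXr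
    (fun r hr => by
      rw [neg_sq]; exact hE (-r) ⟨by linarith [hr.2, hs₂.2], by linarith [hr.1]⟩)
    hs₂pos (by rw [neg_neg, hb]) hs₂0
  -- Both stops lie at the same turning point. Were they at different times, backward uniqueness
  -- would carry the coincidence to time `a` and give an interior time at which the orbit is again
  -- at (0, y), contradicting x > 0.
  have hs : s₁ = -s₂ := by
    by_contra hne
    have hlt : s₁ < -s₂ := lt_of_le_of_ne (by linarith [hs₁.2, hs₂.2]) hne
    have hzs : z s₁ = z (s₁ + (-s₂ - s₁)) := by
      rw [add_sub_cancel]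
      exact Prod.ext (t₁.symm.trans t₂) (hs₁0.trans (neg_eq_zero.1 hs₂0).symm)
    have hv : ContDiff ℝ 1 fun p : ℝ × ℝ × ℝ => (p.2.2, -deriv V p.2.1) := by
      have : ContDiff ℝ 1 (deriv V) := ((contDiff_infty_iff_deriv.1 hV).2).of_le (by simp)
      fun_prop
    have heq := ode_unique_left (v := fun _ w => (w.2, -deriv V w.1)) hv
      (f := z) (g := fun r => z (r + (-s₂ - s₁))) (a := a) (b := s₁) hzc.continuousOn
      (fun r hr => hz.left ⟨hr.1, by linarith [hr.2, hs₁.2]⟩)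
      (by fun_prop) (fun r hr => ?_) hzs (left_mem_Icc.2 hs₁.1.le)
    · have := hpos (a + (-s₂ - s₁)) ⟨by linarith, by linarith [hs₁.1, hs₂.1]⟩
      rw [show z (a + (-s₂ - s₁)) = (0, y) from heq.symm.trans ha] at this
      exact lt_irrefl _ this
    · have := hz.left (t := r + (-s₂ - s₁)) ⟨by linarith [hr.1], by linarith [hr.2, hs₂.1]⟩
      have h2 := hasDerivWithinAt_comp_sub (t := r) (c := -(-s₂ - s₁)) (s' := Iic r)
        (by rw [sub_neg_eq_add]; exact this)
        (fun x hx => by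
          have := mem_Iic.1 hx
          simp only [mem_Iic]; linarith)
      simpa only [sub_neg_eq_add] using h2
  rw [t₁, ht₁]
  rw [← t₂, t₁, ht₁] at ht₂
  linarith

end PeriodIntegral

namespace PWHamiltonian

variable {S : PWHamiltonian} {q : ℝ → ℝ × ℝ}

theorem H0_switching (h0 : S.H0 0 = 0) (y : ℝ) : S.Vp 0 = 0 ∧ S.Vm 0 = 0 ∧
    S.H0 (0, y) = y ^ 2 / 2 := by
  have h1 : S.Vp 0 = 0 := by simpa [H0, H0p] using h0
  exact ⟨h1, S.V_glue ▸ h1, by simp [H0, H0p, h1]⟩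

/-- The balance of the extended system at ε = 0. -/
theorem energy_p {a b : ℝ} {z : ℝ → ℝ × ℝ}
    (hz : HasDerivOnIcc z (fun r => S.Xp 0 (z r) r) a b) {r : ℝ} (hr : r ∈ Icc a b) :
    S.H0p (z r) = S.H0p (z a) := by
  obtain ⟨ζ, h0, h1, -, -, h4⟩ := exists_ext_orbit S.contDiff_H0p S.H1p_smooth
    (hr.1.trans hr.2) hz 0
  have := ext_energy S.contDiff_H0p S.H1p_smooth h4 (r := r - a)
    ⟨by linarith [hr.1], by linarith [hr.2]⟩
  rw [h1, h1, h0] at this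
  simpa using this

theorem energy_m {a b : ℝ} {z : ℝ → ℝ × ℝ}
    (hz : HasDerivOnIcc z (fun r => S.Xm 0 (z r) r) a b) {r : ℝ} (hr : r ∈ Icc a b) :
    S.H0m (z r) = S.H0m (z a) := by
  obtain ⟨ζ, h0, h1, -, -, h4⟩ := exists_ext_orbit S.contDiff_H0m S.H1m_smooth
    (hr.1.trans hr.2) hz 0
  have := ext_energy S.contDiff_H0m S.H1m_smooth h4 (r := r - a)
    ⟨by linarith [hr.1], by linarith [hr.2]⟩
  rw [h1, h1, h0] at this
  simpa using this

/-- The two halves of a closed unperturbed orbit through `(0, y)`. -/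
theorem IsSolution.exists_halves (hq : S.IsSolution 0 q) {y a p : ℝ} (hy : 0 < y)
    (ha : q a = (0, y)) (hap : a < p) (hp : q p = (0, y)) : ∃ b c, a < b ∧ b < c ∧
      HasDerivOnIcc q (fun r => S.Xp 0 (q r) r) a b ∧ (∀ r ∈ Ioo a b, 0 < (q r).1) ∧
      q b = (0, -y) ∧ HasDerivOnIcc q (fun r => S.Xm 0 (q r) r) b c ∧
      (∀ r ∈ Ioo b c, (q r).1 < 0) ∧ q c = (0, y) := by
  have hXp : ∀ t, (S.Xp 0 (q t) t).1 = (q t).2 := fun t => by rw [Xp_zero]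
  have hXm : ∀ t, (S.Xm 0 (q t) t).1 = (q t).2 := fun t => by rw [Xm_zero]
  have ha1 : (q a).1 = 0 := by rw [ha]
  have haX : 0 < (S.Xp 0 (q a) a).1 := by rw [hXp, ha]; exact hy
  obtain ⟨b, hb, hb0, hbpos⟩ := exists_first_zero hq.continuous.fst (hq.pos_after ha1 haX) hap
    (by rw [hp])
  -- The first hit is a downward crossing: an upward one would need x < 0 just before, where x > 0
  -- holds.
  have hb2 : (q b).2 < 0 := by
    rcases (hq b).2.2 hb0 with h | h
    · exfalso
      have h1 := eventually_neg_left h.2.2.1.fst' hb0 h.1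
      obtain ⟨r, hr1, hr2⟩ := (h1.and (Ioo_mem_nhdsLT hb.1)).exists
      exact absurd hr1 (hbpos r hr2).not_gt
    · rw [← hXp]; exact h.1
  have hbX : (S.Xm 0 (q b) b).1 < 0 := by rw [hXm]; exact hb2
  have hbp : b < p := lt_of_le_of_ne hb.2 (by
    rintro rfl; rw [hp] at hb2; exact hb2.not_gt hy)
  obtain ⟨c, hc, hc0, hcneg⟩ := exists_first_zero (g := fun r => -(q r).1)
    hq.continuous.fst.neg (hq.neg_after hb0 hbX) hbp (by simp [hp])
  have hc0' : (q c).1 = 0 := neg_eq_zero.1 hc0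
  have hc2 : 0 < (q c).2 := by
    rcases (hq c).2.2 hc0' with h | h
    · rw [← hXp]; exact h.2.1
    · exfalso
      have h1 := eventually_neg_left h.2.2.1.fst'.neg (by simp [hc0']) (neg_pos.2 h.1)
      obtain ⟨r, hr1, hr2⟩ := (h1.and (Ioo_mem_nhdsLT hc.1)).exists
      exact absurd hr1 (hcneg r hr2).not_gt
  have hdp : HasDerivOnIcc q (fun r => S.Xp 0 (q r) r) a b :=
    hasDerivOnIcc_of_Ioo (hq.up_derivs ha1 haX).2 (hq.down_derivs hb0 hbX).1
      fun t ht => (hq t).1 (hbpos t ht)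
  have hdm : HasDerivOnIcc q (fun r => S.Xm 0 (q r) r) b c :=
    hasDerivOnIcc_of_Ioo (hq.down_derivs hb0 hbX).2
      (hq.up_derivs hc0' (by rw [hXp]; exact hc2)).1
      fun t ht => (hq t).2.1 (neg_pos.1 (hcneg t ht))
  have hE1 := energy_p hdp (right_mem_Icc.2 hb.1.le)
  have hE2 := energy_m hdm (right_mem_Icc.2 hc.1.le)
  simp only [H0p, hb0, ha] at hE1
  have hqb : (q b).2 = -y := by
    have : ((q b).2 - y) * ((q b).2 + y) = 0 := by linarith
    rcases mul_eq_zero.1 this with h | h <;> linarith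
  simp only [H0m, hb0, hc0', hqb] at hE2
  have hqc : (q c).2 = y := by
    have : ((q c).2 - y) * ((q c).2 + y) = 0 := by linarith
    rcases mul_eq_zero.1 this with h | h <;> linarith
  exact ⟨b, c, hb.1, hc.1, hdp, hbpos, Prod.ext hb0 hqb, hdm,
    fun r hr => neg_pos.1 (hcneg r hr), Prod.ext hc0' hqc⟩

theorem alphap_eq (h0 : S.H0 0 = 0) (hq : Continuous q) {y a b : ℝ} (hy : 0 < y) (hab : a < b)
    (hd : HasDerivOnIcc q (fun r => S.Xp 0 (q r) r) a b) (ha : q a = (0, y)) (hb : q b = (0, -y))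
    (hpos : ∀ r ∈ Ioo a b, 0 < (q r).1) : S.alphap y = b - a := by
  have hV := (H0_switching h0 y).1
  simp only [alphap, turnp, (H0_switching h0 y).2.2]
  simp_rw [Xp_zero] at hd
  refine half_period_integral S.Vp_smooth hy hab hq hd (fun r hr => ?_) ha hb hpos
  have := energy_p (S := S) (a := a) (b := b) (z := q) (by simp_rw [Xp_zero]; exact hd) hr
  rw [ha] at this
  simpa [H0p, hV] using this

/-- The rotation z ↦ -z turns motion in x < 0 into motion in x > 0 for the potential V⁻(-x), which
reduces the claim to `half_period_integral`. The supremum in `turnm` becomes an infimum. -/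
theorem alpham_eq (h0 : S.H0 0 = 0) (hq : Continuous q) {y b c : ℝ} (hy : 0 < y) (hbc : b < c)
    (hd : HasDerivOnIcc q (fun r => S.Xm 0 (q r) r) b c) (hb : q b = (0, -y)) (hc : q c = (0, y))
    (hneg : ∀ r ∈ Ioo b c, (q r).1 < 0) : S.alpham (-y) = c - b := by
  have hV := (H0_switching h0 y).2.1
  have hset : {x | 0 < x ∧ S.Vm (-x) = y ^ 2 / 2} = -{x | x < 0 ∧ S.Vm x = y ^ 2 / 2} := by
    ext x; simp
  have key : 2 * ∫ x in (0 : ℝ)..sInf {x | 0 < x ∧ S.Vm (-x) = y ^ 2 / 2},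
      1 / √(2 * (y ^ 2 / 2 - S.Vm (-x))) = c - b := by
    refine half_period_integral (V := fun x => S.Vm (-x)) (z := fun r => -q r)
      (S.Vm_smooth.comp contDiff_neg) hy hbc hq.neg (fun r hr => ?_) (fun r hr => ?_)
      (by simp [hb]) (by simp [hc]) (fun r hr => neg_pos.2 (hneg r hr))
    · have h1 := (hd r hr).neg
      refine h1.congr_deriv ?_
      simp only [Xm_zero, deriv_comp_neg]
      ext <;> simp
    · have := energy_m hd hr
      rw [hb] at this
      simpa [H0m, hV] using this
  rw [hset, Real.sInf_def, neg_neg, intervalIntegral.integral_comp_neg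
    (fun x => 1 / √(2 * (y ^ 2 / 2 - S.Vm x))), neg_neg, neg_zero,
    intervalIntegral.integral_symm] at key
  simp only [alpham, turnm, (H0_switching h0 (-y)).2.2, neg_sq]
  linarith

end PWHamiltonian

/-! ### A quantitative two-dimensional implicit zero -/

theorem HasDerivAt.exists_abs_sub_le {f : ℝ → ℝ} {D x₀ : ℝ} (hf : HasDerivAt f D x₀)
    (h0 : f x₀ = 0) (hD : D ≠ 0) :
    ∃ r > 0, ∀ x, |x - x₀| < r → |f x - D * (x - x₀)| ≤ |D| / 2 * |x - x₀| := by
  have h1 := (hasDerivAt_iff_isLittleO.1 hf).def (half_pos (abs_pos.2 hD))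
  obtain ⟨r, hr, h2⟩ := Metric.eventually_nhds_iff.1 h1
  refine ⟨r, hr, fun x hx => ?_⟩
  have := h2 (show dist x x₀ < r from hx)
  simpa [h0, mul_comm] using this

/-- On a box with half-widths `K₁ * ε` and `K₂ * ε`, the linear parts of `f` and `M` dominate all
errors on opposite sides, so Poincaré–Miranda applies. Only continuity of `A ε` and `B ε` is used.
-/
theorem exists_common_zero {A B : ℝ → ℝ × ℝ → ℝ} {f M : ℝ → ℝ} {y₀ t₀ D D' L r : ℝ} (hr : 0 < r)
    (hL : 0 ≤ L) (hf : HasDerivAt f D y₀) (hf0 : f y₀ = 0) (hD : 0 < D) (hM : HasDerivAt M D' t₀)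
    (hM0 : M t₀ = 0) (hD' : D' ≠ 0)
    (hAc : ∀ ε ∈ Ioo 0 r, ContinuousOn (A ε) {p | |p.1 - y₀| < r ∧ |p.2 - t₀| < r})
    (hBc : ∀ ε ∈ Ioo 0 r, ContinuousOn (B ε) {p | |p.1 - y₀| < r ∧ |p.2 - t₀| < r})
    (hA : ∀ ε ∈ Ioo 0 r, ∀ y t, |y - y₀| < r → |t - t₀| < r → |A ε (y, t) - f y| ≤ L * ε)
    (hB : ∀ ε ∈ Ioo 0 r, ∀ y t, |y - y₀| < r → |t - t₀| < r →
      |B ε (y, t) - M t| ≤ L * (|y - y₀| + ε)) :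
    ∃ ε₀ > 0, ∃ K, ε₀ ≤ r ∧ ∀ ε ∈ Ioo 0 ε₀, ∃ y t, |y - y₀| ≤ K * ε ∧ |t - t₀| ≤ K * ε ∧
      |y - y₀| < r ∧ |t - t₀| < r ∧ A ε (y, t) = 0 ∧ B ε (y, t) = 0 := by
  obtain ⟨r₁, hr₁, h1⟩ := hf.exists_abs_sub_le hf0 hD.ne'
  obtain ⟨r₂, hr₂, h2⟩ := hM.exists_abs_sub_le hM0 hD'
  have hD'0 : 0 < |D'| := abs_pos.2 hD'
  -- `f` keeps at least half its slope, so at distance `K₁ * ε` it exceeds the error `L * ε` of `A`.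
  obtain ⟨K₁, hK₁, hK₁L⟩ : ∃ K₁ > 0, L < D / 2 * K₁ :=
    ⟨2 * (L + 1) / D, by positivity, by field_simp; linarith⟩
  -- `K₂` is chosen after `K₁`, since the error of `B` on the box also contains the width `K₁ * ε`
  -- in `y`.
  obtain ⟨K₂, hK₂, hK₂L⟩ : ∃ K₂ > 0, L * (K₁ + 1) < |D'| / 2 * K₂ :=
    ⟨2 * (L * (K₁ + 1) + 1) / |D'|, by positivity, by field_simp; linarith⟩
  set K := max K₁ K₂ with hK
  have hK0 : 0 < K := lt_max_of_lt_left hK₁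
  set R := min r (min r₁ r₂) with hR
  have hR0 : 0 < R := by positivity
  have hRr : R ≤ r := min_le_left _ _
  have hRr₁ : R ≤ r₁ := (min_le_right _ _).trans (min_le_left _ _)
  have hRr₂ : R ≤ r₂ := (min_le_right _ _).trans (min_le_right _ _)
  refine ⟨R / (K + 1), by positivity, K,
    (div_le_self hR0.le (by linarith)).trans hRr, fun ε hε => ?_⟩
  have hε0 := hε.1
  have hεR : (K + 1) * ε < R := by
    have := (lt_div_iff₀ (by linarith)).1 hε.2
    linarith
  have hKε : K * ε < R := by nlinarith
  have hεr : ε ∈ Ioo 0 r := ⟨hε0, by nlinarith⟩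
  have hK₁ε : K₁ * ε ≤ K * ε := by gcongr; exact le_max_left _ _
  have hK₂ε : K₂ * ε ≤ K * ε := by gcongr; exact le_max_right _ _
  have hK₁ε0 : 0 < K₁ * ε := by positivity
  have hK₂ε0 : 0 < K₂ * ε := by positivity
  have hyr : ∀ y ∈ Icc (y₀ - K₁ * ε) (y₀ + K₁ * ε), |y - y₀| ≤ K₁ * ε := fun y hy =>
    abs_le.2 ⟨by linarith [hy.1], by linarith [hy.2]⟩
  have htr : ∀ t ∈ Icc (t₀ - K₂ * ε) (t₀ + K₂ * ε), |t - t₀| ≤ K₂ * ε := fun t ht =>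
    abs_le.2 ⟨by linarith [ht.1], by linarith [ht.2]⟩
  have hsub : Icc (y₀ - K₁ * ε) (y₀ + K₁ * ε) ×ˢ Icc (t₀ - K₂ * ε) (t₀ + K₂ * ε) ⊆
      {p : ℝ × ℝ | |p.1 - y₀| < r ∧ |p.2 - t₀| < r} := fun p hp =>
    ⟨by linarith [hyr _ hp.1], by linarith [htr _ hp.2]⟩
  -- Multiplication by `D'` replaces the slope of `M` by D'² > 0, so the sign of `D'` needs no case
  -- distinction.
  have hBM : ∀ y ∈ Icc (y₀ - K₁ * ε) (y₀ + K₁ * ε), ∀ t ∈ Icc (t₀ - K₂ * ε) (t₀ + K₂ * ε),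
      |D' * B ε (y, t) - D' * M t| < D' ^ 2 / 2 * (K₂ * ε) := by
    intro y hy t ht
    have h3 := hB ε hεr y t (by linarith [hyr _ hy]) (by linarith [htr _ ht])
    have h4 : L * (|y - y₀| + ε) ≤ L * (K₁ + 1) * ε := by
      have := mul_le_mul_of_nonneg_left (hyr y hy) hL
      nlinarith
    rw [← mul_sub, abs_mul, ← sq_abs]
    have h5 : |B ε (y, t) - M t| < |D'| / 2 * K₂ * ε := by
      have := mul_lt_mul_of_pos_right hK₂L hε0
      linarith
    nlinarith [mul_lt_mul_of_pos_left h5 hD'0]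
  have hM' : ∀ t ∈ Icc (t₀ - K₂ * ε) (t₀ + K₂ * ε),
      |D' * M t - D' ^ 2 * (t - t₀)| ≤ D' ^ 2 / 2 * |t - t₀| := by
    intro t ht
    have h3 := h2 t (by linarith [htr _ ht])
    rw [show D' * M t - D' ^ 2 * (t - t₀) = D' * (M t - D' * (t - t₀)) by ring, abs_mul, ← sq_abs D']
    nlinarith [mul_le_mul_of_nonneg_left h3 hD'0.le]
  have hyl : y₀ - K₁ * ε ∈ Icc (y₀ - K₁ * ε) (y₀ + K₁ * ε) := ⟨le_rfl, by linarith⟩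
  have hyu : y₀ + K₁ * ε ∈ Icc (y₀ - K₁ * ε) (y₀ + K₁ * ε) := ⟨by linarith, le_rfl⟩
  have htl : t₀ - K₂ * ε ∈ Icc (t₀ - K₂ * ε) (t₀ + K₂ * ε) := ⟨le_rfl, by linarith⟩
  have htu : t₀ + K₂ * ε ∈ Icc (t₀ - K₂ * ε) (t₀ + K₂ * ε) := ⟨by linarith, le_rfl⟩
  have hDK : L * ε < D / 2 * (K₁ * ε) := by
    have := mul_lt_mul_of_pos_right hK₁L hε0
    linarith
  have hPM : ∃ p ∈ Icc (y₀ - K₁ * ε) (y₀ + K₁ * ε) ×ˢ Icc (t₀ - K₂ * ε) (t₀ + K₂ * ε),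
      A ε p = 0 ∧ D' * B ε p = 0 := by
    refine poincare_miranda hyl.2 htl.2 ((hAc ε hεr).mono hsub)
      (((hBc ε hεr).mono hsub).const_mul D') ?_ ?_ ?_ ?_
    · intro t ht
      have h3 := abs_le.1 (hA ε hεr _ t (by linarith [hyr _ hyl]) (by linarith [htr _ ht]))
      have h4 := abs_le.1 (h1 (y₀ - K₁ * ε) (by linarith [hyr _ hyl]))
      rw [sub_sub_cancel_left, abs_neg, abs_of_pos hK₁ε0, abs_of_pos hD] at h4
      linarith [h3.2, h4.2]
    · intro t ht
      have h3 := abs_le.1 (hA ε hεr _ t (by linarith [hyr _ hyu]) (by linarith [htr _ ht]))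
      have h4 := abs_le.1 (h1 (y₀ + K₁ * ε) (by linarith [hyr _ hyu]))
      rw [add_sub_cancel_left, abs_of_pos hK₁ε0, abs_of_pos hD] at h4
      linarith [h3.1, h4.1]
    · intro y hy
      have h3 := abs_lt.1 (hBM y hy _ htl)
      have h4 := abs_le.1 (hM' _ htl)
      rw [sub_sub_cancel_left, abs_neg, abs_of_pos hK₂ε0] at h4
      linarith [h3.2, h4.2]
    · intro y hy
      have h3 := abs_lt.1 (hBM y hy _ htu)
      have h4 := abs_le.1 (hM' _ htu)
      rw [add_sub_cancel_left, abs_of_pos hK₂ε0] at h4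
      linarith [h3.1, h4.1]
  obtain ⟨⟨y, t⟩, ⟨hy, ht⟩, hA0, hB0⟩ := hPM
  exact ⟨y, t, (hyr y hy).trans hK₁ε, (htr t ht).trans hK₂ε, (hsub ⟨hy, ht⟩).1,
    (hsub ⟨hy, ht⟩).2, hA0, (mul_eq_zero.1 hB0).resolve_left hD'⟩

/-! ### Return times and reference passages -/

/-- Every state near `w₀` on `Σ` is related by `R` to its image under a map that is Lipschitz near
`w₀` and sends `w₀` to `w₁`. -/
def LipReach (R : ExtState → ExtState → Prop) (w₀ w₁ : ExtState) : Prop :=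
  ∃ P : ExtState → ExtState, P w₀ = w₁ ∧ ∃ U ∈ 𝓝 w₀, (∃ L, LipschitzOnWith L P U) ∧
    ∀ w ∈ U, w.1.1 = 0 → R w (P w)

/-- Continuity of the first map keeps nearby states in the domain of the second, and `hR` returns
them to Σ, where the second relation is available. -/
theorem LipReach.comp {R R' : ExtState → ExtState → Prop} {w₀ w₁ w₂ : ExtState}
    (h : LipReach R w₀ w₁) (h' : LipReach R' w₁ w₂) (hR : ∀ w w', R w w' → w'.1.1 = 0) :
    LipReach (Relation.Comp R R') w₀ w₂ := by
  obtain ⟨P, rfl, U, hU, ⟨L, hL⟩, hP⟩ := h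
  obtain ⟨P', rfl, U', hU', ⟨L', hL'⟩, hP'⟩ := h'
  have hc : ContinuousAt P w₀ := hL.continuousOn.continuousAt hU
  exact ⟨P' ∘ P, rfl, U ∩ P ⁻¹' U', inter_mem hU (hc hU'),
    ⟨L' * L, hL'.comp (hL.mono inter_subset_left) fun w hw => hw.2⟩,
    fun w hw h0 => ⟨P w, hP w hw.1 h0, hP' _ hw.2 (hR _ _ (hP w hw.1 h0))⟩⟩

/-- Open conditions at the two reference states persist for nearby states and their images; this is
how transversal crossing is added to a transit. -/
theorem LipReach.restrict {R : ExtState → ExtState → Prop} {w₀ w₁ : ExtState}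
    (h : LipReach R w₀ w₁) {O O' : Set ExtState} (hO : O ∈ 𝓝 w₀) (hO' : O' ∈ 𝓝 w₁) :
    LipReach (fun w w' => R w w' ∧ w ∈ O ∧ w' ∈ O') w₀ w₁ := by
  obtain ⟨P, rfl, U, hU, ⟨L, hL⟩, hP⟩ := h
  have hc : ContinuousAt P w₀ := hL.continuousOn.continuousAt hU
  exact ⟨P, rfl, U ∩ (O ∩ P ⁻¹' O'), inter_mem hU (inter_mem hO (hc hO')),
    ⟨L, hL.mono inter_subset_left⟩, fun w hw h0 => ⟨hP w hw.1 h0, hw.2.1, hw.2.2⟩⟩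

/-- A transverse planar orbit from `Σ` to `Σ` is a reference for Lipschitz transits. -/
theorem lipReach_transit {H : ℝ × ℝ → ℝ} {W : ℝ × ℝ → ℝ → ℝ} (hH : ContDiff ℝ ∞ H)
    (hW : ContDiff ℝ ∞ fun p : (ℝ × ℝ) × ℝ => W p.1 p.2) {ℓ : ℝ × ℝ →L[ℝ] ℝ}
    (hℓ : ∀ z : ℝ × ℝ, z.1 = 0 → ℓ z = 0) {ε a b : ℝ} (hab : a < b) {z : ℝ → ℝ × ℝ}
    (hz : HasDerivOnIcc z (fun r => pertField H W ε (z r) r) a b)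
    (ha : 0 < ℓ (pertField H W ε (z a) a)) (hb0 : ℓ (z b) = 0)
    (hb : ℓ (pertField H W ε (z b) b) < 0) (hpos : ∀ r ∈ Ioo a b, 0 < ℓ (z r)) (u : ℝ) :
    ∃ u', LipReach (Transit (extField H W) (ℓ.comp (ContinuousLinearMap.fst ℝ _ _)))
      (z a, a, ε, u) (z b, b, ε, u') := by
  obtain ⟨ζ, h0, h1, h2, h3, h4⟩ := exists_ext_orbit hH hW hab.le hz u
  have hζb : ζ (b - a) = (z b, b, ε, (ζ (b - a)).2.2.2) :=
    Prod.ext (by rw [h1, sub_add_cancel]) (Prod.ext (by rw [h2, sub_add_cancel])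
      (Prod.ext (h3 _) rfl))
  obtain ⟨P, hP, U, hU, hL, hT⟩ := exists_lipschitz_transit (contDiff_extField hH hW)
    (ℓ.comp (ContinuousLinearMap.fst ℝ _ _)) (sub_pos.2 hab) h4 (by rw [h0]; exact ha)
    (fun r hr => by
      simp only [ContinuousLinearMap.comp_apply, ContinuousLinearMap.coe_fst', h1]
      exact hpos _ ⟨by linarith [hr.1], by linarith [hr.2]⟩)
    (by rw [hζb]; exact hb0) (by rw [hζb]; exact hb)
  rw [h0] at hP hU
  exact ⟨_, P, hP.trans hζb, U, hU, hL, fun w hw hw0 => hT w hw (hℓ _ hw0)⟩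

namespace PWHamiltonian

variable {S : PWHamiltonian} {q : ℝ → ℝ × ℝ} {c₁ : ℝ}

/-! ### Reference passages along an unperturbed orbit. -/

theorem continuous_Xp_fst :
    Continuous fun w : ExtState => (S.Xp w.2.2.1 w.1 w.2.1).1 :=
  (contDiff_extField S.contDiff_H0p S.H1p_smooth).continuous.fst.fst

theorem continuous_Xm_fst :
    Continuous fun w : ExtState => (S.Xm w.2.2.1 w.1 w.2.1).1 :=
  (contDiff_extField S.contDiff_H0m S.H1m_smooth).continuous.fst.fst

theorem isOpen_crossUp : IsOpen (S.crossUp c₁) :=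
  (isOpen_Ioo.preimage continuous_fst.snd).inter
    ((isOpen_Ioi.preimage continuous_Xp_fst).inter (isOpen_Ioi.preimage continuous_Xm_fst))

theorem isOpen_crossDown : IsOpen (S.crossDown c₁) :=
  (isOpen_Ioo.preimage continuous_fst.snd).inter
    ((isOpen_Iio.preimage continuous_Xp_fst).inter (isOpen_Iio.preimage continuous_Xm_fst))

theorem crossUp_mem_nhds {y : ℝ} (hy : y ∈ Ioo 0 √(2 * c₁)) (x t u : ℝ) :
    S.crossUp c₁ ∈ 𝓝 (((x, y), t, 0, u) : ExtState) :=
  isOpen_crossUp.mem_nhds ⟨hy, by simpa [Xp_zero] using hy.1, by simpa [Xm_zero] using hy.1⟩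

theorem crossDown_mem_nhds {y : ℝ} (hy : y ∈ Ioo 0 √(2 * c₁)) (x t u : ℝ) :
    S.crossDown c₁ ∈ 𝓝 (((x, -y), t, 0, u) : ExtState) :=
  isOpen_crossDown.mem_nhds ⟨⟨neg_lt_neg hy.2, neg_neg_of_pos hy.1⟩,
    by simpa [Xp_zero] using hy.1, by simpa [Xm_zero] using hy.1⟩

theorem exists_lipReach_pass (hq : S.IsSolution 0 q) {y a p : ℝ} (hy : y ∈ Ioo 0 √(2 * c₁))
    (ha : q a = (0, y)) (hap : a < p) (hp : q p = (0, y)) (u : ℝ) :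
    ∃ t' u', LipReach (S.Pass c₁) ((0, y), a, 0, u) ((0, y), t', 0, u') := by
  obtain ⟨b, c, hab, hbc, hdp, hpos, hb, hdm, hneg, hc⟩ := hq.exists_halves hy.1 ha hap hp
  have hy0 := hy.1
  obtain ⟨u₁, h1⟩ := lipReach_transit S.contDiff_H0p S.H1p_smooth
    (ℓ := ContinuousLinearMap.fst ℝ ℝ ℝ) (fun z hz => hz) hab hdp
    (show 0 < (S.Xp 0 (q a) a).1 by rw [Xp_zero, ha]; exact hy0) (by rw [hb]; rfl)
    (show (S.Xp 0 (q b) b).1 < 0 by rw [Xp_zero, hb]; exact neg_neg_of_pos hy0) hpos u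
  obtain ⟨u₂, h2⟩ := lipReach_transit S.contDiff_H0m S.H1m_smooth
    (ℓ := -ContinuousLinearMap.fst ℝ ℝ ℝ) (fun z hz => neg_eq_zero.2 hz) hbc hdm
    (show 0 < -(S.Xm 0 (q b) b).1 by rw [Xm_zero, hb]; simpa using hy0) (by rw [hc]; simp)
    (show -(S.Xm 0 (q c) c).1 < 0 by rw [Xm_zero, hc]; exact neg_neg_of_pos hy0)
    (fun r hr => neg_pos.2 (hneg r hr)) u₁
  rw [ha, hb] at h1
  rw [hb, hc] at h2
  refine ⟨c, u₂, (h1.restrict (crossUp_mem_nhds hy 0 a u) (crossDown_mem_nhds hy 0 b u₁)).comp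
    (h2.restrict (crossDown_mem_nhds hy 0 b u₁) (crossUp_mem_nhds hy 0 c u₂)) ?_⟩
  intro w w' h
  obtain ⟨-, -, -, -, -, -, -, -, -, h9, -⟩ := HalfP.exists_orbit h
  exact h9

theorem exists_lipReach_passIter (hq : S.IsSolution 0 q) {y p : ℝ} (hy : y ∈ Ioo 0 √(2 * c₁))
    (h0 : q 0 = (0, y)) (hp0 : 0 < p) (hp : q p = (0, y)) (k : ℕ) (t u : ℝ) :
    ∃ t' u', LipReach (PassIter (S := S) c₁ k) ((0, y), t, 0, u) ((0, y), t', 0, u') := by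
  induction k generalizing t u with
  | zero => exact ⟨t, u, id, rfl, univ, univ_mem, ⟨1, LipschitzWith.id.lipschitzOnWith⟩,
      fun w _ _ => rfl⟩
  | succ k ih =>
    obtain ⟨t₁, u₁, h1⟩ := exists_lipReach_pass (hq.shift_zero t) hy (a := t) (p := p + t)
      (by simpa using h0) (by linarith) (by simpa using hp) u
    obtain ⟨t₂, u₂, h2⟩ := ih t₁ u₁
    exact ⟨t₂, u₂, h1.comp h2 fun w w' h => h.invariants.2.2.1⟩

/-- The first return time of a solution is its least period. -/
theorem IsSolution.first_return (hq : S.IsSolution 0 q) {p a b : ℝ}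
    (hp : IsLeast {s : ℝ | 0 < s ∧ Function.Periodic q s} p) (hab : a < b) (h : q b = q a)
    (hne : ∀ r ∈ Ioo a b, q r ≠ q a) : b - a = p := by
  refine le_antisymm ?_ (hp.2 ⟨sub_pos.2 hab, fun s => ?_⟩)
  · by_contra hlt
    exact hne (a + p) ⟨by linarith [hp.1.1], by linarith⟩ (hp.1.2 a)
  · have hfwd : ∀ r, a ≤ r → q (r + (b - a)) = q r := by
      intro r hr
      have : q (r - -(b - a)) = q r :=
        (hq.shift_zero (-(b - a))).eqOn_Ici hq (a := a) (by simpa using h) hr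
      rwa [sub_neg_eq_add] at this
    -- Forward uniqueness gives the return identity only after `a`. The known period `p` moves any
    -- earlier time beyond `a`.
    obtain ⟨N, hN⟩ := exists_nat_ge ((a - s) / p)
    have hN' : a ≤ s + N * p := by
      have := (div_le_iff₀ hp.1.1).1 hN
      linarith
    have h1 := hfwd _ hN'
    rw [add_right_comm, hp.1.2.nat_mul N, hp.1.2.nat_mul N] at h1
    exact h1

/-- At ε = 0 energy gives y'² = y², and both heights are positive, so a single passage closes the
orbit. There is no earlier return, since x ≠ 0 inside each half and y < 0 at the crossing between
them. -/
theorem Pass.follow {w w' : ExtState} (h : S.Pass c₁ w w') (hε : w.2.2.1 = 0)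
    (hq : S.IsSolution 0 q) (h0 : q w.2.1 = w.1) :
    w.2.1 < w'.2.1 ∧ q w'.2.1 = w'.1 ∧ w'.1 = w.1 ∧ (∀ r ∈ Ioo w.2.1 w'.2.1, q r ≠ w.1) ∧
      IntervalIntegrable (fun r => S.bracket (q r) r) MeasureTheory.volume w.2.1 w'.2.1 ∧
      w'.2.2.2 - w.2.2.2 = ∫ r in w.2.1..w'.2.1, S.bracket (q r) r := by
  obtain ⟨i1, i2, i3, i4, i5, i6⟩ := h.invariants
  have hw : w'.1 = w.1 := by
    refine Prod.ext (i3.trans i2.symm) ?_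
    rw [hε] at i4
    have : (w'.1.2 - w.1.2) * (w'.1.2 + w.1.2) = 0 := by linarith
    rcases mul_eq_zero.1 this with h | h <;> linarith
  obtain ⟨d, h1, h2⟩ := h
  obtain ⟨-, -, -, -, -, k1, -⟩ := h1.exists_orbit
  obtain ⟨a1, a2, a3, a4, a5⟩ := h1.follow (hε ▸ hq) h0
  obtain ⟨b1, b2, b3, b4, b5⟩ := h2.follow (by rw [k1, hε]; exact hq) a2
  refine ⟨a1.trans b1, b2, hw, fun r hr heq => ?_, a4.trans b4, ?_⟩
  · rcases lt_trichotomy r d.2.1 with hrd | rfl | hrd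
    · have := a3 r ⟨hr.1, hrd⟩
      rw [heq, i2] at this
      exact lt_irrefl _ this
    · rw [a2] at heq
      have := h2.2.1.1.2
      rw [heq] at this
      exact this.not_gt i5
    · have := b3 r ⟨hrd, hr.2⟩
      rw [heq, i2] at this
      exact lt_irrefl _ this
  · rw [← intervalIntegral.integral_add_adjacent_intervals a4 b4, ← a5, ← b5]
    ring

theorem PassIter.follow {w w' : ExtState} {k : ℕ} (h : PassIter (S := S) c₁ k w w')
    (hε : w.2.2.1 = 0) (hq : S.IsSolution 0 q) (h0 : q w.2.1 = w.1) :
    IntervalIntegrable (fun r => S.bracket (q r) r) MeasureTheory.volume w.2.1 w'.2.1 ∧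
      w'.2.2.2 - w.2.2.2 = ∫ r in w.2.1..w'.2.1, S.bracket (q r) r := by
  induction k generalizing w with
  | zero =>
    obtain rfl : w = w' := h
    simp
  | succ k ih =>
    obtain ⟨d, h1, h2⟩ := h
    obtain ⟨a1, a2, a3, a4, a5, a6⟩ := h1.follow hε hq h0
    obtain ⟨b1, b2⟩ := ih h2 (h1.invariants.1.trans hε) a2
    refine ⟨a5.trans b1, ?_⟩
    rw [← intervalIntegral.integral_add_adjacent_intervals a5 b1, ← a6, ← b2]
    ring

/-- Each unperturbed passage ends at the first return to its starting point, so by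
`IsSolution.first_return` it takes exactly one least period. -/
theorem PassIter.time {w w' : ExtState} {k : ℕ} (h : PassIter (S := S) c₁ k w w')
    (hε : w.2.2.1 = 0) (hq : S.IsSolution 0 q) (h0 : q w.2.1 = w.1) {p : ℝ}
    (hp : IsLeast {s : ℝ | 0 < s ∧ Function.Periodic q s} p) : w'.2.1 = w.2.1 + k * p := by
  induction k generalizing w with
  | zero =>
    obtain rfl : w = w' := h
    simp
  | succ k ih =>
    obtain ⟨d, h1, h2⟩ := h
    obtain ⟨a1, a2, a3, a4, -, -⟩ := h1.follow hε hq h0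
    have h3 := ih h2 (h1.invariants.1.trans hε) a2
    have h4 := hq.first_return hp a1 (a2.trans (a3.trans h0.symm)) (by rw [h0]; exact a4)
    rw [h3]
    push_cast
    linarith

/-- The two integrals are the durations of the two halves of the orbit, and their sum is the time of
first return. -/
theorem alpha_eq_period (h0 : S.H0 0 = 0) (hq : S.IsSolution 0 q) {y p : ℝ} (hy : 0 < y)
    (hq0 : q 0 = (0, y)) (hp : IsLeast {s : ℝ | 0 < s ∧ Function.Periodic q s} p) :
    S.alpha y = p := by
  have hqp : q p = (0, y) := by rw [← hq0, ← hp.1.2 0, zero_add]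
  obtain ⟨b, c, hab, hbc, hdp, hpos, hb, hdm, hneg, hc⟩ := hq.exists_halves hy hq0 hp.1.1 hqp
  have h1 := alphap_eq h0 hq.continuous hy hab hdp hq0 hb hpos
  have h2 := alpham_eq h0 hq.continuous hy hbc hdm hb hc hneg
  have h3 := hq.first_return hp (hab.trans hbc) (hc.trans hq0.symm) (fun r hr heq => ?_)
  · rw [alpha, h1, h2]; linarith
  · rw [hq0] at heq
    rcases lt_trichotomy r b with hrb | rfl | hrb
    · have := hpos r ⟨hr.1, hrb⟩
      rw [heq] at this
      exact lt_irrefl _ this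
    · rw [hb] at heq
      have := congrArg Prod.snd heq
      simp only at this
      linarith
    · have := hneg r ⟨hrb, hr.2⟩
      rw [heq] at this
      exact lt_irrefl _ this

/-- On the segment from the origin to (0, y) the energy is s²/2 < c₁, while it equals c₁ on the
heteroclinic loop. The segment therefore joins (0, y) to the origin inside the enclosed component.
-/
theorem switching_mem_levelSet {zp zm : ℝ × ℝ} {γ₁ γ₂ : ℝ → ℝ × ℝ}
    (hC1 : S.HasSaddles zp zm c₁) (h0 : S.H0 0 = 0) (hC3 : S.HasHeteroclinics zp zm c₁ γ₁ γ₂)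
    {y : ℝ} (hy : y ∈ Ioo 0 √(2 * c₁)) :
    (0, y) ∈ S.levelSet (heteroclinicLoop zp zm γ₁ γ₂) (y ^ 2 / 2) := by
  have hΓ : ∀ z ∈ heteroclinicLoop zp zm γ₁ γ₂, S.H0 z = c₁ := by
    rintro z (((rfl | rfl) | ⟨t, rfl⟩) | ⟨t, rfl⟩)
    · exact hC1.zp_level
    · exact hC1.zm_level
    · exact hC3.level₁ t
    · exact hC3.level₂ t
  have hc : y ^ 2 < 2 * c₁ := (Real.lt_sqrt hy.1.le).1 hy.2
  refine ⟨?_, (H0_switching h0 y).2.2⟩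
  have hpre : IsPreconnected ((fun s : ℝ => ((0 : ℝ), s)) '' Icc 0 y) :=
    isPreconnected_Icc.image _ (by fun_prop)
  refine hpre.subset_connectedComponentIn ⟨0, ⟨le_rfl, hy.1.le⟩, rfl⟩ ?_
    ⟨y, ⟨hy.1.le, le_rfl⟩, rfl⟩
  rintro _ ⟨s, hs, rfl⟩ hmem
  have h1 := hΓ _ hmem
  rw [(H0_switching h0 s).2.2] at h1
  nlinarith [hs.1, hs.2, hy.1]

theorem periodic_comp_sub_iff {α : Type*} {f : ℝ → α} {c s : ℝ} :
    Function.Periodic (fun x => f (x - c)) s ↔ Function.Periodic f s := by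
  refine ⟨fun h x => ?_, fun h x => ?_⟩
  · have h1 : f (x + c + s - c) = f (x + c - c) := h (x + c)
    rwa [add_sub_cancel_right, show x + c + s - c = x + s by ring] at h1
  · change f (x + s - c) = f (x - c)
    rw [add_sub_right_comm, h]

theorem IsPeriodicOrbit.exists_solution {C : Set (ℝ × ℝ)} {p : ℝ} (h : S.IsPeriodicOrbit C p)
    {z : ℝ × ℝ} (hz : z ∈ C) : ∃ q, S.IsSolution 0 q ∧ q 0 = z ∧
      IsLeast {s : ℝ | 0 < s ∧ Function.Periodic q s} p := by
  obtain ⟨q, hq, rfl, hp⟩ := h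
  obtain ⟨σ, rfl⟩ := hz
  refine ⟨fun t => q (t - (-σ)), hq.shift_zero (-σ), by simp, ?_⟩
  simpa only [periodic_comp_sub_iff] using hp

end PWHamiltonian

/-! ### The subharmonic Melnikov theorem -/

namespace PWHamiltonian

variable {S : PWHamiltonian}

/-- A return map of the extended system that is Lipschitz near a resonant unperturbed orbit has,
near a simple zero of the Melnikov function, a point that returns with unchanged energy after the
prescribed time. -/
theorem exists_closed_passIter {c₁ ybar tbar : ℝ} {n m : ℕ} {per : ℝ → ℝ}
    (hm : 0 < m) (hy : ybar ∈ Ioo 0 √(2 * c₁)) {q : ℝ → ℝ × ℝ} (hq : S.IsSolution 0 q)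
    (hq0 : q 0 = (0, ybar))
    (hper : ∀ y ∈ Ioo 0 √(2 * c₁), ∃ Q, S.IsSolution 0 Q ∧ Q 0 = (0, y) ∧
      IsLeast {s : ℝ | 0 < s ∧ Function.Periodic Q s} (per (y ^ 2 / 2)))
    {d : ℝ} (hd : HasDerivAt per d (ybar ^ 2 / 2)) (hd0 : 0 < d)
    (hres : m * per (ybar ^ 2 / 2) = n * S.T)
    (hzero : S.melnikov q n tbar = 0) (hsimple : deriv (S.melnikov q n) tbar ≠ 0) :
    ∃ ε₀ > 0, ∃ K, ∀ ε ∈ Ioo 0 ε₀, ∃ y t, |y - ybar| ≤ K * ε ∧ |t - tbar| ≤ K * ε ∧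
      ∃ u, PassIter (S := S) c₁ m ((0, y), t, ε, 0) ((0, y), t + n * S.T, ε, u) := by
  obtain ⟨Q, hQ, hQ0, hQp⟩ := hper ybar hy
  -- The image of the reference state can be forgotten: values of `P` are recovered below from its
  -- passages.
  obtain ⟨t', u', P, -, U, hU, ⟨L, hL⟩, hP⟩ := exists_lipReach_passIter (S := S) (c₁ := c₁) hQ hy
    hQ0 hQp.1.1 (by rw [← hQ0, ← hQp.1.2 0, zero_add]) m tbar 0
  obtain ⟨r₁, hr₁, hr₁U⟩ := Metric.mem_nhds_iff.1 hU
  set ι : ℝ → ℝ × ℝ → ExtState := fun ε p => ((0, p.1), p.2, ε, 0) with hι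
  have hιc : ∀ ε, Continuous (ι ε) := fun ε => by fun_prop
  set r := min r₁ (min ybar (√(2 * c₁) - ybar)) with hr
  have hr0 : 0 < r := lt_min hr₁ (lt_min hy.1 (sub_pos.2 hy.2))
  have hιU : ∀ ε y t, |ε| < r → |y - ybar| < r → |t - tbar| < r → ι ε (y, t) ∈ U := by
    intro ε y t hε hy' ht'
    refine hr₁U ?_
    have hr1 : r ≤ r₁ := min_le_left _ _
    simp only [hι, Metric.mem_ball, Prod.dist_eq, Real.dist_eq, sub_self, abs_zero, sub_zero,
      max_lt_iff]
    exact ⟨⟨hr₁, hy'.trans_le hr1⟩, ht'.trans_le hr1, hε.trans_le hr1, hr₁⟩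
  have hyI : ∀ y, |y - ybar| < r → y ∈ Ioo 0 √(2 * c₁) := by
    intro y h
    have h1 : r ≤ ybar := (min_le_right _ _).trans (min_le_left _ _)
    have h2 : r ≤ √(2 * c₁) - ybar := (min_le_right _ _).trans (min_le_right _ _)
    have := abs_lt.1 h
    exact ⟨by linarith, by linarith⟩
  have hPι : ∀ ε y t, |ε| < r → |y - ybar| < r → |t - tbar| < r →
      PassIter (S := S) c₁ m (ι ε (y, t)) (P (ι ε (y, t))) := fun ε y t h1 h2 h3 =>
    hP _ (hιU ε y t h1 h2 h3) rfl
  have hdist : ∀ ε y t y', |ε| < r → |y - ybar| < r → |t - tbar| < r → |y' - ybar| < r →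
      dist (P (ι ε (y, t))) (P (ι 0 (y', t))) ≤ L * (|y - y'| + |ε|) := by
    intro ε y t y' h1 h2 h3 h4
    refine (hL.dist_le_mul _ (hιU ε y t h1 h2 h3) _ (hιU 0 y' t (by simpa using hr0) h4 h3)).trans ?_
    gcongr
    simp only [hι, Prod.dist_eq, Real.dist_eq, sub_self, abs_zero, sub_zero]
    have := abs_nonneg (y - y')
    have := abs_nonneg ε
    simp only [max_le_iff]
    refine ⟨⟨by linarith, by linarith⟩, by linarith, by linarith, by linarith⟩
  have htime : ∀ w w' : ExtState, |w.2.1 - w'.2.1| ≤ dist w w' := fun w w' => by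
    rw [Prod.dist_eq, Prod.dist_eq, ← Real.dist_eq]
    exact (le_max_left _ _).trans (le_max_right _ _)
  have hu : ∀ w w' : ExtState, |w.2.2.2 - w'.2.2.2| ≤ dist w w' := fun w w' => by
    rw [Prod.dist_eq, Prod.dist_eq, Prod.dist_eq, ← Real.dist_eq]
    exact (le_max_right _ _).trans ((le_max_right _ _).trans (le_max_right _ _))
  have htime0 : ∀ y t, |y - ybar| < r → |t - tbar| < r →
      (P (ι 0 (y, t))).2.1 = t + m * per (y ^ 2 / 2) := by
    intro y t h1 h2
    obtain ⟨Q, hQ, hQ0, hQp⟩ := hper y (hyI y h1)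
    exact (hPι 0 y t (by simpa using hr0) h1 h2).time rfl (hQ.shift_zero t) (by simp [hι, hQ0])
      (by simpa only [periodic_comp_sub_iff] using hQp)
  -- Only at `ybar` is the unperturbed return time equal to nT, so that the accumulated bracket is
  -- the full Melnikov integral, up to a translation of time.
  have hu0 : ∀ t, |t - tbar| < r → (P (ι 0 (ybar, t))).2.2.2 = S.melnikov q n t := by
    intro t h2
    have h1 : |ybar - ybar| < r := by simpa using hr0
    have h3 := ((hPι 0 ybar t (by simpa using hr0) h1 h2).follow rfl (hq.shift_zero t)
      (by simp [hι, hq0])).2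
    rw [htime0 ybar t h1 h2, hres] at h3
    simp only [hι, sub_zero] at h3
    rw [h3, melnikov]
    have := intervalIntegral.integral_comp_add_right (a := 0) (b := n * S.T)
      (fun x => S.bracket (q (x - t)) x) t
    simp only [add_sub_cancel_right, zero_add] at this
    rw [this, add_comm t]
  have hcont : ∀ ε ∈ Ioo 0 r,
      ContinuousOn (fun p => P (ι ε p)) {p | |p.1 - ybar| < r ∧ |p.2 - tbar| < r} := by
    intro ε hε
    exact hL.continuousOn.comp (hιc ε).continuousOn fun p hp =>
      hιU ε p.1 p.2 (by rw [abs_of_pos hε.1]; exact hε.2) hp.1 hp.2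
  have hm' : (0 : ℝ) < m := Nat.cast_pos.2 hm
  have hf : HasDerivAt (fun y => m * per (y ^ 2 / 2) - n * S.T) (m * (d * ybar)) ybar := by
    have h1 : HasDerivAt (fun y : ℝ => y ^ 2 / 2) ybar ybar := by
      simpa using hasDerivAt_kinetic 0 ybar
    exact ((hd.comp ybar h1).const_mul (m : ℝ)).sub_const _
  have habs : ∀ ε ∈ Ioo 0 r, |ε| < r := fun ε hε => by rw [abs_of_pos hε.1]; exact hε.2
  have hA : ∀ ε ∈ Ioo 0 r, ∀ y t, |y - ybar| < r → |t - tbar| < r →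
      |((P (ι ε (y, t))).2.1 - t - n * S.T) - (m * per (y ^ 2 / 2) - n * S.T)| ≤ L * ε := by
    intro ε hε y t h1 h2
    have h3 := (htime _ _).trans (hdist ε y t y (habs ε hε) h1 h2 h1)
    rw [htime0 y t h1 h2, sub_self, abs_zero, zero_add, abs_of_pos hε.1] at h3
    rwa [show (P (ι ε (y, t))).2.1 - t - n * S.T - (m * per (y ^ 2 / 2) - n * S.T)
      = (P (ι ε (y, t))).2.1 - (t + m * per (y ^ 2 / 2)) by ring]
  have hB : ∀ ε ∈ Ioo 0 r, ∀ y t, |y - ybar| < r → |t - tbar| < r →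
      |(P (ι ε (y, t))).2.2.2 - S.melnikov q n t| ≤ L * (|y - ybar| + ε) := by
    intro ε hε y t h1 h2
    have h3 := (hu _ _).trans (hdist ε y t ybar (habs ε hε) h1 h2 (by simpa using hr0))
    rwa [hu0 t h2, abs_of_pos hε.1] at h3
  obtain ⟨ε₀, hε₀, K, hε₀r, hK⟩ := exists_common_zero (r := r) (L := L)
    (A := fun ε p => (P (ι ε p)).2.1 - p.2 - n * S.T) (B := fun ε p => (P (ι ε p)).2.2.2)
    hr0 L.2 hf (by rw [hres, sub_self]) (mul_pos hm' (mul_pos hd0 hy.1))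
    (differentiableAt_of_deriv_ne_zero hsimple).hasDerivAt hzero hsimple
    (fun ε hε => ((hcont ε hε).snd.fst.sub continuousOn_snd).sub continuousOn_const)
    (fun ε hε => (hcont ε hε).snd.snd.snd) hA hB
  refine ⟨ε₀, hε₀, K, fun ε hε => ?_⟩
  obtain ⟨y, t, h1, h2, h3, h4, h5, h6⟩ := hK ε hε
  refine ⟨y, t, h1, h2, (P (ι ε (y, t))).2.2.2, ?_⟩
  have h7 := hPι ε y t (habs ε ⟨hε.1, hε.2.trans_le hε₀r⟩) h3 h4
  obtain ⟨i1, i2, i3, i4⟩ := h7.invariants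
  have hypos : 0 < y := (hyI y h3).1
  -- With u' = 0 the energy balance reads y'² = y², and positivity leaves y' = y; the vanishing of
  -- `A` gives the time.
  have hw : P (ι ε (y, t)) = ((0, y), t + n * S.T, ε, (P (ι ε (y, t))).2.2.2) := by
    refine Prod.ext (Prod.ext (i2 rfl) ?_) (Prod.ext ?_ (Prod.ext i1 rfl))
    · rw [h6] at i3
      have h8 := i4 hypos
      have h9 : ((P (ι ε (y, t))).1.2 - y) * ((P (ι ε (y, t))).1.2 + y) = 0 := by
        simp only [hι] at i3 ⊢
        linarith
      rcases mul_eq_zero.1 h9 with h | h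
      · exact sub_eq_zero.1 h
      · linarith
    · simp only at h5 ⊢
      linarith
  exact hw ▸ h7

end PWHamiltonian

end

theorem theorem1 (S : PWHamiltonian) (zp zm : ℝ × ℝ) (c₁ : ℝ) (γ₁ γ₂ : ℝ → ℝ × ℝ)
    (hC1 : S.HasSaddles zp zm c₁)
    (hC2 : S.HasFoldFold)
    (hC3 : S.HasHeteroclinics zp zm c₁ γ₁ γ₂)
    (hC4 : S.HasPeriodicOrbits c₁ (heteroclinicLoop zp zm γ₁ γ₂))
    (hC5 : S.HasIncreasingPeriod c₁ (heteroclinicLoop zp zm γ₁ γ₂))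
    (n m : ℕ) (hn : 0 < n) (hm : 0 < m) (hnm : Nat.Coprime n m)
    (ybar tbar : ℝ) (hy : ybar ∈ Set.Ioo 0 √(2 * c₁)) (ht : tbar ∈ Set.Icc 0 S.T)
    (hα : S.alpha ybar = (n : ℝ) / m * S.T)
    (q : ℝ → ℝ × ℝ) (hq : S.IsSolution 0 q) (hq0 : q 0 = (0, ybar))
    (hzero : S.melnikov q n tbar = 0) (hsimple : deriv (S.melnikov q n) tbar ≠ 0) :
    ∃ ε₀ > 0, ∃ K : ℝ, ∀ ε ∈ Set.Ioo 0 ε₀, ∃ y₀ t₀ : ℝ,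
      S.IsNMPeriodic c₁ ε n m y₀ t₀ ∧ |y₀ - ybar| ≤ K * ε ∧ |t₀ - tbar| ≤ K * ε := by
  obtain ⟨per, hper, hdiff, hpos⟩ := hC5
  have h0 := hC2.level
  have hsq : ∀ y ∈ Ioo 0 √(2 * c₁), y ^ 2 / 2 ∈ Ioo 0 c₁ := fun y hy => by
    have h1 := (Real.lt_sqrt hy.1.le).1 hy.2
    have h2 := pow_pos hy.1 2
    exact ⟨by linarith, by linarith⟩
  -- The point (0, y) lies on the level y²/2, so the differentiable period function describes the
  -- orbit through it.
  have hQ : ∀ y ∈ Ioo 0 √(2 * c₁), ∃ Q, S.IsSolution 0 Q ∧ Q 0 = (0, y) ∧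
      IsLeast {s : ℝ | 0 < s ∧ Function.Periodic Q s} (per (y ^ 2 / 2)) := fun y hy =>
    (hper _ (hsq y hy)).exists_solution (PWHamiltonian.switching_mem_levelSet hC1 h0 hC3 hy)
  -- The resonance is given for the integral α; identifying α with the least period transfers it to
  -- `per`, whose derivative is known to be positive.
  have hres : m * per (ybar ^ 2 / 2) = n * S.T := by
    obtain ⟨Q, h1, h2, h3⟩ := hQ ybar hy
    rw [← PWHamiltonian.alpha_eq_period h0 h1 hy.1 h2 h3, hα]
    have : (m : ℝ) ≠ 0 := Nat.cast_ne_zero.2 hm.ne'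
    field_simp
  have hd := (hdiff.differentiableAt (isOpen_Ioo.mem_nhds (hsq ybar hy))).hasDerivAt
  obtain ⟨ε₀, hε₀, K, hK⟩ := PWHamiltonian.exists_closed_passIter hm hy hq hq0 hQ hd
    (hpos _ (hsq ybar hy)) hres hzero hsimple
  refine ⟨ε₀, hε₀, K, fun ε hε => ?_⟩
  obtain ⟨y, t, h1, h2, u, h3⟩ := hK ε hε
  exact ⟨y, t, h3.isNMPeriodic hm, h1, h2⟩
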